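/- **Setting.** Let $f:\mathbb{R}^d\to\mathbb{R}$ have minimizer $\theta^\star$ and let $\nabla F:\mathbb{R}^d\times\mathsf Z\to\mathbb{R}^d$ be a jointly measurable stochastic gradient, where $\xi\sim\mathbb{P}_\xi$ on the measurable space $\mathsf Z$. Let $p\ge 2$ be real and assume the following. 1. ($\mu$-strong convexity) $f$ is $C^1$, $\mu>0$, and $\frac{\mu}{2}\|\theta-\theta'\|^2\le f(\theta)-f(\theta')-\langle\nabla f(\theta'),\theta-\theta'\rangle$ for all $\theta,\theta'$. 2. (Smoothness) $f$ is $C^4$, $\|\nabla f(\theta)-\nabla f(\theta')\|\le L_2\|\theta-\theta'\|$, $\|\nabla^3f(\theta)\|\le L_3$ and $\|\nabla^4 f(\theta)\|\le L_4$ for all $\theta,\theta'$, with $L_2,L_3,L_4\ge0$. 3. (Noise, order $3p$) $\mathsf{E}[\nabla F(\theta,\xi)]=\nabla f(\theta)$ for all $\theta$; $\mathsf{E}^{1/(3p)}[\|\nabla F(\theta^\star,\xi)\|^{3p}]\le\tau_{3p}$ with $\tau_{3p}\ge 0$; and for some $L_1>0$, all integers $q$ with $2\le q\le 3p$ and all $\theta_1,\theta_2$,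 $$\mathsf{E}[\|\nabla F(\theta_1,\xi)-\nabla F(\theta_2,\xi)\|^q]\le L_1^{q-1}\|\theta_1-\theta_2\|^{q-2}\langle\nabla f(\theta_1)-\nabla f(\theta_2),\theta_1-\theta_2\rangle .$$ Put $L=\max(L_1,L_2,L_3,L_4)$. For a step size $\gamma>0$ and an initial distribution $\nu$, let $$\theta^{(\gamma)}_{k+1}=\theta^{(\gamma)}_k-\gamma\nabla F(\theta^{(\gamma)}_k,\xi_{k+1}),\qquad \theta_0^{(\gamma)}=\theta_0\sim\nu,$$ where $(\xi_k)$ is i.i.d. with law $\mathbb{P}_\xi$ and independent of $\theta_0$. Write $\mathsf{E}_\nu$ for the expectation. 4. (Moment bounds, order $3p$) With constants $D_{3p},C_{3p}\ge2$, for every $\gamma\in(0,1/(LC_{3p})]$, every $\nu$ and every $k\ge 0$, $$\mathsf{E}_\nu^{2/(3p)}[\|\theta_k^{(\gamma)}-\theta^\star\|^{3p}]\le(1-\gamma\mu)^k\,\mathsf{E}_\nu^{2/(3p)}[\|\theta_0-\theta^\star\|^{3p}]+D_{3p}\gamma\tau_{3p}^2/\mu ,$$ and $\bigl(\int\|\theta-\theta^\star\|^{3p}\,\pi_\gamma(\mathrm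 d\theta)\bigr)^{2/(3p)}\le D_{3p}\gamma\tau_{3p}^2/\mu$ for the invariant distribution $\pi_\gamma$ of the Markov chain $(\theta_k^{(\gamma)})$. Let $\bar\theta_n^{(\gamma)}=\frac1n\sum_{k=n+1}^{2n}\theta_k^{(\gamma)}$ and let $\bar\theta_n^{(RR)}=2\bar\theta_n^{(\gamma)}-\bar\theta_n^{(2\gamma)}$ be the Richardson–Romberg estimator, the two chains being driven by the same $\theta_0$ and the same $(\xi_k)$. Put $H^\star=\nabla^2f(\theta^\star)$, $\Sigma_\varepsilon^\star=\mathsf{E}[\nabla F(\theta^\star,\xi)^{\otimes2}]$ and $$\begin{aligned}\mathcal R_5(n,\gamma)={}&\Bigl(\frac{(1-\gamma\mu)^{(n+1)/2}}{\gamma n}+\frac{Lp(1-\gamma\mu)^{(n+1)/2}}{\mu^{1/2}\gamma^{1/2}n}\Bigr)\mathsf{E}_\nu^{1/p}[\|\theta_0-\theta^\star\|^{p}]\\&+\frac{Lp^2(1-\gamma\mu)^{(n+1)/2}}{\gamma\mu^2}\mathsf{E}_\nu^{1/p}[\|\theta_0-\theta^\star\|^{2p}]+\frac{L(1-\gamma\mu)^{3n/2}}{\gamma\mu}\mathsf{E}_\nu^{1/p}[\|\theta_0-\theta^\star\|^{3p}].\end{aligned}$$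 **Statement.** There is an absolute constant $c_0>0$ and, for all values of $p,\mu,L,\tau_{3p},D_{3p},C_{3p}$, a constant $K\ge 0$ depending only on these six numbers (in particular not on $n$, $\nu$, $d$ or $f$), such that under the assumptions above, for every initial distribution $\nu$, every $n\ge(LC_{3p})^2$ and the step size $\gamma=n^{-1/2}$, $$\mathsf{E}_\nu^{1/p}\bigl[\|H^\star(\bar\theta_n^{(RR)}-\theta^\star)\|^p\bigr]\le c_0\frac{\sqrt{\operatorname{Tr}\Sigma_\varepsilon^\star}\,p^{1/2}}{n^{1/2}}+K n^{-3/4}+c_0\,\mathcal R_5(n,n^{-1/2}),$$ where both sides may be $+\infty$ if $\nu$ has infinite moments. -/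

import Mathlib

open MeasureTheory ProbabilityTheory
open scoped ENNReal

noncomputable section

/-! ### Moments, the objective function -/

/-- The absolute moment `E[‖X‖ ^ q]`, as an element of `[0, ∞]`. -/
def absMoment {Ω E : Type*} [MeasurableSpace Ω] [NormedAddCommGroup E]
    (P : Measure Ω) (X : Ω → E) (q : ℝ) : ℝ≥0∞ :=
  ∫⁻ ω, ‖X ω‖ₑ ^ q ∂P

/-- `f` is continuously differentiable and `μ`-strongly convex on `ℝ^d`, with `μ > 0`. -/
structure IsStronglyConvex {d : ℕ} (f : EuclideanSpace ℝ (Fin d) → ℝ) (μ : ℝ) : Prop where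
  pos : 0 < μ
  contDiff : ContDiff ℝ 1 f
  lower_bound : ∀ θ θ' : EuclideanSpace ℝ (Fin d),
    μ / 2 * ‖θ - θ'‖ ^ 2 ≤ f θ - f θ' - inner ℝ (gradient f θ') (θ - θ')

/-- `f` is four times continuously differentiable, its gradient is `L₂`-Lipschitz, and its third and
fourth derivatives are bounded by `L₃` and `L₄` (in the operator norm of multilinear forms). -/
structure IsSmoothObjective {d : ℕ} (f : EuclideanSpace ℝ (Fin d) → ℝ) (L₂ L₃ L₄ : ℝ) :
    Prop where
  contDiff : ContDiff ℝ 4 f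
  nonneg₂ : 0 ≤ L₂
  nonneg₃ : 0 ≤ L₃
  nonneg₄ : 0 ≤ L₄
  gradient_lipschitz : ∀ θ θ' : EuclideanSpace ℝ (Fin d),
    ‖gradient f θ - gradient f θ'‖ ≤ L₂ * ‖θ - θ'‖
  third_bound : ∀ θ, ‖iteratedFDeriv ℝ 3 f θ‖ ≤ L₃
  fourth_bound : ∀ θ, ‖iteratedFDeriv ℝ 4 f θ‖ ≤ L₄

/-- The Hessian `∇² f(θ)`, as a linear operator on `ℝ^d`. -/
def hessian {d : ℕ} (f : EuclideanSpace ℝ (Fin d) → ℝ) (θ : EuclideanSpace ℝ (Fin d)) :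
    EuclideanSpace ℝ (Fin d) →L[ℝ] EuclideanSpace ℝ (Fin d) :=
  fderiv ℝ (gradient f) θ

/-! ### The stochastic gradient -/

/-- The conditions of order `r` on the stochastic gradient `gradF θ z` (written `∇F(θ, z)`), where
`z` has law `Pξ`: it is measurable and unbiased for `∇ f`, its `r`-th moment at the minimizer `θs` is
at most `τ ^ r`, and it satisfies the `q`-th order co-coercivity inequality with constant `L₁` for
every integer `q` with `2 ≤ q ≤ r`. -/
structure IsStochasticGradient {d : ℕ} {Z : Type*} [MeasurableSpace Z] (r : ℝ) (Pξ : Measure Z)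
    (f : EuclideanSpace ℝ (Fin d) → ℝ)
    (gradF : EuclideanSpace ℝ (Fin d) → Z → EuclideanSpace ℝ (Fin d))
    (θs : EuclideanSpace ℝ (Fin d)) (τ L₁ : ℝ) : Prop where
  measurable : Measurable (Function.uncurry gradF)
  integrable : ∀ θ, Integrable (gradF θ) Pξ
  unbiased : ∀ θ, ∫ z, gradF θ z ∂Pξ = gradient f θ
  τ_nonneg : 0 ≤ τ
  moment_le : absMoment Pξ (gradF θs) r ^ (1 / r) ≤ ENNReal.ofReal τ
  L₁_pos : 0 < L₁
  cocoercive : ∀ q : ℕ, 2 ≤ q → (q : ℝ) ≤ r → ∀ θ₁ θ₂ : EuclideanSpace ℝ (Fin d),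
    absMoment Pξ (fun z => gradF θ₁ z - gradF θ₂ z) q ≤
      ENNReal.ofReal (L₁ ^ (q - 1) * ‖θ₁ - θ₂‖ ^ (q - 2) *
        inner ℝ (gradient f θ₁ - gradient f θ₂) (θ₁ - θ₂))

/-- The matrix `E[∇F(θs, ξ) ⊗ ∇F(θs, ξ)]`, the noise covariance at the minimizer `θs`. -/
def noiseCov {d : ℕ} {Z : Type*} [MeasurableSpace Z] (Pξ : Measure Z)
    (gradF : EuclideanSpace ℝ (Fin d) → Z → EuclideanSpace ℝ (Fin d))
    (θs : EuclideanSpace ℝ (Fin d)) : Matrix (Fin d) (Fin d) ℝ :=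
  Matrix.of fun i j => ∫ z, gradF θs z i * gradF θs z j ∂Pξ

/-! ### Stochastic gradient descent with constant step size -/

/-- The SGD iterates `θ_{k+1} = θ_k - γ ∇F(θ_k, z_{k+1})` started from `θ₀`. -/
def sgdIter {d : ℕ} {Z : Type*}
    (gradF : EuclideanSpace ℝ (Fin d) → Z → EuclideanSpace ℝ (Fin d)) (γ : ℝ)
    (θ₀ : EuclideanSpace ℝ (Fin d)) (z : ℕ → Z) : ℕ → EuclideanSpace ℝ (Fin d)
  | 0 => θ₀
  | k + 1 => sgdIter gradF γ θ₀ z k - γ • gradF (sgdIter gradF γ θ₀ z k) (z (k + 1))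

/-- The Polyak–Ruppert average `n⁻¹ ∑_{k=n+1}^{2n} θ_k`. -/
def polyakRuppert {d : ℕ} {Z : Type*}
    (gradF : EuclideanSpace ℝ (Fin d) → Z → EuclideanSpace ℝ (Fin d)) (γ : ℝ)
    (θ₀ : EuclideanSpace ℝ (Fin d)) (z : ℕ → Z) (n : ℕ) : EuclideanSpace ℝ (Fin d) :=
  (n : ℝ)⁻¹ • ∑ k ∈ Finset.Icc (n + 1) (2 * n), sgdIter gradF γ θ₀ z k

/-- The Richardson–Romberg estimator: twice the average with step size `γ` minus the average with
step size `2γ`, both chains being driven by the same noise and the same starting point. -/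
def richardsonRomberg {d : ℕ} {Z : Type*}
    (gradF : EuclideanSpace ℝ (Fin d) → Z → EuclideanSpace ℝ (Fin d)) (γ : ℝ)
    (θ₀ : EuclideanSpace ℝ (Fin d)) (z : ℕ → Z) (n : ℕ) : EuclideanSpace ℝ (Fin d) :=
  (2 : ℝ) • polyakRuppert gradF γ θ₀ z n - polyakRuppert gradF (2 * γ) θ₀ z n

/-- The Markov kernel of SGD with step size `γ`: `Q_γ(θ, ·)` is the law of `θ - γ ∇F(θ, ξ)`. -/
def sgdKernel {d : ℕ} {Z : Type*} [MeasurableSpace Z] (Pξ : Measure Z)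
    (gradF : EuclideanSpace ℝ (Fin d) → Z → EuclideanSpace ℝ (Fin d)) (γ : ℝ) :
    Kernel (EuclideanSpace ℝ (Fin d)) (EuclideanSpace ℝ (Fin d)) :=
  (Kernel.id ×ₖ Kernel.const (EuclideanSpace ℝ (Fin d)) Pξ).map fun x => x.1 - γ • gradF x.1 x.2

/-- The moment condition of order `r` on SGD with constants `Clast` and `Cstep`. For all step sizes
`γ ∈ (0, 1 / (L Cstep)]` and all initial distributions `ν`, the `r`-th moment of the error of the
iterates (on the canonical space, under `ν ⊗ Pξ^ℕ`) contracts geometrically up to a term of order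
`γ`, and the `r`-th moment of the error under the invariant distribution is of order `γ`. -/
structure HasMomentBounds {d : ℕ} {Z : Type*} [MeasurableSpace Z] (r : ℝ)
    (Pξ : Measure Z) [IsProbabilityMeasure Pξ]
    (gradF : EuclideanSpace ℝ (Fin d) → Z → EuclideanSpace ℝ (Fin d))
    (θs : EuclideanSpace ℝ (Fin d)) (μ L τ Clast Cstep : ℝ) : Prop where
  two_le_last : 2 ≤ Clast
  two_le_step : 2 ≤ Cstep
  iterates : ∀ γ : ℝ, 0 < γ → γ ≤ 1 / (L * Cstep) →
    ∀ ν : Measure (EuclideanSpace ℝ (Fin d)), IsProbabilityMeasure ν → ∀ k : ℕ,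
      absMoment (ν.prod (Measure.infinitePi fun _ : ℕ => Pξ))
          (fun x => sgdIter gradF γ x.1 x.2 k - θs) r ^ (2 / r) ≤
        ENNReal.ofReal ((1 - γ * μ) ^ k) * absMoment ν (fun θ => θ - θs) r ^ (2 / r) +
          ENNReal.ofReal (Clast * γ * τ ^ 2 / μ)
  stationary : ∀ γ : ℝ, 0 < γ → γ ≤ 1 / (L * Cstep) →
    ∀ π : Measure (EuclideanSpace ℝ (Fin d)), IsProbabilityMeasure π →
      (sgdKernel Pξ gradF γ).Invariant π →
      absMoment π (fun θ => θ - θs) r ^ (2 / r) ≤ ENNReal.ofReal (Clast * γ * τ ^ 2 / μ)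

/-- The random inputs of SGD on a probability space: a starting point `θ₀` with law `ν` and an
i.i.d. noise sequence with law `Pξ`, independent of `θ₀`. -/
structure IsSGDInput {d : ℕ} {Z Ω : Type*} [MeasurableSpace Z] [MeasurableSpace Ω]
    (P : Measure Ω) (ν : Measure (EuclideanSpace ℝ (Fin d))) (Pξ : Measure Z)
    (θ₀ : Ω → EuclideanSpace ℝ (Fin d)) (ξ : ℕ → Ω → Z) : Prop where
  measurable_init : Measurable θ₀
  measurable_noise : ∀ k, Measurable (ξ k)
  law_init : P.map θ₀ = ν
  law_noise : ∀ k, P.map (ξ k) = Pξ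
  indep_noise : iIndepFun ξ P
  indep_init : IndepFun θ₀ (fun ω k => ξ k ω) P

/-- The exponentially small remainder, which carries the dependence on the initial distribution. -/
def remainder {d : ℕ} (p μ L : ℝ) (ν : Measure (EuclideanSpace ℝ (Fin d)))
    (θs : EuclideanSpace ℝ (Fin d)) (n : ℕ) (γ : ℝ) : ℝ≥0∞ :=
  ENNReal.ofReal ((1 - γ * μ) ^ (((n : ℝ) + 1) / 2) / (γ * n)) *
      absMoment ν (fun θ => θ - θs) p ^ (1 / p) +
    ENNReal.ofReal (L * p * (1 - γ * μ) ^ (((n : ℝ) + 1) / 2) / (√μ * √γ * n)) *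
      absMoment ν (fun θ => θ - θs) p ^ (1 / p) +
    ENNReal.ofReal (L * (1 - γ * μ) ^ (((n : ℝ) + 1) / 2) * p ^ 2 / (γ * μ ^ 2)) *
      absMoment ν (fun θ => θ - θs) (2 * p) ^ (1 / p) +
    ENNReal.ofReal (L * (1 - γ * μ) ^ (3 / 2 * (n : ℝ)) / (γ * μ)) *
      absMoment ν (fun θ => θ - θs) (3 * p) ^ (1 / p)

end

/-! Write x for the error of an iterate, G for the stochastic gradient used in the step, g for the
true gradient, e for the stochastic gradient at the minimizer with the same noise, and T for the
second derivative of g at the minimizer. Solving a step for Hx and summing leaves a telescoping sum,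
the noise G, and the Taylor term T(x, x)/2, which is of order γ and causes the bias. It is removed
by the bilinear solution Φ of Φ(H·, ·) + Φ(·, H·) = T (`exists_sylvester_solution`): the increment
of Φ(x, x) along one step is -γ(Φ(x, G) + Φ(G, x)) + γ²Φ(G, G), so T(x, x) also telescopes, up to
martingale increments, cubic errors and γΦ(G, G). Replacing G by e in the last term gives
(`GradientModel.sum_hessian_apply_eq`) average of Hx = -average of e - (γ/2) average of Φ(e, e) +
remainder.

Both chains see the same e, so the combination 2·(γ) - (2γ) cancels the Φ(e, e) term pathwise, not
merely in expectation, and keeps -average of e (`GradientModel.lpLE_richardsonRomberg`).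

With t = n^(-1/4) we have γ = t² and n = t⁻⁴, and once the start is forgotten x is of order t. Each
remainder term is then O(t³) = O(n^(-3/4)): x/(γn), martingales of size |x|/√n, cubic terms |x|³,
and γ(Φ(G, G) - Φ(e, e)) of size γ|x|. The average of e is bounded by a Rosenthal inequality
(`lpLE_iid_sum`) whose variance term grows only like √p; it rests on a second-order expansion of the
q-th power of the norm (`norm_add_rpow_le`).

The dependence on the start is treated for deterministic starting points first. The resulting
polynomial in ‖θ₀ - θ*‖ is absorbed into the last two terms of the allowed remainder
(`absorb_large`); finitely many small n are covered by a crude bound exponential in n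
(`absorb_small`). Integrating over the start finishes the proof (`absMoment_le_of_forall_init`). -/

/-! ### The Sylvester equation for bilinear maps. -/

section Sylvester

set_option maxSynthPendingDepth 3

variable {E : Type*} [NormedAddCommGroup E] [InnerProductSpace ℝ E]

/-- The Sylvester operator `Φ ↦ Φ(H·, ·) + Φ(·, H·)` on bilinear maps. -/
noncomputable def sylvesterMap (H : E →L[ℝ] E) : (E →L[ℝ] E →L[ℝ] E) →ₗ[ℝ] (E →L[ℝ] E →L[ℝ] E) where
  toFun Φ := Φ ∘L H + (ContinuousLinearMap.compL ℝ E E E).flip H ∘L Φ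
  map_add' Φ Ψ := by ext x y; simp; abel
  map_smul' c Φ := by ext x y; simp

lemma sylvesterMap_apply (H : E →L[ℝ] E) (Φ : E →L[ℝ] E →L[ℝ] E) (x y : E) :
    sylvesterMap H Φ x y = Φ (H x) y + Φ x (H y) := by
  simp [sylvesterMap]

lemma norm_sub_smul_sq_le {H : E →L[ℝ] E} {μ L δ : ℝ} (hδ : 0 ≤ δ)
    (hH : ∀ v, μ * ‖v‖ ^ 2 ≤ inner ℝ (H v) v) (hL : ‖H‖ ≤ L) (v : E) :
    ‖v - δ • H v‖ ^ 2 ≤ (1 - 2 * δ * μ + δ ^ 2 * L ^ 2) * ‖v‖ ^ 2 := by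
  have h1 : ‖H v‖ ≤ L * ‖v‖ := (H.le_opNorm v).trans (by gcongr)
  have h2 : ‖H v‖ ^ 2 ≤ L ^ 2 * ‖v‖ ^ 2 := by rw [← mul_pow]; gcongr
  rw [norm_sub_sq_real, inner_smul_right, norm_smul, mul_pow, Real.norm_eq_abs, sq_abs,
    real_inner_comm]
  nlinarith [hH v, mul_le_mul_of_nonneg_left (hH v) hδ,
    mul_le_mul_of_nonneg_left h2 (sq_nonneg δ)]

/-- Put P = 1 - δH. Expanding gives Φ = Φ(P·, P·) + δS(Φ) - δ²Φ(H·, H·), with S the Sylvester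
operator, and coercivity makes P a contraction for small δ. With δ = μ/(2L²) the terms in Φ on the
right have total factor 1 - δμ. The bound is dimension-free and does not use symmetry of H. -/
lemma norm_le_norm_sylvesterMap {H : E →L[ℝ] E} {μ L : ℝ} (hμ : 0 < μ) (hL0 : 0 < L)
    (hH : ∀ v, μ * ‖v‖ ^ 2 ≤ inner ℝ (H v) v) (hL : ‖H‖ ≤ L) (Φ : E →L[ℝ] E →L[ℝ] E) :
    μ * ‖Φ‖ ≤ ‖sylvesterMap H Φ‖ := by
  set δ : ℝ := μ / (2 * L ^ 2) with hδ
  have hδ0 : 0 < δ := by positivity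
  have hδL : δ * L ^ 2 = μ / 2 := by rw [hδ]; field_simp
  set a : ℝ := 1 - 2 * δ * μ + δ ^ 2 * L ^ 2 with ha
  -- In the trivial space `a` may be negative; otherwise a nonzero vector shows `0 ≤ a`, which the
  -- square root needs.
  rcases subsingleton_or_nontrivial E with hE | hE
  · have : Φ = 0 := by ext x; simp [Subsingleton.elim x 0]
    simp [this]
  have ha0 : 0 ≤ a := by
    obtain ⟨v, hv⟩ := exists_ne (0 : E)
    have h := (sq_nonneg _).trans (norm_sub_smul_sq_le hδ0.le hH hL v)
    exact nonneg_of_mul_nonneg_left h (by positivity)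
  have hP : ∀ v, ‖v - δ • H v‖ ≤ √a * ‖v‖ := fun v => by
    rw [← Real.sqrt_sq (norm_nonneg v), ← Real.sqrt_mul ha0]
    exact Real.le_sqrt_of_sq_le (norm_sub_smul_sq_le hδ0.le hH hL v)
  have key : ‖Φ‖ ≤ a * ‖Φ‖ + δ * ‖sylvesterMap H Φ‖ + δ ^ 2 * L ^ 2 * ‖Φ‖ := by
    refine Φ.opNorm_le_bound₂ (by positivity) fun x y => ?_
    have e : Φ x y = Φ (x - δ • H x) (y - δ • H y) + δ • sylvesterMap H Φ x y
        - δ ^ 2 • Φ (H x) (H y) := by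
      rw [sylvesterMap_apply]
      simp only [map_sub, map_smul, sub_apply, smul_apply,
        smul_sub, smul_add, smul_smul, pow_two]
      abel
    have b1 : ‖Φ (x - δ • H x) (y - δ • H y)‖ ≤ a * ‖Φ‖ * ‖x‖ * ‖y‖ := by
      calc _ ≤ ‖Φ‖ * ‖x - δ • H x‖ * ‖y - δ • H y‖ := Φ.le_opNorm₂ _ _
        _ ≤ ‖Φ‖ * (√a * ‖x‖) * (√a * ‖y‖) := by gcongr <;> apply hP
        _ = (√a * √a) * ‖Φ‖ * ‖x‖ * ‖y‖ := by ring
        _ = _ := by rw [Real.mul_self_sqrt ha0]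
    have b2 : ‖δ • sylvesterMap H Φ x y‖ ≤ δ * ‖sylvesterMap H Φ‖ * ‖x‖ * ‖y‖ := by
      rw [norm_smul, Real.norm_of_nonneg hδ0.le, mul_assoc, mul_assoc, ← mul_assoc ‖_‖]
      gcongr
      exact ContinuousLinearMap.le_opNorm₂ _ _ _
    have b3 : ‖δ ^ 2 • Φ (H x) (H y)‖ ≤ δ ^ 2 * L ^ 2 * ‖Φ‖ * ‖x‖ * ‖y‖ := by
      rw [norm_smul, Real.norm_of_nonneg (by positivity)]
      calc _ ≤ δ ^ 2 * (‖Φ‖ * ‖H x‖ * ‖H y‖) := by gcongr; exact Φ.le_opNorm₂ _ _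
        _ ≤ δ ^ 2 * (‖Φ‖ * (L * ‖x‖) * (L * ‖y‖)) := by
          gcongr <;> exact (H.le_opNorm _).trans (by gcongr)
        _ = _ := by ring
    rw [e]
    calc _ ≤ ‖Φ (x - δ • H x) (y - δ • H y)‖ + ‖δ • sylvesterMap H Φ x y‖
          + ‖δ ^ 2 • Φ (H x) (H y)‖ := (norm_sub_le _ _).trans (by gcongr; exact norm_add_le _ _)
      _ ≤ _ := by nlinarith
  have e1 : a + δ ^ 2 * L ^ 2 = 1 - δ * μ := by
    rw [ha]; linear_combination (2 * δ) * hδL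
  have : δ * (μ * ‖Φ‖) ≤ δ * ‖sylvesterMap H Φ‖ := by
    have : a * ‖Φ‖ + δ ^ 2 * L ^ 2 * ‖Φ‖ = (1 - δ * μ) * ‖Φ‖ := by rw [← e1]; ring
    nlinarith
  exact le_of_mul_le_mul_left this hδ0

/-- The a priori bound makes the operator injective, hence surjective in finite dimension, and
bounds the solution. -/
lemma exists_sylvester_solution [FiniteDimensional ℝ E] {H : E →L[ℝ] E} {μ L : ℝ} (hμ : 0 < μ)
    (hL0 : 0 < L) (hH : ∀ v, μ * ‖v‖ ^ 2 ≤ inner ℝ (H v) v) (hL : ‖H‖ ≤ L)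
    (T : E →L[ℝ] E →L[ℝ] E) :
    ∃ Φ : E →L[ℝ] E →L[ℝ] E, ‖Φ‖ ≤ ‖T‖ / μ ∧ ∀ x y, Φ (H x) y + Φ x (H y) = T x y := by
  have inj : Function.Injective (sylvesterMap H) := by
    rw [injective_iff_map_eq_zero]
    intro Φ hΦ
    have := norm_le_norm_sylvesterMap hμ hL0 hH hL Φ
    rw [hΦ, norm_zero] at this
    exact norm_le_zero_iff.1 (nonpos_of_mul_nonpos_right this hμ)
  obtain ⟨Φ, hΦ⟩ := LinearMap.injective_iff_surjective.1 inj T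
  refine ⟨Φ, ?_, fun x y => by rw [← hΦ, sylvesterMap_apply]⟩
  rw [le_div_iff₀ hμ, mul_comm, ← hΦ]
  exact norm_le_norm_sylvesterMap hμ hL0 hH hL Φ

end Sylvester

/-! ### Taylor bounds along segments, with non-optimal constants. -/

section Taylor

set_option maxSynthPendingDepth 3

variable {E F : Type*} [NormedAddCommGroup E] [NormedSpace ℝ E]
  [NormedAddCommGroup F] [NormedSpace ℝ F]

lemma norm_image_sub_le_of_forall_norm_fderiv_le {g : E → F} (hg : Differentiable ℝ g) {C : ℝ}
    (hC : ∀ x, ‖fderiv ℝ g x‖ ≤ C) (x y : E) : ‖g y - g x‖ ≤ C * ‖y - x‖ :=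
  convex_univ.norm_image_sub_le_of_norm_fderiv_le (fun z _ => hg z) (fun z _ => hC z)
    (Set.mem_univ x) (Set.mem_univ y)

lemma norm_taylor_one_le {g : E → F} (hg : ContDiff ℝ 2 g) {C : ℝ}
    (hC : ∀ x, ‖fderiv ℝ (fderiv ℝ g) x‖ ≤ C) (a x : E) :
    ‖g (a + x) - g a - fderiv ℝ g a x‖ ≤ C * ‖x‖ ^ 2 := by
  have hD : Differentiable ℝ (fderiv ℝ g) :=
    (hg.fderiv_right (m := 1) (by norm_num)).differentiable (by norm_num)
  have hC0 : 0 ≤ C := (norm_nonneg _).trans (hC a)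
  have hd : ∀ t : ℝ, HasDerivAt (fun t : ℝ => g (a + t • x) - t • fderiv ℝ g a x)
      (fderiv ℝ g (a + t • x) x - fderiv ℝ g a x) t := fun t => by
    have h1 : HasDerivAt (fun t : ℝ => a + t • x) x t := by
      simpa using ((hasDerivAt_id t).smul_const x).const_add a
    have h2 := ((hg.differentiable (by norm_num)) (a + t • x)).hasFDerivAt.comp_hasDerivAt t h1
    exact h2.sub (by simpa using (hasDerivAt_id t).smul_const (fderiv ℝ g a x))
  have := norm_image_sub_le_of_norm_deriv_le_segment_01' (C := C * ‖x‖ ^ 2)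
    (fun t _ => (hd t).hasDerivWithinAt) fun t ht => by
      rw [← sub_apply]
      calc _ ≤ ‖fderiv ℝ g (a + t • x) - fderiv ℝ g a‖ * ‖x‖ := ContinuousLinearMap.le_opNorm _ _
        _ ≤ C * ‖a + t • x - a‖ * ‖x‖ := by
          gcongr; exact norm_image_sub_le_of_forall_norm_fderiv_le hD hC _ _
        _ = t * (C * ‖x‖ ^ 2) := by
          rw [add_sub_cancel_left, norm_smul, Real.norm_of_nonneg ht.1]; ring
        _ ≤ 1 * (C * ‖x‖ ^ 2) := by gcongr; exact ht.2.le
        _ = _ := one_mul _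
  simpa [sub_right_comm] using this

/-- The derivative of the remainder along the segment is the first-order remainder of `fderiv ℝ g`,
so the first-order bound and the mean value inequality suffice. -/
lemma norm_taylor_two_le {g : E → F} (hg : ContDiff ℝ 3 g) {C : ℝ}
    (hC : ∀ x, ‖fderiv ℝ (fderiv ℝ (fderiv ℝ g)) x‖ ≤ C) (a x : E) :
    ‖g (a + x) - g a - fderiv ℝ g a x - (1 / 2 : ℝ) • fderiv ℝ (fderiv ℝ g) a x x‖
      ≤ C * ‖x‖ ^ 3 := by
  have hD : ContDiff ℝ 2 (fderiv ℝ g) := hg.fderiv_right (m := 2) (by norm_num)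
  have hC0 : 0 ≤ C := (norm_nonneg _).trans (hC a)
  have hd : ∀ t : ℝ, HasDerivAt (fun t : ℝ => g (a + t • x) - t • fderiv ℝ g a x
      - (t ^ 2 / 2) • fderiv ℝ (fderiv ℝ g) a x x)
      (fderiv ℝ g (a + t • x) x - fderiv ℝ g a x - t • fderiv ℝ (fderiv ℝ g) a x x) t := fun t => by
    have h1 : HasDerivAt (fun t : ℝ => a + t • x) x t := by
      simpa using ((hasDerivAt_id t).smul_const x).const_add a
    have h2 := ((hg.differentiable (by norm_num)) (a + t • x)).hasFDerivAt.comp_hasDerivAt t h1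
    have h3 : HasDerivAt (fun t : ℝ => t ^ 2 / 2) t t := by
      simpa using (hasDerivAt_pow 2 t).div_const 2
    exact (h2.sub (by simpa using (hasDerivAt_id t).smul_const (fderiv ℝ g a x))).sub
      (h3.smul_const _)
  have := norm_image_sub_le_of_norm_deriv_le_segment_01' (C := C * ‖x‖ ^ 3)
    (fun t _ => (hd t).hasDerivWithinAt) fun t ht => by
      have e : fderiv ℝ g (a + t • x) x - fderiv ℝ g a x - t • fderiv ℝ (fderiv ℝ g) a x x
          = (fderiv ℝ g (a + t • x) - fderiv ℝ g a - fderiv ℝ (fderiv ℝ g) a (t • x)) x := by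
        simp
      have ht1 : t ^ 2 ≤ 1 := pow_le_one₀ ht.1 ht.2.le
      rw [e]
      calc _ ≤ ‖fderiv ℝ g (a + t • x) - fderiv ℝ g a - fderiv ℝ (fderiv ℝ g) a (t • x)‖ * ‖x‖ :=
            ContinuousLinearMap.le_opNorm _ _
        _ ≤ C * ‖t • x‖ ^ 2 * ‖x‖ := by
          gcongr; exact norm_taylor_one_le hD hC _ _
        _ = t ^ 2 * (C * ‖x‖ ^ 3) := by
          rw [norm_smul, Real.norm_of_nonneg ht.1]; ring
        _ ≤ 1 * (C * ‖x‖ ^ 3) := by gcongr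
        _ = _ := one_mul _
  simpa [sub_right_comm] using this

end Taylor

/-! ### Consequences of smoothness and strong convexity. -/

section Objective

set_option maxSynthPendingDepth 3

variable {d : ℕ} {f : EuclideanSpace ℝ (Fin d) → ℝ} {μ L₂ L₃ L₄ : ℝ}

lemma gradient_eq_toDual_symm_comp (f : EuclideanSpace ℝ (Fin d) → ℝ) :
    gradient f = (InnerProductSpace.toDual ℝ (EuclideanSpace ℝ (Fin d))).symm ∘ fderiv ℝ f := rfl

lemma IsSmoothObjective.contDiff_gradient (h : IsSmoothObjective f L₂ L₃ L₄) :
    ContDiff ℝ 3 (gradient f) := by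
  rw [gradient_eq_toDual_symm_comp]
  exact (LinearIsometryEquiv.contDiff _).comp (h.contDiff.fderiv_right (m := 3) (by norm_num))

/-- The gradient is the derivative composed with the Riesz isometry, so bounds on derivatives of `f`
transfer without loss. -/
lemma norm_iteratedFDeriv_gradient (f : EuclideanSpace ℝ (Fin d) → ℝ) (n : ℕ)
    (x : EuclideanSpace ℝ (Fin d)) :
    ‖iteratedFDeriv ℝ n (gradient f) x‖ = ‖iteratedFDeriv ℝ (n + 1) f x‖ := by
  rw [gradient_eq_toDual_symm_comp, ← norm_iteratedFDeriv_fderiv]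
  exact LinearIsometryEquiv.norm_iteratedFDeriv_comp_left
    (InnerProductSpace.toDual ℝ (EuclideanSpace ℝ (Fin d))).symm _ _ _

lemma IsSmoothObjective.norm_fderiv_fderiv_gradient_le (h : IsSmoothObjective f L₂ L₃ L₄)
    (x : EuclideanSpace ℝ (Fin d)) : ‖fderiv ℝ (fderiv ℝ (gradient f)) x‖ ≤ L₃ := by
  rw [← norm_iteratedFDeriv_one, norm_iteratedFDeriv_fderiv, norm_iteratedFDeriv_gradient]
  exact h.third_bound x

lemma IsSmoothObjective.norm_fderiv_fderiv_fderiv_gradient_le (h : IsSmoothObjective f L₂ L₃ L₄)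
    (x : EuclideanSpace ℝ (Fin d)) : ‖fderiv ℝ (fderiv ℝ (fderiv ℝ (gradient f))) x‖ ≤ L₄ := by
  rw [← norm_iteratedFDeriv_one, norm_iteratedFDeriv_fderiv, norm_iteratedFDeriv_fderiv,
    norm_iteratedFDeriv_gradient]
  exact h.fourth_bound x

lemma IsSmoothObjective.norm_hessian_le (h : IsSmoothObjective f L₂ L₃ L₄)
    (x : EuclideanSpace ℝ (Fin d)) : ‖hessian f x‖ ≤ L₂ := by
  have : LipschitzWith ⟨L₂, h.nonneg₂⟩ (gradient f) :=
    LipschitzWith.of_dist_le_mul fun a b => by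
      rw [dist_eq_norm, dist_eq_norm]; exact h.gradient_lipschitz a b
  exact norm_fderiv_le_of_lipschitz ℝ this

lemma IsStronglyConvex.inner_gradient_sub_ge (h : IsStronglyConvex f μ)
    (θ θ' : EuclideanSpace ℝ (Fin d)) :
    μ * ‖θ - θ'‖ ^ 2 ≤ inner ℝ (gradient f θ - gradient f θ') (θ - θ') := by
  have h1 := h.lower_bound θ θ'
  have h2 := h.lower_bound θ' θ
  rw [norm_sub_rev θ' θ, ← neg_sub θ θ', inner_neg_right] at h2
  rw [inner_sub_left]
  linarith

/-- Strong monotonicity of the gradient, applied to difference quotients in the direction `v`,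
passes to the limit. -/
lemma IsStronglyConvex.inner_hessian_ge (h : IsStronglyConvex f μ)
    (hs : IsSmoothObjective f L₂ L₃ L₄) (θ v : EuclideanSpace ℝ (Fin d)) :
    μ * ‖v‖ ^ 2 ≤ inner ℝ (hessian f θ v) v := by
  have hd : HasDerivAt (fun t : ℝ => gradient f (θ + t • v)) (hessian f θ v) 0 := by
    have h1 : HasDerivAt (fun t : ℝ => θ + t • v) v 0 := by
      simpa using ((hasDerivAt_id (0 : ℝ)).smul_const v).const_add θ
    have h2 : HasFDerivAt (gradient f) (hessian f θ) (θ + (0 : ℝ) • v) := by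
      rw [zero_smul, add_zero]
      exact ((hs.contDiff_gradient.differentiable (by norm_num)) θ).hasFDerivAt
    exact h2.comp_hasDerivAt 0 h1
  have ht := hd.tendsto_slope_zero_right
  have ht' := (ht.inner (𝕜 := ℝ) (tendsto_const_nhds (x := v)))
  refine ge_of_tendsto ht' ?_
  filter_upwards [self_mem_nhdsWithin] with t ht0
  have ht0 : 0 < t := ht0
  have hm := h.inner_gradient_sub_ge (θ + t • v) θ
  rw [add_sub_cancel_left, norm_smul, inner_smul_right, Real.norm_of_nonneg ht0.le] at hm
  rw [zero_add, zero_smul, add_zero, inner_smul_left, RCLike.conj_to_real, inv_mul_eq_div,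
    le_div_iff₀ ht0]
  have : t * (μ * ‖v‖ ^ 2 * t) ≤ t * inner ℝ (gradient f (θ + t • v) - gradient f θ) v := by
    nlinarith
  exact le_of_mul_le_mul_left this ht0

lemma gradient_eq_zero_of_isMinOn {θs : EuclideanSpace ℝ (Fin d)}
    (h : IsMinOn f Set.univ θs) : gradient f θs = 0 := by
  have : IsLocalMin f θs := h.isLocalMin Filter.univ_mem
  rw [gradient_eq_toDual_symm_comp, Function.comp_apply, this.fderiv_eq_zero, map_zero]

lemma IsStronglyConvex.le_lipschitz_const (h : IsStronglyConvex f μ)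
    (hs : IsSmoothObjective f L₂ L₃ L₄) (hd : d ≠ 0) : μ ≤ L₂ := by
  have : Nonempty (Fin d) := ⟨⟨0, Nat.pos_of_ne_zero hd⟩⟩
  obtain ⟨v, hv⟩ := exists_ne (0 : EuclideanSpace ℝ (Fin d))
  have h1 := h.inner_gradient_sub_ge v 0
  have h2 := hs.gradient_lipschitz v 0
  rw [sub_zero] at h1 h2
  have h3 := real_inner_le_norm (gradient f v - gradient f 0) v
  have hv' : 0 < ‖v‖ := norm_pos_iff.2 hv
  have : μ * ‖v‖ ^ 2 ≤ L₂ * ‖v‖ ^ 2 := by nlinarith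
  exact le_of_mul_le_mul_right this (by positivity)

end Objective

/-! ### Scalar power inequalities and the moment recursion. -/

section PowerInequalities

lemma young_rpow {r a b : ℝ} (hr : 1 ≤ r) (ha : 0 ≤ a) (hb : 0 ≤ b) :
    r * a ^ (r - 1) * b ≤ (r - 1) * a ^ r + b ^ r := by
  have hr0 : 0 < r := by linarith
  have h := Real.geom_mean_le_arith_mean2_weighted (w₁ := (r - 1) / r) (w₂ := 1 / r)
    (div_nonneg (by linarith) hr0.le) (by positivity) (Real.rpow_nonneg ha r)
    (Real.rpow_nonneg hb r) (by field_simp; ring)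
  rw [← Real.rpow_mul ha, ← Real.rpow_mul hb, mul_div_cancel₀ _ hr0.ne', mul_one_div_cancel hr0.ne',
    Real.rpow_one] at h
  calc r * a ^ (r - 1) * b = r * (a ^ (r - 1) * b) := by ring
    _ ≤ r * ((r - 1) / r * a ^ r + 1 / r * b ^ r) := by gcongr
    _ = _ := by field_simp

lemma rpow_sub_two_mul_sq {q a : ℝ} (hq : 2 ≤ q) (ha : 0 ≤ a) : a ^ (q - 2) * a ^ 2 = a ^ q := by
  rcases ha.eq_or_lt with rfl | ha
  · rw [Real.zero_rpow (by linarith : q ≠ 0)]; norm_num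
  · rw [← Real.rpow_natCast, ← Real.rpow_add ha]; norm_num

lemma rpow_sub_two_mul_self {q a : ℝ} (hq : 2 ≤ q) (ha : 0 ≤ a) :
    a ^ (q - 2) * a = a ^ (q - 1) := by
  rcases ha.eq_or_lt with rfl | ha
  · rw [Real.zero_rpow (by linarith : q - 1 ≠ 0)]; norm_num
  · nth_rw 2 [← Real.rpow_one a]
    rw [← Real.rpow_add ha]; ring_nf

/-- This replaces the mean value theorem for x ↦ x^s. The factor `b` avoids the singularity of
x^(s-1) at zero when s < 1; the proof is log x ≤ x - 1 followed by 1 + x ≤ exp x. -/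
lemma mul_rpow_sub_rpow_le {s a b : ℝ} (hs : 0 ≤ s) (hb : 0 ≤ b) (hab : b ≤ a) :
    b * (a ^ s - b ^ s) ≤ s * a ^ s * (a - b) := by
  rcases hb.eq_or_lt with rfl | hb
  · rw [zero_mul]
    exact mul_nonneg (mul_nonneg hs (Real.rpow_nonneg hab s)) (by linarith)
  have ha : 0 < a := hb.trans_le hab
  have h1 : Real.log (a / b) ≤ a / b - 1 := Real.log_le_sub_one_of_pos (by positivity)
  have h2 : b ^ s = a ^ s * Real.exp (-(s * Real.log (a / b))) := by
    rw [Real.rpow_def_of_pos hb, Real.rpow_def_of_pos ha, ← Real.exp_add,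
      Real.log_div ha.ne' hb.ne']
    ring_nf
  have h3 : 1 - s * (a / b - 1) ≤ Real.exp (-(s * Real.log (a / b))) := by
    have := Real.add_one_le_exp (-(s * Real.log (a / b)))
    nlinarith [mul_le_mul_of_nonneg_left h1 hs]
  have h4 : a ^ s * (1 - s * (a / b - 1)) ≤ b ^ s := by
    rw [h2]; gcongr
  calc b * (a ^ s - b ^ s) ≤ b * (a ^ s - a ^ s * (1 - s * (a / b - 1))) := by gcongr
    _ = s * a ^ s * (a - b) := by field_simp; ring

/-- If b ≤ a/q, then (1 + 1/q)^(q-2) ≤ e ≤ 3. An absolute coefficient in front of a^(q-2) is what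
keeps the growth of the variance term in Rosenthal's inequality at √q; the coefficient of b^(q-2)
may be large. -/
lemma add_rpow_sub_two_le {q a b : ℝ} (hq : 2 ≤ q) (ha : 0 ≤ a) (hb : 0 ≤ b) :
    (a + b) ^ (q - 2) ≤ 3 * a ^ (q - 2) + (1 + q) ^ (q - 2) * b ^ (q - 2) := by
  have hq0 : 0 < q := by linarith
  have hs : 0 ≤ q - 2 := by linarith
  have n1 : 0 ≤ a ^ (q - 2) := by positivity
  rcases le_total (q * b) a with h | h
  · have h1 : a + b ≤ Real.exp (1 / q) * a := by
      have h2 := Real.add_one_le_exp (1 / q)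
      have h3 : b ≤ 1 / q * a := by rw [one_div_mul_eq_div, le_div_iff₀ hq0]; linarith
      nlinarith
    calc (a + b) ^ (q - 2) ≤ (Real.exp (1 / q) * a) ^ (q - 2) := by gcongr
      _ = Real.exp (1 / q * (q - 2)) * a ^ (q - 2) := by
        rw [Real.mul_rpow (Real.exp_nonneg _) ha, ← Real.exp_mul]
      _ ≤ 3 * a ^ (q - 2) := by
        gcongr
        have : 1 / q * (q - 2) ≤ 1 := by
          rw [one_div_mul_eq_div, div_le_one hq0]; linarith
        exact (Real.exp_le_exp.2 this).trans (by linarith [Real.exp_one_lt_d9])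
      _ ≤ _ := by simp only [le_add_iff_nonneg_right]; positivity
  · calc (a + b) ^ (q - 2) ≤ ((1 + q) * b) ^ (q - 2) := by gcongr; linarith
      _ = (1 + q) ^ (q - 2) * b ^ (q - 2) := Real.mul_rpow (by linarith) hb
      _ ≤ _ := by simp only [le_add_iff_nonneg_left]; positivity

/-- Minkowski's inequality in ℓ^r for the vectors (A, 0) and (B, κ^(1/r)). -/
lemma add_rpow_add_le {r A B κ : ℝ} (hr : 1 ≤ r) (hA : 0 ≤ A) (hB : 0 ≤ B) (hκ : 0 ≤ κ) :
    (A + B) ^ r + κ ≤ (A + (B ^ r + κ) ^ (1 / r)) ^ r := by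
  have hr0 : 0 < r := by linarith
  have h := Real.Lp_add_le_of_nonneg (s := Finset.univ) (f := ![A, 0]) (g := ![B, κ ^ (1 / r)]) hr
    (by intro i _; fin_cases i <;> simp [hA])
    (by intro i _; fin_cases i <;> simp [hB]; positivity)
  simp only [Fin.sum_univ_two, Matrix.cons_val_zero, Matrix.cons_val_one, zero_add,
    Real.zero_rpow hr0.ne', add_zero] at h
  rw [← Real.rpow_mul hκ, one_div_mul_cancel hr0.ne', Real.rpow_one, ← Real.rpow_mul hA,
    mul_one_div_cancel hr0.ne', Real.rpow_one] at h
  calc (A + B) ^ r + κ = (((A + B) ^ r + κ) ^ (1 / r)) ^ r := by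
        rw [← Real.rpow_mul (by positivity), one_div_mul_cancel hr0.ne', Real.rpow_one]
    _ ≤ _ := by gcongr

/-- Bound for a sequence of moments that satisfies the recursion of martingale partial sums. -/
lemma moment_recursion_le {q s κ : ℝ} (hq : 2 ≤ q) (hκ : 0 ≤ κ) {u : ℕ → ℝ}
    (hu0 : u 0 = 0) (hu : ∀ k, 0 ≤ u k) {n : ℕ}
    (hstep : ∀ k < n, u (k + 1) ≤ u k + 3 * q * (q - 1) * s ^ 2 * u k ^ ((q - 2) / q) + κ) :
    u n ≤ (6 * (q - 1) * s ^ 2 * n + (n * κ) ^ (2 / q)) ^ (q / 2) := by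
  have hq0 : 0 < q := by linarith
  have hq1 : 0 ≤ q - 1 := by linarith
  have hr : 1 ≤ q / 2 := by linarith
  suffices ∀ k ≤ n, u k ≤ (6 * (q - 1) * s ^ 2 * k + (k * κ) ^ (2 / q)) ^ (q / 2) from
    this n le_rfl
  intro k hk
  induction k with
  | zero =>
    rw [hu0]; positivity
  | succ k ih =>
    have ih := ih (by omega)
    set A := 6 * (q - 1) * s ^ 2 * k with hA
    set B := (k * κ) ^ (2 / q) with hB
    set h := 6 * (q - 1) * s ^ 2 with hh
    have hA0 : 0 ≤ A := by positivity
    have hB0 : 0 ≤ B := by positivity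
    have hh0 : 0 ≤ h := by positivity
    have e1 : u k ^ ((q - 2) / q) ≤ (A + B) ^ (q / 2 - 1) := by
      calc _ ≤ ((A + B) ^ (q / 2)) ^ ((q - 2) / q) := by
            refine Real.rpow_le_rpow (hu k) ih (div_nonneg (by linarith) hq0.le)
        _ = _ := by rw [← Real.rpow_mul (by positivity)]; congr 1; field_simp
    have e2 := young_rpow hr (add_nonneg hA0 hB0) (show 0 ≤ A + B + h by positivity)
    -- The tangent-line inequality for the power q/2 at A + B: adding `h` to the base pays for the
    -- drift term of the recursion, since (q/2)h = 3q(q-1)s².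
    have e3 : (A + B) ^ (q / 2) + (q / 2) * h * (A + B) ^ (q / 2 - 1) ≤ (A + B + h) ^ (q / 2) := by
      have : (A + B) ^ (q / 2 - 1) * (A + B) = (A + B) ^ (q / 2) := by
        rcases (add_nonneg hA0 hB0).eq_or_lt with h0 | h0
        · rw [← h0, Real.zero_rpow (by positivity : q / 2 ≠ 0), mul_zero]
        · nth_rw 2 [← Real.rpow_one (A + B)]
          rw [← Real.rpow_add h0]; ring_nf
      nlinarith
    -- The additive κ is paid by enlarging `B` only, from (kκ)^(2/q) to ((k+1)κ)^(2/q).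
    have e4 := add_rpow_add_le hr (add_nonneg hA0 hh0) hB0 hκ
    have e5 : B ^ (q / 2) = k * κ := by
      rw [hB, ← Real.rpow_mul (by positivity), show 2 / q * (q / 2) = 1 by field_simp,
        Real.rpow_one]
    rw [e5, show 1 / (q / 2) = 2 / q by field_simp] at e4
    have e6 : 3 * q * (q - 1) * s ^ 2 * u k ^ ((q - 2) / q)
        ≤ (q / 2) * h * (A + B) ^ (q / 2 - 1) := by
      rw [show q / 2 * h = 3 * q * (q - 1) * s ^ 2 by rw [hh]; ring]
      gcongr
    calc u (k + 1) ≤ u k + 3 * q * (q - 1) * s ^ 2 * u k ^ ((q - 2) / q) + κ := hstep k (by omega)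
      _ ≤ (A + B + h) ^ (q / 2) + κ := by linarith
      _ = (A + h + B) ^ (q / 2) + κ := by ring_nf
      _ ≤ _ := e4
      _ = _ := by rw [hA]; push_cast; ring_nf

end PowerInequalities

/-! ### Second-order expansion of powers of the norm. -/

section VectorInequality

variable {E : Type*} [NormedAddCommGroup E] [InnerProductSpace ℝ E]

lemma norm_rpow_smul_sub_le_of_le {s : ℝ} (hs : 0 ≤ s) {x y : E} (h : ‖x‖ ≤ ‖y‖) :
    ‖‖y‖ ^ s • y - ‖x‖ ^ s • x‖ ≤ (s + 1) * ‖y‖ ^ s * ‖y - x‖ := by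
  have e : ‖y‖ ^ s • y - ‖x‖ ^ s • x = ‖y‖ ^ s • (y - x) + (‖y‖ ^ s - ‖x‖ ^ s) • x := by
    rw [smul_sub, sub_smul]; abel
  have h1 : 0 ≤ ‖y‖ ^ s - ‖x‖ ^ s := by
    rw [sub_nonneg]; gcongr
  rw [e]
  refine (norm_add_le _ _).trans ?_
  rw [norm_smul, norm_smul, Real.norm_of_nonneg (by positivity), Real.norm_of_nonneg h1]
  have h2 := mul_rpow_sub_rpow_le hs (norm_nonneg x) h
  have h3 : s * ‖y‖ ^ s * (‖y‖ - ‖x‖) ≤ s * ‖y‖ ^ s * ‖y - x‖ := by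
    gcongr; exact norm_sub_norm_le y x
  nlinarith

lemma norm_rpow_smul_sub_le {s M : ℝ} (hs : 0 ≤ s) {x y : E} (hx : ‖x‖ ≤ M) (hy : ‖y‖ ≤ M) :
    ‖‖y‖ ^ s • y - ‖x‖ ^ s • x‖ ≤ (s + 1) * M ^ s * ‖y - x‖ := by
  rcases le_total ‖x‖ ‖y‖ with h | h
  · exact (norm_rpow_smul_sub_le_of_le hs h).trans (by gcongr)
  · rw [norm_sub_rev, norm_sub_rev y x]
    exact (norm_rpow_smul_sub_le_of_le hs h).trans (by gcongr)

/-- Convexity bounds the increment of ‖·‖^q by its gradient at the endpoint y = S + X, paired with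
X. The local Lipschitz bound for x ↦ ‖x‖^(q-2) x moves the gradient back to S, where it will be
orthogonal to a martingale increment. The cost is split by `add_rpow_sub_two_le`. -/
lemma norm_add_rpow_le {q : ℝ} (hq : 2 ≤ q) (S X : E) :
    ‖S + X‖ ^ q ≤ ‖S‖ ^ q + q * (‖S‖ ^ (q - 2) * inner ℝ S X)
      + 3 * q * (q - 1) * (‖S‖ ^ (q - 2) * ‖X‖ ^ 2)
      + q * (q - 1) * (1 + q) ^ (q - 2) * ‖X‖ ^ q := by
  have hq0 : 0 < q := by linarith
  have hq1 : 0 ≤ q - 1 := by linarith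
  set y := S + X with hy
  have c1 : ‖y‖ ^ q ≤ ‖S‖ ^ q + q * (‖y‖ ^ (q - 2) * inner ℝ y X) := by
    have h1 := young_rpow (by linarith : 1 ≤ q) (norm_nonneg y) (norm_nonneg S)
    have h2 : inner ℝ y X = ‖y‖ ^ 2 - inner ℝ y S := by
      rw [← real_inner_self_eq_norm_sq, ← inner_sub_right, hy, add_sub_cancel_left]
    have h3 := rpow_sub_two_mul_sq hq (norm_nonneg y)
    have h4 := rpow_sub_two_mul_self hq (norm_nonneg y)
    have h5 : ‖y‖ ^ (q - 2) * inner ℝ y S ≤ ‖y‖ ^ (q - 1) * ‖S‖ := by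
      rw [← h4, mul_assoc]
      gcongr
      exact real_inner_le_norm y S
    rw [h2, mul_sub, h3]
    nlinarith [mul_le_mul_of_nonneg_left h5 hq0.le]
  have c2 : ‖y‖ ^ (q - 2) * inner ℝ y X ≤ ‖S‖ ^ (q - 2) * inner ℝ S X
      + (q - 1) * (‖S‖ + ‖X‖) ^ (q - 2) * ‖X‖ ^ 2 := by
    have h1 := norm_rpow_smul_sub_le (s := q - 2) (M := ‖S‖ + ‖X‖) (by linarith) (x := S) (y := y)
      (by simp) (norm_add_le S X)
    have h2 := real_inner_le_norm (‖y‖ ^ (q - 2) • y - ‖S‖ ^ (q - 2) • S) X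
    rw [inner_sub_left, real_inner_smul_left, real_inner_smul_left] at h2
    have h3 : y - S = X := by rw [hy, add_sub_cancel_left]
    rw [h3] at h1
    have h4 := mul_le_mul_of_nonneg_right h1 (norm_nonneg X)
    nlinarith
  have c3 := add_rpow_sub_two_le hq (norm_nonneg S) (norm_nonneg X)
  have c4 := rpow_sub_two_mul_sq hq (norm_nonneg X)
  have c5 : (‖S‖ + ‖X‖) ^ (q - 2) * ‖X‖ ^ 2 ≤
      3 * (‖S‖ ^ (q - 2) * ‖X‖ ^ 2) + (1 + q) ^ (q - 2) * ‖X‖ ^ q := by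
    rw [← c4]
    nlinarith [mul_le_mul_of_nonneg_right c3 (sq_nonneg ‖X‖)]
  have c6 := mul_le_mul_of_nonneg_left c5 (mul_nonneg hq0.le hq1)
  have c7 := mul_le_mul_of_nonneg_left c2 hq0.le
  nlinarith

omit [InnerProductSpace ℝ E] in
lemma norm_rpow_sub_two_mul_sq_le {q : ℝ} (hq : 2 ≤ q) (S X : E) :
    ‖S‖ ^ (q - 2) * ‖X‖ ^ 2 ≤ ‖S‖ ^ q + ‖X‖ ^ q := by
  have hs : 0 ≤ q - 2 := by linarith
  rcases le_total ‖S‖ ‖X‖ with h | h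
  · calc _ ≤ ‖X‖ ^ (q - 2) * ‖X‖ ^ 2 := by gcongr
      _ = ‖X‖ ^ q := rpow_sub_two_mul_sq hq (norm_nonneg X)
      _ ≤ _ := by simp only [le_add_iff_nonneg_left]; positivity
  · calc _ ≤ ‖S‖ ^ (q - 2) * ‖S‖ ^ 2 := by gcongr
      _ = ‖S‖ ^ q := rpow_sub_two_mul_sq hq (norm_nonneg S)
      _ ≤ _ := by simp only [le_add_iff_nonneg_right]; positivity

lemma abs_norm_rpow_sub_two_mul_inner_le {q : ℝ} (hq : 2 ≤ q) (S X : E) :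
    |‖S‖ ^ (q - 2) * inner ℝ S X| ≤ 2 * (‖S‖ ^ q + ‖X‖ ^ q) := by
  have h1 := norm_rpow_sub_two_mul_sq_le hq S X
  have h2 := rpow_sub_two_mul_sq hq (norm_nonneg S)
  have h3 := abs_real_inner_le_norm S X
  have h4 : (0 : ℝ) ≤ ‖S‖ ^ (q - 2) := by positivity
  have h5 : (0 : ℝ) ≤ ‖S‖ ^ q := by positivity
  rw [abs_mul, abs_of_nonneg h4]
  have : ‖S‖ * ‖X‖ ≤ ‖S‖ ^ 2 + ‖X‖ ^ 2 := by nlinarith [sq_nonneg (‖S‖ - ‖X‖), sq_nonneg ‖S‖, sq_nonneg ‖X‖]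
  calc _ ≤ ‖S‖ ^ (q - 2) * (‖S‖ ^ 2 + ‖X‖ ^ 2) := by gcongr; exact h3.trans this
    _ ≤ _ := by rw [mul_add, h2]; linarith [show (0 : ℝ) ≤ ‖X‖ ^ q by positivity]

end VectorInequality

/-! ### Calculus of explicit L^q bounds. -/

section LpBounds

variable {Ω E F : Type*} [MeasurableSpace Ω] {P : Measure Ω}
  [NormedAddCommGroup E] [NormedAddCommGroup F] {q B C : ℝ} {X Y : Ω → E}

/-- `X` is measurable and `E^{1/q}[‖X‖ ^ q] ≤ B`, where `B ≥ 0`. -/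
structure LpLE (P : Measure Ω) (q B : ℝ) (X : Ω → E) : Prop where
  aesm : AEStronglyMeasurable X P
  nonneg : 0 ≤ B
  le : eLpNorm X (ENNReal.ofReal q) P ≤ ENNReal.ofReal B

lemma LpLE.memLp (h : LpLE P q B X) : MemLp X (ENNReal.ofReal q) P :=
  ⟨h.aesm, h.le.trans_lt ENNReal.ofReal_lt_top⟩

lemma LpLE.mono (h : LpLE P q B X) (hBC : B ≤ C) : LpLE P q C X :=
  ⟨h.aesm, h.nonneg.trans hBC, h.le.trans (ENNReal.ofReal_le_ofReal hBC)⟩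

lemma LpLE.add (hX : LpLE P q B X) (hY : LpLE P q C Y) (hq : 1 ≤ q) :
    LpLE P q (B + C) (fun ω => X ω + Y ω) where
  aesm := hX.aesm.add hY.aesm
  nonneg := add_nonneg hX.nonneg hY.nonneg
  le := by
    rw [ENNReal.ofReal_add hX.nonneg hY.nonneg]
    exact (eLpNorm_add_le hX.aesm hY.aesm (ENNReal.one_le_ofReal.2 hq)).trans
      (add_le_add hX.le hY.le)

lemma LpLE.sub (hX : LpLE P q B X) (hY : LpLE P q C Y) (hq : 1 ≤ q) :
    LpLE P q (B + C) (fun ω => X ω - Y ω) where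
  aesm := hX.aesm.sub hY.aesm
  nonneg := add_nonneg hX.nonneg hY.nonneg
  le := by
    rw [ENNReal.ofReal_add hX.nonneg hY.nonneg]
    exact (eLpNorm_sub_le hX.aesm hY.aesm (ENNReal.one_le_ofReal.2 hq)).trans
      (add_le_add hX.le hY.le)

lemma LpLE.of_norm_le {W : Ω → F} (hX : LpLE P q B X) (hW : AEStronglyMeasurable W P)
    (hC : 0 ≤ C) (h : ∀ ω, ‖W ω‖ ≤ C * ‖X ω‖) : LpLE P q (C * B) W where
  aesm := hW
  nonneg := mul_nonneg hC hX.nonneg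
  le := by
    rw [ENNReal.ofReal_mul hC]
    exact (eLpNorm_le_mul_eLpNorm_of_ae_le_mul (.of_forall h) _).trans (by gcongr; exact hX.le)

lemma LpLE.const_smul [NormedSpace ℝ E] (hX : LpLE P q B X) {c : ℝ} (hc : 0 ≤ c) :
    LpLE P q (c * B) (fun ω => c • X ω) :=
  hX.of_norm_le (hX.aesm.const_smul c) hc fun ω => by
    rw [norm_smul, Real.norm_of_nonneg hc]

lemma LpLE.norm (hX : LpLE P q B X) : LpLE P q B (fun ω => ‖X ω‖) := by
  simpa using hX.of_norm_le hX.aesm.norm zero_le_one fun ω => by simp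

lemma LpLE.zero (P : Measure Ω) (q : ℝ) : LpLE P q 0 (fun _ => (0 : E)) :=
  ⟨aestronglyMeasurable_const, le_rfl, by simp⟩

lemma LpLE.sum {ι : Type*} {s : Finset ι} {b : ι → ℝ} {f : ι → Ω → E} (hq : 1 ≤ q)
    (h : ∀ i ∈ s, LpLE P q (b i) (f i)) :
    LpLE P q (∑ i ∈ s, b i) (fun ω => ∑ i ∈ s, f i ω) := by
  classical
  induction s using Finset.induction_on with
  | empty => simpa using LpLE.zero P q
  | insert i s hi ih =>
    simp only [Finset.sum_insert hi]
    exact (h i (Finset.mem_insert_self i s)).add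
      (ih fun j hj => h j (Finset.mem_insert_of_mem hj)) hq

lemma LpLE.exponent_mono [IsProbabilityMeasure P] {r : ℝ} (h : LpLE P r B X) (hqr : q ≤ r) :
    LpLE P q B X :=
  ⟨h.aesm, h.nonneg, (eLpNorm_le_eLpNorm_of_exponent_le (ENNReal.ofReal_le_ofReal hqr)
    h.aesm).trans h.le⟩

lemma LpLE.norm_pow {m : ℕ} (hm : m ≠ 0) (h : LpLE P (m * q) B X) :
    LpLE P q (B ^ m) (fun ω => ‖X ω‖ ^ m) where
  aesm := h.aesm.norm.pow m
  nonneg := pow_nonneg h.nonneg m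
  le := by
    have e := eLpNorm_norm_rpow (p := ENNReal.ofReal q) (μ := P) (q := m) X (by positivity)
    simp only [Real.rpow_natCast] at e
    rw [← ENNReal.ofReal_mul' (by positivity), mul_comm q] at e
    rw [e, ENNReal.rpow_natCast, ENNReal.ofReal_pow h.nonneg]
    gcongr
    exact h.le

lemma LpLE.const [IsProbabilityMeasure P] {c : E} (hc : ‖c‖ ≤ B) (hq : 0 < q) :
    LpLE P q B (fun _ => c) where
  aesm := aestronglyMeasurable_const
  nonneg := (norm_nonneg c).trans hc
  le := by
    rw [eLpNorm_const _ (by simpa using hq) (IsProbabilityMeasure.ne_zero P)]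
    simp only [measure_univ, ENNReal.one_rpow, mul_one, ← ofReal_norm]
    exact ENNReal.ofReal_le_ofReal hc

lemma LpLE.integral_norm_rpow_le (h : LpLE P q B X) (hq : 0 < q) :
    ∫ ω, ‖X ω‖ ^ q ∂P ≤ B ^ q := by
  have h1 := h.le
  rw [h.memLp.eLpNorm_eq_integral_rpow_norm (by simpa using hq) ENNReal.ofReal_ne_top,
    ENNReal.ofReal_le_ofReal_iff h.nonneg, ENNReal.toReal_ofReal hq.le] at h1
  have h0 : 0 ≤ ∫ ω, ‖X ω‖ ^ q ∂P := integral_nonneg fun _ => by positivity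
  have := Real.rpow_le_rpow (by positivity) h1 hq.le
  rwa [← Real.rpow_mul h0, inv_mul_cancel₀ hq.ne', Real.rpow_one] at this

lemma LpLE.of_integral_le (hq : 0 < q) (hB : 0 ≤ B) (hX : MemLp X (ENNReal.ofReal q) P)
    (h : ∫ ω, ‖X ω‖ ^ q ∂P ≤ B ^ q) : LpLE P q B X where
  aesm := hX.1
  nonneg := hB
  le := by
    rw [hX.eLpNorm_eq_integral_rpow_norm (by simpa using hq) ENNReal.ofReal_ne_top]
    apply ENNReal.ofReal_le_ofReal
    rw [ENNReal.toReal_ofReal hq.le]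
    have h0 : 0 ≤ ∫ ω, ‖X ω‖ ^ q ∂P := integral_nonneg fun _ => by positivity
    have := Real.rpow_le_rpow h0 h (inv_nonneg.2 hq.le)
    rwa [← Real.rpow_mul hB, mul_inv_cancel₀ hq.ne', Real.rpow_one] at this

lemma integrable_norm_rpow_of_memLp (hq : 0 < q) (hX : MemLp X (ENNReal.ofReal q) P) :
    Integrable (fun ω => ‖X ω‖ ^ q) P := by
  have := hX.integrable_norm_rpow (by simpa using hq) ENNReal.ofReal_ne_top
  rwa [ENNReal.toReal_ofReal hq.le] at this

lemma integral_norm_rpow_sub_two_mul_sq_le {W : Ω → F} (hq : 2 ≤ q)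
    (hX : MemLp X (ENNReal.ofReal q) P) (hW : MemLp W (ENNReal.ofReal q) P)
    [IsProbabilityMeasure P] :
    ∫ ω, ‖X ω‖ ^ (q - 2) * ‖W ω‖ ^ 2 ∂P ≤
      (∫ ω, ‖X ω‖ ^ q ∂P) ^ ((q - 2) / q) * (∫ ω, ‖W ω‖ ^ q ∂P) ^ (2 / q) := by
  -- Hölder is used with exponents q/(q-2) and q/2; the first is infinite when q = 2.
  rcases hq.eq_or_lt with rfl | hq'
  · simp
  have hs : 0 < q - 2 := by linarith
  have hq0 : 0 < q := by linarith
  have hc : (q / (q - 2)).HolderConjugate (q / 2) := by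
    rw [Real.holderConjugate_iff]
    refine ⟨by rw [lt_div_iff₀ hs]; linarith, by field_simp; ring⟩
  have h1 : MemLp (fun ω => ‖X ω‖ ^ (q - 2)) (ENNReal.ofReal (q / (q - 2))) P := by
    have := hX.norm_rpow_div (ENNReal.ofReal (q - 2))
    rwa [ENNReal.toReal_ofReal hs.le, ← ENNReal.ofReal_div_of_pos hs] at this
  have h2 : MemLp (fun ω => ‖W ω‖ ^ (2 : ℝ)) (ENNReal.ofReal (q / 2)) P := by
    have := hW.norm_rpow_div (ENNReal.ofReal 2)
    rwa [ENNReal.toReal_ofReal (by norm_num), ← ENNReal.ofReal_div_of_pos (by norm_num)] at this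
  have := integral_mul_le_Lp_mul_Lq_of_nonneg hc (.of_forall fun ω => by positivity)
    (.of_forall fun ω => by positivity) h1 h2
  simp only [← Real.rpow_mul (norm_nonneg _), one_div_div] at this
  rw [show (q - 2) * (q / (q - 2)) = q by field_simp, show 2 * (q / 2) = q by ring] at this
  simpa using this

end LpBounds

lemma sqrt_add_le_sqrt_add_sqrt {x y : ℝ} (hx : 0 ≤ x) (hy : 0 ≤ y) : √(x + y) ≤ √x + √y := by
  rw [Real.sqrt_le_left (by positivity)]
  nlinarith [Real.sq_sqrt hx, Real.sq_sqrt hy, mul_nonneg (Real.sqrt_nonneg x) (Real.sqrt_nonneg y)]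

/-! ### A Rosenthal inequality for partial sums. -/

section PartialSums

variable {Ω E : Type*} [MeasurableSpace Ω] {P : Measure Ω}
  [NormedAddCommGroup E] [InnerProductSpace ℝ E] {q β s : ℝ}

lemma integrable_norm_rpow_mul_inner (hq : 2 ≤ q) {S X : Ω → E}
    (hS : MemLp S (ENNReal.ofReal q) P) (hX : MemLp X (ENNReal.ofReal q) P) :
    Integrable (fun ω => ‖S ω‖ ^ (q - 2) * inner ℝ (S ω) (X ω)) P := by
  have hq0 : 0 < q := by linarith
  refine Integrable.mono' (((integrable_norm_rpow_of_memLp hq0 hS).add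
    (integrable_norm_rpow_of_memLp hq0 hX)).const_mul 2) ?_
    (.of_forall fun ω => abs_norm_rpow_sub_two_mul_inner_le hq (S ω) (X ω))
  exact ((hS.1.norm.aemeasurable.pow_const _).aestronglyMeasurable).mul (hS.1.inner hX.1)

lemma integrable_norm_rpow_mul_sq (hq : 2 ≤ q) {S X : Ω → E}
    (hS : MemLp S (ENNReal.ofReal q) P) (hX : MemLp X (ENNReal.ofReal q) P) :
    Integrable (fun ω => ‖S ω‖ ^ (q - 2) * ‖X ω‖ ^ 2) P := by
  have hq0 : 0 < q := by linarith
  refine Integrable.mono' ((integrable_norm_rpow_of_memLp hq0 hS).add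
    (integrable_norm_rpow_of_memLp hq0 hX)) ?_
    (.of_forall fun ω => ?_)
  · exact ((hS.1.norm.aemeasurable.pow_const _).aestronglyMeasurable).mul (hX.1.norm.pow 2)
  · rw [Real.norm_of_nonneg (by positivity)]
    exact norm_rpow_sub_two_mul_sq_le hq (S ω) (X ω)

/-- The constant of the term of order `n ^ (1 / q)` in the moment inequality for partial sums. -/
noncomputable def sumConst (q : ℝ) : ℝ := (q * (q - 1) * (1 + q) ^ (q - 2)) ^ (1 / q)

lemma sumConst_nonneg (hq : 2 ≤ q) : 0 ≤ sumConst q := by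
  have : 0 ≤ q - 1 := by linarith
  have : 0 ≤ q := by linarith
  unfold sumConst; positivity

/-- Rosenthal's inequality for partial sums whose increments are orthogonal to the gradient of the
`q`-th power of the norm at the preceding partial sum. -/
lemma lpLE_sum_of_orthogonal [IsProbabilityMeasure P] (hq : 2 ≤ q) (hs : 0 ≤ s) (hβ : 0 ≤ β) {X : ℕ → Ω → E} {n : ℕ}
    (hX : ∀ j < n, LpLE P q β (X j))
    (horth : ∀ j < n, ∫ ω, ‖∑ i ∈ Finset.range j, X i ω‖ ^ (q - 2) *
      inner ℝ (∑ i ∈ Finset.range j, X i ω) (X j ω) ∂P = 0)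
    (hvar : ∀ j < n, ∫ ω, ‖∑ i ∈ Finset.range j, X i ω‖ ^ (q - 2) * ‖X j ω‖ ^ 2 ∂P ≤
      s ^ 2 * (∫ ω, ‖∑ i ∈ Finset.range j, X i ω‖ ^ q ∂P) ^ ((q - 2) / q)) :
    LpLE P q (√(6 * q) * s * √n + sumConst q * β * (n : ℝ) ^ (1 / q))
      (fun ω => ∑ i ∈ Finset.range n, X i ω) := by
  have hq0 : 0 < q := by linarith
  have hq1 : 0 ≤ q - 1 := by linarith
  rcases Nat.eq_zero_or_pos n with rfl | hn
  · have := LpLE.zero (E := E) P q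
    simpa [Real.zero_rpow (inv_ne_zero hq0.ne')] using this
  have hmem : ∀ j ≤ n, MemLp (fun ω => ∑ i ∈ Finset.range j, X i ω) (ENNReal.ofReal q) P :=
    fun j hj => memLp_finsetSum _ fun i hi =>
      (hX i ((Finset.mem_range.1 hi).trans_le hj)).memLp
  set κ : ℝ := q * (q - 1) * (1 + q) ^ (q - 2) * β ^ q with hκ
  have hκ0 : 0 ≤ κ := by positivity
  have hu : ∀ j, 0 ≤ ∫ ω, ‖∑ i ∈ Finset.range j, X i ω‖ ^ q ∂P :=
    fun j => integral_nonneg fun ω => by positivity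
  -- Integrating the expansion of ‖S + X‖^q kills the first-order term by orthogonality and leaves
  -- the recursion for the q-th moments of the partial sums.
  have hrec := moment_recursion_le (s := s) hq hκ0
    (u := fun j => ∫ ω, ‖∑ i ∈ Finset.range j, X i ω‖ ^ q ∂P)
    (by simp [Real.zero_rpow hq0.ne']) hu (n := n) fun j hj => by
      have i1 := integrable_norm_rpow_of_memLp hq0 (hmem j hj.le)
      have i2 := (integrable_norm_rpow_mul_inner hq (hmem j hj.le) (hX j hj).memLp).const_mul q
      have i3 := (integrable_norm_rpow_mul_sq hq (hmem j hj.le) (hX j hj).memLp).const_mul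
        (3 * q * (q - 1))
      have i4 := (integrable_norm_rpow_of_memLp hq0 (hX j hj).memLp).const_mul
        (q * (q - 1) * (1 + q) ^ (q - 2))
      have i5 := integrable_norm_rpow_of_memLp hq0 (hmem (j + 1) hj)
      simp only [Finset.sum_range_succ] at i5 ⊢
      calc _ ≤ ∫ ω, (‖∑ i ∈ Finset.range j, X i ω‖ ^ q
            + q * (‖∑ i ∈ Finset.range j, X i ω‖ ^ (q - 2) *
              inner ℝ (∑ i ∈ Finset.range j, X i ω) (X j ω))
            + 3 * q * (q - 1) * (‖∑ i ∈ Finset.range j, X i ω‖ ^ (q - 2) * ‖X j ω‖ ^ 2)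
            + q * (q - 1) * (1 + q) ^ (q - 2) * ‖X j ω‖ ^ q) ∂P := by
            exact integral_mono i5 (((i1.add i2).add i3).add i4) fun ω => norm_add_rpow_le hq _ _
        _ = (∫ ω, ‖∑ i ∈ Finset.range j, X i ω‖ ^ q ∂P)
            + q * 0
            + 3 * q * (q - 1) *
              (∫ ω, ‖∑ i ∈ Finset.range j, X i ω‖ ^ (q - 2) * ‖X j ω‖ ^ 2 ∂P)
            + q * (q - 1) * (1 + q) ^ (q - 2) * ∫ ω, ‖X j ω‖ ^ q ∂P := by
            have h12 := integral_add i1 i2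
            have h123 := integral_add (i1.add i2) i3
            have h1234 := integral_add ((i1.add i2).add i3) i4
            simp only [Pi.add_apply] at h123 h1234
            rw [h1234, h123, h12, integral_const_mul, integral_const_mul, integral_const_mul,
              horth j hj]
        _ ≤ (∫ ω, ‖∑ i ∈ Finset.range j, X i ω‖ ^ q ∂P) + q * 0
            + 3 * q * (q - 1) *
              (s ^ 2 * (∫ ω, ‖∑ i ∈ Finset.range j, X i ω‖ ^ q ∂P) ^ ((q - 2) / q))
            + q * (q - 1) * (1 + q) ^ (q - 2) * β ^ q := by
            gcongr
            · exact hvar j hj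
            · exact (hX j hj).integral_norm_rpow_le hq0
        _ = _ := by rw [hκ]; ring
  set W : ℝ := 6 * (q - 1) * s ^ 2 * n + (n * κ) ^ (2 / q) with hW
  have hW0 : 0 ≤ W := by positivity
  have h1 : LpLE P q (√W) (fun ω => ∑ i ∈ Finset.range n, X i ω) := by
    refine LpLE.of_integral_le hq0 (Real.sqrt_nonneg _) (hmem n le_rfl) (hrec.trans_eq ?_)
    rw [Real.sqrt_eq_rpow, ← Real.rpow_mul hW0]
    ring_nf
  refine h1.mono ((Real.sqrt_le_sqrt ?_).trans
    ((sqrt_add_le_sqrt_add_sqrt (x := 6 * q * s ^ 2 * n) (y := (n * κ) ^ (2 / q))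
      (by positivity) (by positivity)).trans_eq ?_))
  · rw [hW]; gcongr; linarith
  · rw [Real.sqrt_mul (by positivity), Real.sqrt_mul (by positivity), Real.sqrt_sq hs]
    congr 1
    rw [Real.sqrt_eq_rpow, ← Real.rpow_mul (by positivity), show 2 / q * (1 / 2) = 1 / q by ring,
      hκ, Real.mul_rpow (by positivity) (by positivity), Real.mul_rpow (by positivity)
      (by positivity), ← Real.rpow_mul hβ, mul_one_div_cancel hq0.ne', Real.rpow_one, sumConst]
    ring

end PartialSums

/-! ### Past σ-algebras and independence of fresh noise. -/

section Past

variable {Ω Z : Type*} [MeasurableSpace Z]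

/-- The σ-algebra generated by `ξ 0, …, ξ k`. -/
@[reducible] def pastAlgebra (ξ : ℕ → Ω → Z) (k : ℕ) : MeasurableSpace Ω :=
  ⨆ i ∈ Set.Iic k, MeasurableSpace.comap (ξ i) inferInstance

lemma pastAlgebra_mono (ξ : ℕ → Ω → Z) {k l : ℕ} (h : k ≤ l) :
    pastAlgebra ξ k ≤ pastAlgebra ξ l :=
  biSup_mono fun _ hi => le_trans hi h

lemma measurable_pastAlgebra (ξ : ℕ → Ω → Z) {i k : ℕ} (h : i ≤ k) :
    Measurable[pastAlgebra ξ k] (ξ i) := by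
  rw [measurable_iff_comap_le]
  exact le_iSup₂_of_le i h le_rfl

variable [mΩ : MeasurableSpace Ω] {P : Measure Ω} {ξ : ℕ → Ω → Z}

lemma pastAlgebra_le (hξ : ∀ k, Measurable (ξ k)) (k : ℕ) : pastAlgebra ξ k ≤ mΩ :=
  iSup₂_le fun i _ => (hξ i).comap_le

lemma indepFun_of_measurable_pastAlgebra {S : Type*} [MeasurableSpace S]
    (hξ : ∀ k, Measurable (ξ k)) (hind : iIndepFun ξ P) {k : ℕ} {Y : Ω → S}
    (hY : Measurable[pastAlgebra ξ k] Y) : IndepFun Y (ξ (k + 1)) P := by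
  rw [IndepFun_iff_Indep]
  have h := indep_iSup_of_disjoint (fun i => (hξ i).comap_le)
    ((iIndepFun_iff_iIndep _ ξ P).1 hind) (S := Set.Iic k) (T := {k + 1})
    (Set.disjoint_singleton_right.2 (by simp))
  rw [iSup_singleton] at h
  exact indep_of_indep_of_le_left h (measurable_iff_comap_le.1 hY)

/-- Independence makes the joint law a product, and Fubini with the inner integral over ζ gives
zero. This does the work of conditional expectations. -/
lemma integral_eq_zero_of_indepFun {S : Type*} [MeasurableSpace S] [IsProbabilityMeasure P]
    {Y : Ω → S} {ζ : Ω → Z} (hY : Measurable Y) (hζ : Measurable ζ) (hind : IndepFun Y ζ P)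
    {G : S × Z → ℝ} (hG : Measurable G) (hint : Integrable (fun ω => G (Y ω, ζ ω)) P)
    (h0 : ∀ y, ∫ z, G (y, z) ∂(P.map ζ) = 0) : ∫ ω, G (Y ω, ζ ω) ∂P = 0 := by
  have hpair : AEMeasurable (fun ω => (Y ω, ζ ω)) P := (hY.prodMk hζ).aemeasurable
  have hmap := (indepFun_iff_map_prod_eq_prod_map_map hY.aemeasurable hζ.aemeasurable).1 hind
  have : IsProbabilityMeasure (P.map Y) := Measure.isProbabilityMeasure_map hY.aemeasurable
  have : IsProbabilityMeasure (P.map ζ) := Measure.isProbabilityMeasure_map hζ.aemeasurable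
  rw [← integral_map (f := G) hpair hG.aestronglyMeasurable, hmap, integral_prod]
  · simp [h0]
  · rw [← hmap]
    exact (integrable_map_measure hG.aestronglyMeasurable hpair).2 hint

end Past

/-! ### Sums of martingale increments and of i.i.d. vectors. -/

section Martingale

variable {Ω Z S E : Type*} [mΩ : MeasurableSpace Ω] [MeasurableSpace Z] [MeasurableSpace S]
  {P : Measure Ω} [IsProbabilityMeasure P] {ξ : ℕ → Ω → Z} {Pξ : Measure Z}
  [NormedAddCommGroup E] [InnerProductSpace ℝ E] [MeasurableSpace E] [BorelSpace E]
  [SecondCountableTopology E] [CompleteSpace E] {q β : ℝ}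

-- A sum of j increments starting at index m involves noise only up to ξ (m + j), so the next
-- increment, driven by ξ (m + j + 1), sees fresh noise.
omit mΩ [InnerProductSpace ℝ E] [CompleteSpace E] in
lemma measurable_pastAlgebra_partialSum {Y : ℕ → Ω → S} {h : S → Z → E}
    (hY : ∀ k, Measurable[pastAlgebra ξ k] (Y k)) (hh : Measurable (Function.uncurry h))
    (m j : ℕ) :
    Measurable[pastAlgebra ξ (m + j)]
      (fun ω => ∑ i ∈ Finset.range j, h (Y (m + i) ω) (ξ (m + i + 1) ω)) := by
  refine Finset.measurable_sum (m := pastAlgebra ξ (m + j)) _ fun i hi => ?_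
  have hi : i < j := Finset.mem_range.1 hi
  exact hh.comp (((hY (m + i)).mono (pastAlgebra_mono ξ (by omega)) le_rfl).prodMk
    (measurable_pastAlgebra ξ (by omega)))

lemma integral_norm_rpow_mul_inner_eq_zero (hq : 2 ≤ q) (hξ : ∀ k, Measurable (ξ k))
    (hlaw : ∀ k, P.map (ξ k) = Pξ) (hind : iIndepFun ξ P) {k : ℕ} {T : Ω → E} {Y : Ω → S}
    {h : S → Z → E} (hT : Measurable[pastAlgebra ξ k] T) (hY : Measurable[pastAlgebra ξ k] Y)
    (hh : Measurable (Function.uncurry h)) (hint : ∀ y, Integrable (h y) Pξ)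
    (h0 : ∀ y, ∫ z, h y z ∂Pξ = 0) (hTq : MemLp T (ENNReal.ofReal q) P)
    (hhq : MemLp (fun ω => h (Y ω) (ξ (k + 1) ω)) (ENNReal.ofReal q) P) :
    ∫ ω, ‖T ω‖ ^ (q - 2) * inner ℝ (T ω) (h (Y ω) (ξ (k + 1) ω)) ∂P = 0 := by
  have hTY : Measurable[pastAlgebra ξ k] fun ω => (T ω, Y ω) := hT.prodMk hY
  refine integral_eq_zero_of_indepFun (Y := fun ω => (T ω, Y ω)) (ζ := ξ (k + 1))
    (G := fun x => ‖x.1.1‖ ^ (q - 2) * inner ℝ x.1.1 (h x.1.2 x.2))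
    (hTY.mono (pastAlgebra_le hξ k) le_rfl) (hξ _)
    (indepFun_of_measurable_pastAlgebra hξ hind hTY) ?_
    (integrable_norm_rpow_mul_inner hq hTq hhq) fun y => ?_
  · have h1 : Measurable fun x : (E × S) × Z => h x.1.2 x.2 :=
      hh.comp (measurable_fst.snd.prodMk measurable_snd)
    exact (measurable_fst.fst.norm.pow_const _).mul (measurable_fst.fst.inner h1)
  · dsimp only
    rw [hlaw, integral_const_mul, integral_inner (hint _), h0, inner_zero_right, mul_zero]

/-- A moment bound for sums of martingale increments driven by an i.i.d. sequence. -/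
lemma lpLE_martingale_sum (hq : 2 ≤ q) (hβ : 0 ≤ β) (hξ : ∀ k, Measurable (ξ k))
    (hlaw : ∀ k, P.map (ξ k) = Pξ) (hind : iIndepFun ξ P) {Y : ℕ → Ω → S} {h : S → Z → E}
    (hY : ∀ k, Measurable[pastAlgebra ξ k] (Y k)) (hh : Measurable (Function.uncurry h))
    (hint : ∀ y, Integrable (h y) Pξ) (h0 : ∀ y, ∫ z, h y z ∂Pξ = 0) (m n : ℕ)
    (hb : ∀ j < n, LpLE P q β fun ω => h (Y (m + j) ω) (ξ (m + j + 1) ω)) :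
    LpLE P q ((√(6 * q) + sumConst q) * √n * β)
      (fun ω => ∑ i ∈ Finset.range n, h (Y (m + i) ω) (ξ (m + i + 1) ω)) := by
  have hq0 : 0 < q := by linarith
  have hmem : ∀ j ≤ n, MemLp (fun ω => ∑ i ∈ Finset.range j,
      h (Y (m + i) ω) (ξ (m + i + 1) ω)) (ENNReal.ofReal q) P :=
    fun j hj => memLp_finsetSum _ fun i hi =>
      (hb i ((Finset.mem_range.1 hi).trans_le hj)).memLp
  refine (lpLE_sum_of_orthogonal (s := β) hq hβ hβ hb (fun j hj => ?_) fun j hj => ?_).mono ?_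
  · exact integral_norm_rpow_mul_inner_eq_zero hq hξ hlaw hind
      (measurable_pastAlgebra_partialSum hY hh m j) (hY (m + j)) hh hint h0 (hmem j hj.le)
      (hb j hj).memLp
  -- No separate control of the conditional variance is assumed: Hölder lets the L^q bound β play
  -- its role.
  · refine (integral_norm_rpow_sub_two_mul_sq_le hq (hmem j hj.le) (hb j hj).memLp).trans ?_
    rw [mul_comm]
    gcongr
    have h1 := (hb j hj).integral_norm_rpow_le hq0
    calc _ ≤ (β ^ q) ^ (2 / q) := by
          refine Real.rpow_le_rpow (integral_nonneg fun _ => by positivity) h1 (by positivity)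
      _ = β ^ 2 := by
          rw [← Real.rpow_mul hβ, mul_div_cancel₀ _ hq0.ne', Real.rpow_two]
  · rcases Nat.eq_zero_or_pos n with rfl | hn
    · simp [Real.zero_rpow (inv_ne_zero hq0.ne')]
    have h1 : (n : ℝ) ^ (1 / q) ≤ √n := by
      rw [Real.sqrt_eq_rpow]
      exact Real.rpow_le_rpow_of_exponent_le (by exact_mod_cast hn)
        (one_div_le_one_div_of_le (by norm_num) hq)
    have h2 := mul_le_mul_of_nonneg_left h1 (mul_nonneg (sumConst_nonneg hq) hβ)
    nlinarith

/-- Rosenthal's inequality for i.i.d. centred vectors. -/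
lemma lpLE_iid_sum (hq : 2 ≤ q) (hβ : 0 ≤ β) (hξ : ∀ k, Measurable (ξ k))
    (hlaw : ∀ k, P.map (ξ k) = Pξ) (hind : iIndepFun ξ P) {h : Z → E} (hh : Measurable h)
    (hint : Integrable h Pξ) (h0 : ∫ z, h z ∂Pξ = 0) (m n : ℕ)
    (hb : ∀ k, LpLE P q β fun ω => h (ξ k ω)) :
    LpLE P q (√(6 * q) * √(∫ z, ‖h z‖ ^ 2 ∂Pξ) * √n + sumConst q * β * (n : ℝ) ^ (1 / q))
      (fun ω => ∑ i ∈ Finset.range n, h (ξ (m + i + 1) ω)) := by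
  have hq0 : 0 < q := by linarith
  have hmem : ∀ j, MemLp (fun ω => ∑ i ∈ Finset.range j,
      h (ξ (m + i + 1) ω)) (ENNReal.ofReal q) P :=
    fun j => memLp_finsetSum _ fun i _ => (hb _).memLp
  have hYm : ∀ k, Measurable[pastAlgebra ξ k] fun _ : Ω => () := fun k => measurable_const
  have hh' : Measurable (Function.uncurry fun (_ : Unit) (z : Z) => h z) := hh.comp measurable_snd
  have hpast : ∀ j, Measurable[pastAlgebra ξ (m + j)]
      fun ω => ∑ i ∈ Finset.range j, h (ξ (m + i + 1) ω) := fun j =>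
    measurable_pastAlgebra_partialSum (Y := fun _ _ => ()) (h := fun _ z => h z) hYm hh' m j
  refine lpLE_sum_of_orthogonal hq (Real.sqrt_nonneg _) hβ (fun j _ => hb _)
    (fun j hj => ?_) fun j hj => ?_
  · exact integral_norm_rpow_mul_inner_eq_zero (Y := fun _ => ()) (h := fun _ z => h z)
      hq hξ hlaw hind (hpast j) (hYm (m + j)) hh' (fun _ => hint) (fun _ => h0) (hmem j)
      (hb _).memLp
  -- Here the increment itself is independent of the past, so the integral factorizes and the true
  -- second moment enters instead of β². This produces the trace of the noise covariance in the
  -- final bound.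
  · have hi := (indepFun_of_measurable_pastAlgebra hξ hind (hpast j)).comp
      (φ := fun x => ‖x‖ ^ (q - 2)) (ψ := fun z => ‖h z‖ ^ 2)
      (measurable_norm.pow_const _) (hh.norm.pow_const _)
    have hpm := (hpast j).mono (pastAlgebra_le hξ _) le_rfl
    have e1 := hi.integral_fun_mul_eq_mul_integral
      (hpm.norm.pow_const _).aestronglyMeasurable
      ((hh.norm.pow_const _).comp (hξ _)).aestronglyMeasurable
    simp only [Function.comp_apply] at e1
    have e2 : ∫ ω, ‖h (ξ (m + j + 1) ω)‖ ^ 2 ∂P = ∫ z, ‖h z‖ ^ 2 ∂Pξ := by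
      rw [← hlaw (m + j + 1), integral_map (hξ _).aemeasurable
        (hh.norm.pow_const _).aestronglyMeasurable]
    have e3 := integral_norm_rpow_sub_two_mul_sq_le (W := fun _ : Ω => (1 : ℝ)) hq (hmem j)
      (memLp_const 1)
    simp only [norm_one, one_pow, mul_one, Real.one_rpow, integral_const, probReal_univ,
      smul_eq_mul] at e3
    rw [e1, e2, Real.sq_sqrt (integral_nonneg fun _ => by positivity), mul_comm]
    gcongr

end Martingale

/-! ### Moment bounds conditional on an independent variable. -/

section CondMoment

variable {Ω Z S E : Type*} [MeasurableSpace Ω] [MeasurableSpace Z] [MeasurableSpace S]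
  {P : Measure Ω} [IsProbabilityMeasure P] {Pξ : Measure Z} [IsProbabilityMeasure Pξ]
  [NormedAddCommGroup E] {q B : ℝ}

lemma eLpNorm_rpow_eq_lintegral {α : Type*} [MeasurableSpace α] {ν : Measure α} (hq : 0 < q)
    (X : α → E) :
    eLpNorm X (ENNReal.ofReal q) ν = (∫⁻ ω, ‖X ω‖ₑ ^ q ∂ν) ^ (1 / q) := by
  rw [eLpNorm_eq_lintegral_rpow_enorm_toReal (by simpa using hq) ENNReal.ofReal_ne_top,
    ENNReal.toReal_ofReal hq.le]

/-- A conditional moment bound given an independent variable integrates to a moment bound. -/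
lemma eLpNorm_le_of_indepFun [MeasurableSpace E] [BorelSpace E] [SecondCountableTopology E]
    (hq : 0 < q) {Y : Ω → S} {ζ : Ω → Z} (hY : Measurable Y)
    (hζ : Measurable ζ) (hlaw : P.map ζ = Pξ) (hind : IndepFun Y ζ P) {h : S → Z → E}
    (hh : Measurable (Function.uncurry h)) {b : S → ℝ} (hhb : ∀ y, LpLE Pξ q (b y) (h y)) :
    eLpNorm (fun ω => h (Y ω) (ζ ω)) (ENNReal.ofReal q) P ≤
      eLpNorm (fun ω => b (Y ω)) (ENNReal.ofReal q) P := by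
  rw [eLpNorm_rpow_eq_lintegral hq, eLpNorm_rpow_eq_lintegral hq]
  refine ENNReal.rpow_le_rpow ?_ (by positivity)
  have hmap := (indepFun_iff_map_prod_eq_prod_map_map hY.aemeasurable hζ.aemeasurable).1 hind
  have : IsProbabilityMeasure (P.map Y) := Measure.isProbabilityMeasure_map hY.aemeasurable
  have hm : Measurable fun x : S × Z => ‖h x.1 x.2‖ₑ ^ q := hh.enorm.pow_const _
  calc ∫⁻ ω, ‖h (Y ω) (ζ ω)‖ₑ ^ q ∂P
      = ∫⁻ x, ‖h x.1 x.2‖ₑ ^ q ∂(P.map fun ω => (Y ω, ζ ω)) :=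
        (lintegral_map hm (hY.prodMk hζ)).symm
    _ = ∫⁻ y, ∫⁻ z, ‖h y z‖ₑ ^ q ∂Pξ ∂(P.map Y) := by
        rw [hmap, hlaw, lintegral_prod _ hm.aemeasurable]
    _ = ∫⁻ ω, ∫⁻ z, ‖h (Y ω) z‖ₑ ^ q ∂Pξ ∂P := by
        rw [lintegral_map (Measurable.lintegral_prod_right' hm) hY]
    _ ≤ ∫⁻ ω, ‖b (Y ω)‖ₑ ^ q ∂P := by
        refine lintegral_mono fun ω => ?_
        have h1 := (hhb (Y ω)).le
        rw [eLpNorm_rpow_eq_lintegral hq, ← Real.enorm_eq_ofReal (hhb (Y ω)).nonneg] at h1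
        have h2 := ENNReal.rpow_le_rpow h1 hq.le
        rwa [← ENNReal.rpow_mul, one_div_mul_cancel hq.ne', ENNReal.rpow_one] at h2

lemma LpLE.of_indepFun [MeasurableSpace E] [BorelSpace E] [SecondCountableTopology E]
    (hq : 0 < q) {Y : Ω → S} {ζ : Ω → Z} (hY : Measurable Y)
    (hζ : Measurable ζ) (hlaw : P.map ζ = Pξ) (hind : IndepFun Y ζ P) {h : S → Z → E}
    (hh : Measurable (Function.uncurry h)) {b : S → ℝ}
    (hhb : ∀ y, LpLE Pξ q (b y) (h y)) (hbY : LpLE P q B fun ω => b (Y ω)) :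
    LpLE P q B fun ω => h (Y ω) (ζ ω) where
  aesm := (hh.comp (hY.prodMk hζ)).aestronglyMeasurable
  nonneg := hbY.nonneg
  le := (eLpNorm_le_of_indepFun hq hY hζ hlaw hind hh hhb).trans hbY.le

end CondMoment

/-- The properties of the objective and of the stochastic gradient near the minimizer that enter the
error expansion: `g` is the gradient, `H` its derivative at `θs`, `T` its second derivative there,
and `Φ` solves the Sylvester equation `Φ(H·, ·) + Φ(·, H·) = T`. -/
structure GradientModel {d : ℕ} {Z : Type*} [MeasurableSpace Z] (p μ L τ : ℝ) (Pξ : Measure Z)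
    (gradF : EuclideanSpace ℝ (Fin d) → Z → EuclideanSpace ℝ (Fin d))
    (θs : EuclideanSpace ℝ (Fin d))
    (g : EuclideanSpace ℝ (Fin d) → EuclideanSpace ℝ (Fin d))
    (H : EuclideanSpace ℝ (Fin d) →L[ℝ] EuclideanSpace ℝ (Fin d))
    (T Φ : EuclideanSpace ℝ (Fin d) →L[ℝ] EuclideanSpace ℝ (Fin d) →L[ℝ]
      EuclideanSpace ℝ (Fin d)) : Prop where
  two_le : 2 ≤ p
  μ_pos : 0 < μ
  L_pos : 0 < L
  measurable : Measurable (Function.uncurry gradF)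
  measurable_g : Measurable g
  integrable : ∀ θ, Integrable (gradF θ) Pξ
  unbiased : ∀ θ, ∫ z, gradF θ z ∂Pξ = g θ
  g_zero : g θs = 0
  noise_le : LpLE Pξ (3 * p) τ (gradF θs)
  diff_le : ∀ q, 2 ≤ q → q ≤ 2 * p → ∀ θ,
    LpLE Pξ q (L * ‖θ - θs‖) fun z => gradF θ z - gradF θs z
  norm_g_le : ∀ θ, ‖g θ‖ ≤ L * ‖θ - θs‖
  taylor_one : ∀ θ, ‖g θ - H (θ - θs)‖ ≤ L * ‖θ - θs‖ ^ 2
  taylor_two : ∀ θ, ‖g θ - H (θ - θs) - (1 / 2 : ℝ) • T (θ - θs) (θ - θs)‖ ≤ L * ‖θ - θs‖ ^ 3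
  norm_H_le : ‖H‖ ≤ L
  norm_Φ_le : ‖Φ‖ ≤ L / μ
  sylvester : ∀ x y, Φ (H x) y + Φ x (H y) = T x y

/-! ### The canonical noise space and the iterates on it. -/

section Noise

variable {Z : Type*} [MeasurableSpace Z] (Pξ : Measure Z) [IsProbabilityMeasure Pξ]

lemma map_eval_infinitePi (k : ℕ) :
    (Measure.infinitePi fun _ : ℕ => Pξ).map (fun z => z k) = Pξ :=
  (measurePreserving_eval_infinitePi (fun _ : ℕ => Pξ) k).map_eq

lemma iIndepFun_eval_infinitePi :
    iIndepFun (fun (k : ℕ) (z : ℕ → Z) => z k) (Measure.infinitePi fun _ : ℕ => Pξ) :=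
  iIndepFun_infinitePi (P := fun _ : ℕ => Pξ) (X := fun _ => id) fun _ => measurable_id

end Noise

section Iterates

variable {d : ℕ} {Z : Type*} [MeasurableSpace Z]
  {gradF : EuclideanSpace ℝ (Fin d) → Z → EuclideanSpace ℝ (Fin d)}

lemma measurable_sgdIter (hF : Measurable (Function.uncurry gradF)) (γ : ℝ) (k : ℕ) :
    Measurable fun x : EuclideanSpace ℝ (Fin d) × (ℕ → Z) => sgdIter gradF γ x.1 x.2 k := by
  induction k with
  | zero => exact measurable_fst
  | succ k ih =>
    exact ih.sub ((hF.comp (ih.prodMk ((measurable_pi_apply _).comp measurable_snd))).const_smul γ)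

lemma measurable_richardsonRomberg (hF : Measurable (Function.uncurry gradF)) (γ : ℝ) (n : ℕ) :
    Measurable fun x : EuclideanSpace ℝ (Fin d) × (ℕ → Z) =>
      richardsonRomberg gradF γ x.1 x.2 n := by
  have h : ∀ γ, Measurable fun x : EuclideanSpace ℝ (Fin d) × (ℕ → Z) =>
      polyakRuppert gradF γ x.1 x.2 n := fun γ => by
    simp only [polyakRuppert]
    exact (Finset.measurable_fun_sum _ fun k _ => measurable_sgdIter hF γ k).const_smul
      (n : ℝ)⁻¹
  simp only [richardsonRomberg]
  exact ((h γ).const_smul (2 : ℝ)).sub (h (2 * γ))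

lemma measurable_pastAlgebra_sgdIter (hF : Measurable (Function.uncurry gradF)) (γ : ℝ)
    (θ : EuclideanSpace ℝ (Fin d)) (k : ℕ) :
    Measurable[pastAlgebra (fun (k : ℕ) (z : ℕ → Z) => z k) k]
      fun z : ℕ → Z => sgdIter gradF γ θ z k := by
  induction k with
  | zero => exact measurable_const
  | succ k ih =>
    have ih' := ih.mono (pastAlgebra_mono (fun (k : ℕ) (z : ℕ → Z) => z k) k.le_succ) le_rfl
    have hz : Measurable[pastAlgebra (fun (k : ℕ) (z : ℕ → Z) => z k) (k + 1)]
        fun z : ℕ → Z => z (k + 1) :=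
      measurable_pastAlgebra (fun (k : ℕ) (z : ℕ → Z) => z k) le_rfl
    exact ih'.sub ((hF.comp (ih'.prodMk hz)).const_smul γ)

lemma sum_Icc_eq_sum_range {M : Type*} [AddCommMonoid M] (a : ℕ → M) (n : ℕ) :
    ∑ k ∈ Finset.Icc (n + 1) (2 * n), a k = ∑ i ∈ Finset.range n, a (n + 1 + i) := by
  have : Finset.Icc (n + 1) (2 * n) = Finset.Ico (n + 1) (2 * n + 1) := by
    ext k; simp only [Finset.mem_Icc, Finset.mem_Ico]; omega
  rw [this, Finset.sum_Ico_eq_sum_range, show 2 * n + 1 - (n + 1) = n by omega]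

end Iterates

/-! ### The one-step error expansion. -/

section Expansion

variable {d : ℕ} {Z : Type*} [MeasurableSpace Z] {p μ L τ : ℝ} {Pξ : Measure Z}
  [IsProbabilityMeasure Pξ]
  {gradF : EuclideanSpace ℝ (Fin d) → Z → EuclideanSpace ℝ (Fin d)}
  {θs : EuclideanSpace ℝ (Fin d)}
  {g : EuclideanSpace ℝ (Fin d) → EuclideanSpace ℝ (Fin d)}
  {H : EuclideanSpace ℝ (Fin d) →L[ℝ] EuclideanSpace ℝ (Fin d)}
  {T Φ : EuclideanSpace ℝ (Fin d) →L[ℝ] EuclideanSpace ℝ (Fin d) →L[ℝ]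
      EuclideanSpace ℝ (Fin d)}

/-- One step of SGD, solved for the linear term. -/
lemma hessian_apply_eq {γ : ℝ} (hγ : γ ≠ 0)
    (hs : ∀ x y, Φ (H x) y + Φ x (H y) = T x y) (x gx G e : EuclideanSpace ℝ (Fin d)) :
    H x = -e - (γ / 2) • Φ e e + (γ⁻¹ • (x - (x - γ • G))
      - (γ⁻¹ / 2) • (Φ x x - Φ (x - γ • G) (x - γ • G))
      - (G - gx - e) - (gx - H x - (1 / 2 : ℝ) • T x x)
      + (1 / 2 : ℝ) • (Φ x (gx - H x) + Φ (gx - H x) x)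
      + (1 / 2 : ℝ) • (Φ x (G - gx) + Φ (G - gx) x)
      - (γ / 2) • (Φ G G - Φ e e)) := by
  rw [← hs x x]
  have h1 : γ⁻¹ • (x - (x - γ • G)) = G := by
    rw [sub_sub_cancel, smul_smul, inv_mul_cancel₀ hγ, one_smul]
  -- The increment of Φ(x, x) over a step; its part linear in G turns into T(x, x) when G is
  -- replaced by Hx and the Sylvester equation is used.
  have h2 : (γ⁻¹ / 2) • (Φ x x - Φ (x - γ • G) (x - γ • G)) =
      (1 / 2 : ℝ) • (Φ x G + Φ G x) - (γ / 2) • Φ G G := by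
    simp only [map_sub, map_smul, sub_apply, smul_apply]
    match_scalars <;> field_simp; ring
  rw [h1, h2]
  simp only [map_sub, sub_apply]
  module

end Expansion

lemma LpLE.comp_of_map_eq {Ω Z E : Type*} [MeasurableSpace Ω] [MeasurableSpace Z]
    {P : Measure Ω} {Pξ : Measure Z} [NormedAddCommGroup E] {q B : ℝ} {ζ : Ω → Z}
    (hζ : Measurable ζ) (hlaw : P.map ζ = Pξ) {h : Z → E} (hh : LpLE Pξ q B h) :
    LpLE P q B fun ω => h (ζ ω) where
  aesm := by
    have := hh.aesm
    rw [← hlaw] at this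
    exact this.comp_measurable hζ
  nonneg := hh.nonneg
  le := by
    have h1 := hh.le
    have h2 := hh.aesm
    rw [← hlaw] at h1 h2
    rwa [eLpNorm_map_measure h2 hζ.aemeasurable] at h1

lemma measurable_bilin {d : ℕ} {α : Type*} [MeasurableSpace α]
    (Φ : EuclideanSpace ℝ (Fin d) →L[ℝ] EuclideanSpace ℝ (Fin d) →L[ℝ] EuclideanSpace ℝ (Fin d))
    {a b : α → EuclideanSpace ℝ (Fin d)} (ha : Measurable a) (hb : Measurable b) :
    Measurable fun x => Φ (a x) (b x) :=
  Φ.continuous₂.measurable.comp (ha.prodMk hb)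

/-! ### Bounds for the fluctuation terms of the expansion. -/

namespace GradientModel

variable {d : ℕ} {Z : Type*} [MeasurableSpace Z] {p μ L τ : ℝ} {Pξ : Measure Z}
  [IsProbabilityMeasure Pξ]
  {gradF : EuclideanSpace ℝ (Fin d) → Z → EuclideanSpace ℝ (Fin d)}
  {θs : EuclideanSpace ℝ (Fin d)}
  {g : EuclideanSpace ℝ (Fin d) → EuclideanSpace ℝ (Fin d)}
  {H : EuclideanSpace ℝ (Fin d) →L[ℝ] EuclideanSpace ℝ (Fin d)}
  {T Φ : EuclideanSpace ℝ (Fin d) →L[ℝ] EuclideanSpace ℝ (Fin d) →L[ℝ]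
      EuclideanSpace ℝ (Fin d)} {γ m q : ℝ} {θ : EuclideanSpace ℝ (Fin d)}

omit [IsProbabilityMeasure Pξ] in
lemma measurable_iter (hm : GradientModel p μ L τ Pξ gradF θs g H T Φ) (γ : ℝ)
    (θ : EuclideanSpace ℝ (Fin d)) (k : ℕ) : Measurable fun z : ℕ → Z => sgdIter gradF γ θ z k :=
  (measurable_sgdIter hm.measurable γ k).comp (measurable_const.prodMk measurable_id)

/-- The k-th iterate depends on the noise up to index k only, so a moment bound at every fixed point
may be evaluated at the iterate. -/
lemma lpLE_of_forall (hm : GradientModel p μ L τ Pξ gradF θs g H T Φ) (hq : 0 < q)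
    {h : EuclideanSpace ℝ (Fin d) → Z → EuclideanSpace ℝ (Fin d)}
    (hh : Measurable (Function.uncurry h)) {b : EuclideanSpace ℝ (Fin d) → ℝ} {B : ℝ}
    (hhb : ∀ y, LpLE Pξ q (b y) (h y)) (k : ℕ)
    (hbY : LpLE (Measure.infinitePi fun _ : ℕ => Pξ) q B fun z => b (sgdIter gradF γ θ z k)) :
    LpLE (Measure.infinitePi fun _ : ℕ => Pξ) q B
      fun z => h (sgdIter gradF γ θ z k) (z (k + 1)) := by
  have hind : IndepFun (fun z : ℕ → Z => sgdIter gradF γ θ z k) (fun z => z (k + 1))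
      (Measure.infinitePi fun _ : ℕ => Pξ) :=
    indepFun_of_measurable_pastAlgebra (ξ := fun (k : ℕ) (z : ℕ → Z) => z k)
      (fun _ => measurable_pi_apply _) (iIndepFun_eval_infinitePi Pξ)
      (measurable_pastAlgebra_sgdIter hm.measurable γ θ k)
  exact LpLE.of_indepFun (Y := fun z : ℕ → Z => sgdIter gradF γ θ z k)
    (ζ := fun z : ℕ → Z => z (k + 1)) hq (hm.measurable_iter γ θ k) (measurable_pi_apply _)
    (map_eval_infinitePi Pξ (k + 1)) hind hh hhb hbY

lemma lpLE_diff (hm : GradientModel p μ L τ Pξ gradF θs g H T Φ) (hq : 2 ≤ q) (hqp : q ≤ 2 * p)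
    {k : ℕ} (hx : LpLE (Measure.infinitePi fun _ : ℕ => Pξ) q m
      fun z => sgdIter gradF γ θ z k - θs) :
    LpLE (Measure.infinitePi fun _ : ℕ => Pξ) q (L * m)
      fun z => gradF (sgdIter gradF γ θ z k) (z (k + 1)) - gradF θs (z (k + 1)) :=
  hm.lpLE_of_forall (by linarith) (h := fun y z => gradF y z - gradF θs z)
    (hm.measurable.sub (hm.measurable.comp (measurable_const.prodMk measurable_snd)))
    (hm.diff_le q hq hqp) k (hx.norm.const_smul hm.L_pos.le)

lemma lpLE_noise (hm : GradientModel p μ L τ Pξ gradF θs g H T Φ) (hq : q ≤ 3 * p) (k : ℕ) :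
    LpLE (Measure.infinitePi fun _ : ℕ => Pξ) q τ fun z => gradF θs (z k) :=
  (hm.noise_le.exponent_mono hq).comp_of_map_eq (measurable_pi_apply k) (map_eval_infinitePi Pξ k)

omit [IsProbabilityMeasure Pξ] in
lemma measurable_centered (hm : GradientModel p μ L τ Pξ gradF θs g H T Φ) :
    Measurable fun x : EuclideanSpace ℝ (Fin d) × Z => gradF x.1 x.2 - g x.1 :=
  hm.measurable.sub (hm.measurable_g.comp measurable_fst)

lemma lpLE_centered_sub (hm : GradientModel p μ L τ Pξ gradF θs g H T Φ)
    (y : EuclideanSpace ℝ (Fin d)) :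
    LpLE Pξ p (2 * L * ‖y - θs‖) fun z => gradF y z - g y - gradF θs z := by
  have hp := hm.two_le
  have h1 := hm.diff_le p hp (by linarith) y
  have h2 : LpLE Pξ p (L * ‖y - θs‖) fun _ : Z => g y := LpLE.const (hm.norm_g_le y) (by linarith)
  have h3 := (h1.sub h2 (by linarith)).mono (C := 2 * L * ‖y - θs‖) (by linarith)
  simpa only [sub_right_comm] using h3

lemma lpLE_centered (hm : GradientModel p μ L τ Pξ gradF θs g H T Φ)
    (y : EuclideanSpace ℝ (Fin d)) :
    LpLE Pξ p (2 * L * ‖y - θs‖ + τ) fun z => gradF y z - g y := by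
  have hp := hm.two_le
  have := (hm.lpLE_centered_sub y).add (hm.noise_le.exponent_mono (q := p) (by linarith))
    (by linarith)
  simpa only [sub_add_cancel] using this

/-- The constant of the moment inequality for martingales. -/
noncomputable def martConst (p : ℝ) : ℝ := √(6 * p) + sumConst p

lemma martConst_nonneg (hp : 2 ≤ p) : 0 ≤ martConst p :=
  add_nonneg (Real.sqrt_nonneg _) (sumConst_nonneg hp)

/-- This is the cost of replacing the centred noise at the iterates by the noise at the minimizer.
The differences are martingale increments of size proportional to the error, hence of order m√n and
not mn. -/
lemma lpLE_sum_centered_sub (hm : GradientModel p μ L τ Pξ gradF θs g H T Φ) (hm0 : 0 ≤ m)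
    (l n : ℕ) (hx : ∀ k, l ≤ k → LpLE (Measure.infinitePi fun _ : ℕ => Pξ) p m
      fun z => sgdIter gradF γ θ z k - θs) :
    LpLE (Measure.infinitePi fun _ : ℕ => Pξ) p (martConst p * √n * (2 * L * m)) fun z =>
      ∑ i ∈ Finset.range n, (gradF (sgdIter gradF γ θ z (l + i)) (z (l + i + 1))
        - g (sgdIter gradF γ θ z (l + i)) - gradF θs (z (l + i + 1))) := by
  have hp := hm.two_le
  have hL := hm.L_pos
  have hmeas : Measurable (Function.uncurry
      fun (y : EuclideanSpace ℝ (Fin d)) (z : Z) => gradF y z - g y - gradF θs z) :=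
    hm.measurable_centered.sub (hm.measurable.comp (measurable_const.prodMk measurable_snd))
  have hi : ∀ y, Integrable (fun z => gradF y z - g y) Pξ :=
    fun y => (hm.integrable y).sub (integrable_const _)
  refine lpLE_martingale_sum (h := fun y z => gradF y z - g y - gradF θs z)
    (ξ := fun (k : ℕ) (z : ℕ → Z) => z k) (Y := fun k z => sgdIter gradF γ θ z k) hp
    (by positivity) (fun _ => measurable_pi_apply _) (map_eval_infinitePi Pξ)
    (iIndepFun_eval_infinitePi Pξ) (measurable_pastAlgebra_sgdIter hm.measurable γ θ) hmeas
    (fun y => (hi y).sub (hm.integrable θs)) (fun y => ?_) l n fun j _ => ?_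
  · rw [integral_sub (hi y) (hm.integrable θs),
      integral_sub (hm.integrable y) (integrable_const _), hm.unbiased, hm.unbiased, hm.g_zero]
    simp
  · exact hm.lpLE_of_forall (by linarith) hmeas hm.lpLE_centered_sub (l + j)
      ((hx (l + j) (by omega)).norm.const_smul (by positivity))

omit [IsProbabilityMeasure Pξ] in
lemma norm_bilin_le (hm : GradientModel p μ L τ Pξ gradF θs g H T Φ)
    (x y : EuclideanSpace ℝ (Fin d)) : ‖Φ x y‖ ≤ L / μ * ‖x‖ * ‖y‖ :=
  (Φ.le_opNorm₂ x y).trans (by gcongr; exact hm.norm_Φ_le)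

/-- Given the past, Φ(x, ·) and Φ(·, x) are linear in a centred variable, so these are martingale
increments. Conditioning on x first means that only x needs moments of order 2p. -/
lemma lpLE_sum_bilin_centered (hm : GradientModel p μ L τ Pξ gradF θs g H T Φ) (hm0 : 0 ≤ m)
    (l n : ℕ) (hx : ∀ k, l ≤ k → LpLE (Measure.infinitePi fun _ : ℕ => Pξ) (2 * p) m
      fun z => sgdIter gradF γ θ z k - θs) :
    LpLE (Measure.infinitePi fun _ : ℕ => Pξ) p
      (martConst p * √n * (2 * (L / μ) * (2 * L * m ^ 2 + τ * m))) fun z =>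
      ∑ i ∈ Finset.range n, (Φ (sgdIter gradF γ θ z (l + i) - θs)
          (gradF (sgdIter gradF γ θ z (l + i)) (z (l + i + 1)) - g (sgdIter gradF γ θ z (l + i)))
        + Φ (gradF (sgdIter gradF γ θ z (l + i)) (z (l + i + 1))
          - g (sgdIter gradF γ θ z (l + i))) (sgdIter gradF γ θ z (l + i) - θs)) := by
  have hp := hm.two_le
  have hL := hm.L_pos
  have hμ := hm.μ_pos
  have hτ := hm.noise_le.nonneg
  have hsub : Measurable fun x : EuclideanSpace ℝ (Fin d) × Z => x.1 - θs :=
    measurable_fst.sub_const θs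
  have hmeas : Measurable (Function.uncurry
      fun (y : EuclideanSpace ℝ (Fin d)) (z : Z) =>
        Φ (y - θs) (gradF y z - g y) + Φ (gradF y z - g y) (y - θs)) :=
    (measurable_bilin Φ hsub hm.measurable_centered).add
      (measurable_bilin Φ hm.measurable_centered hsub)
  have hi : ∀ y, Integrable (fun z => gradF y z - g y) Pξ :=
    fun y => (hm.integrable y).sub (integrable_const _)
  have hi0 : ∀ y, ∫ z, gradF y z - g y ∂Pξ = 0 := fun y => by
    rw [integral_sub (hm.integrable y) (integrable_const _), hm.unbiased]; simp
  refine lpLE_martingale_sum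
    (h := fun y z => Φ (y - θs) (gradF y z - g y) + Φ (gradF y z - g y) (y - θs))
    (ξ := fun (k : ℕ) (z : ℕ → Z) => z k) (Y := fun k z => sgdIter gradF γ θ z k) hp
    (by positivity) (fun _ => measurable_pi_apply _) (map_eval_infinitePi Pξ)
    (iIndepFun_eval_infinitePi Pξ) (measurable_pastAlgebra_sgdIter hm.measurable γ θ) hmeas
    (fun y => ((Φ (y - θs)).integrable_comp (hi y)).add
      ((Φ.flip (y - θs)).integrable_comp (hi y))) (fun y => ?_) l n fun j _ => ?_
  · have e1 := (Φ (y - θs)).integral_comp_comm (hi y)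
    have e2 := (Φ.flip (y - θs)).integral_comp_comm (hi y)
    rw [hi0, map_zero] at e1 e2
    have := integral_add ((Φ (y - θs)).integrable_comp (hi y))
      ((Φ.flip (y - θs)).integrable_comp (hi y))
    rw [e1, e2, add_zero] at this
    exact this
  · refine hm.lpLE_of_forall (by linarith) hmeas
      (b := fun y => 2 * (L / μ) * (2 * L * ‖y - θs‖ ^ 2 + τ * ‖y - θs‖)) (fun y => ?_) (l + j) ?_
    · refine ((hm.lpLE_centered y).of_norm_le (C := 2 * (L / μ) * ‖y - θs‖)
        (hmeas.comp (measurable_const.prodMk measurable_id)).aestronglyMeasurable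
        (by positivity) fun z => ?_).mono (le_of_eq (by ring))
      change ‖Φ (y - θs) (gradF y z - g y) + Φ (gradF y z - g y) (y - θs)‖ ≤ _
      refine (norm_add_le _ _).trans ?_
      have b1 := hm.norm_bilin_le (y - θs) (gradF y z - g y)
      have b2 := hm.norm_bilin_le (gradF y z - g y) (y - θs)
      linarith
    · have h1 := (hx (l + j) (by omega)).exponent_mono (q := p) (by linarith)
      have h2 := LpLE.norm_pow (m := 2) (q := p) two_ne_zero
        (by simpa using hx (l + j) (by omega))
      exact (((h2.const_smul (c := 2 * L) (by positivity)).add (h1.norm.const_smul hτ)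
        (by linarith)).const_smul (c := 2 * (L / μ)) (by positivity))

/-- Write Φ(G, G) - Φ(e, e) in terms of e and G - e. The cross terms are split by Young's inequality
with a free weight `lam`; taking it of the order of m later makes both parts of order m. -/
lemma lpLE_bilin_sub (hm : GradientModel p μ L τ Pξ gradF θs g H T Φ) {lam : ℝ} (hlam : 0 < lam)
    {k : ℕ} (hx : LpLE (Measure.infinitePi fun _ : ℕ => Pξ) (2 * p) m
      fun z => sgdIter gradF γ θ z k - θs) :
    LpLE (Measure.infinitePi fun _ : ℕ => Pξ) p
      (L / μ * (lam * τ ^ 2 + (lam⁻¹ + 1) * (L * m) ^ 2)) fun z =>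
      Φ (gradF (sgdIter gradF γ θ z k) (z (k + 1))) (gradF (sgdIter gradF γ θ z k) (z (k + 1)))
        - Φ (gradF θs (z (k + 1))) (gradF θs (z (k + 1))) := by
  have hp := hm.two_le
  have hL := hm.L_pos
  have hμ := hm.μ_pos
  have h1 := LpLE.norm_pow (m := 2) (q := p) two_ne_zero
    (by simpa using hm.lpLE_diff (by linarith) le_rfl hx)
  have h2 := LpLE.norm_pow (m := 2) (q := p) two_ne_zero
    (by simpa using hm.lpLE_noise (q := 2 * p) (by linarith) (k + 1))
  have hG : Measurable fun z : ℕ → Z => gradF (sgdIter gradF γ θ z k) (z (k + 1)) :=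
    hm.measurable.comp ((hm.measurable_iter γ θ k).prodMk (measurable_pi_apply _))
  have he : Measurable fun z : ℕ → Z => gradF θs (z (k + 1)) :=
    hm.measurable.comp (measurable_const.prodMk (measurable_pi_apply _))
  refine ((h2.const_smul hlam.le).add (h1.const_smul (c := lam⁻¹ + 1) (by positivity))
    (by linarith)).of_norm_le (C := L / μ)
    ((measurable_bilin Φ hG hG).sub (measurable_bilin Φ he he)).aestronglyMeasurable
    (by positivity) fun z => ?_
  set G := gradF (sgdIter gradF γ θ z k) (z (k + 1))
  set e := gradF θs (z (k + 1))
  have e1 : Φ G G - Φ e e = Φ e (G - e) + Φ (G - e) e + Φ (G - e) (G - e) := by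
    simp only [map_sub, sub_apply]; abel
  have b1 := hm.norm_bilin_le e (G - e)
  have b2 := hm.norm_bilin_le (G - e) e
  have b3 := hm.norm_bilin_le (G - e) (G - e)
  have am : 2 * (‖e‖ * ‖G - e‖) ≤ lam * ‖e‖ ^ 2 + lam⁻¹ * ‖G - e‖ ^ 2 := by
    have h : lam * ‖e‖ ^ 2 + lam⁻¹ * ‖G - e‖ ^ 2 - 2 * (‖e‖ * ‖G - e‖)
        = lam⁻¹ * (lam * ‖e‖ - ‖G - e‖) ^ 2 := by field_simp; ring
    have : 0 ≤ lam⁻¹ * (lam * ‖e‖ - ‖G - e‖) ^ 2 := by positivity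
    linarith
  have hF : 0 ≤ L / μ := by positivity
  rw [e1, smul_eq_mul, smul_eq_mul, Real.norm_of_nonneg (by positivity)]
  calc _ ≤ ‖Φ e (G - e)‖ + ‖Φ (G - e) e‖ + ‖Φ (G - e) (G - e)‖ := norm_add₃_le
    _ ≤ L / μ * (2 * (‖e‖ * ‖G - e‖) + ‖G - e‖ ^ 2) := by linarith
    _ ≤ L / μ * (lam * ‖e‖ ^ 2 + (lam⁻¹ + 1) * ‖G - e‖ ^ 2) :=
        mul_le_mul_of_nonneg_left (by rw [add_mul]; linarith) hF

end GradientModel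

/-! ### Cubic and boundary terms, and the summed expansion. -/

namespace GradientModel

variable {d : ℕ} {Z : Type*} [MeasurableSpace Z] {p μ L τ : ℝ} {Pξ : Measure Z}
  [IsProbabilityMeasure Pξ]
  {gradF : EuclideanSpace ℝ (Fin d) → Z → EuclideanSpace ℝ (Fin d)}
  {θs : EuclideanSpace ℝ (Fin d)}
  {g : EuclideanSpace ℝ (Fin d) → EuclideanSpace ℝ (Fin d)}
  {H : EuclideanSpace ℝ (Fin d) →L[ℝ] EuclideanSpace ℝ (Fin d)}
  {T Φ : EuclideanSpace ℝ (Fin d) →L[ℝ] EuclideanSpace ℝ (Fin d) →L[ℝ]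
      EuclideanSpace ℝ (Fin d)} {γ m q : ℝ} {θ : EuclideanSpace ℝ (Fin d)}

lemma lpLE_taylor_two (hm : GradientModel p μ L τ Pξ gradF θs g H T Φ) {k : ℕ}
    (hx : LpLE (Measure.infinitePi fun _ : ℕ => Pξ) (3 * p) m
      fun z => sgdIter gradF γ θ z k - θs) :
    LpLE (Measure.infinitePi fun _ : ℕ => Pξ) p (L * m ^ 3) fun z =>
      g (sgdIter gradF γ θ z k) - H (sgdIter gradF γ θ z k - θs)
        - (1 / 2 : ℝ) • T (sgdIter gradF γ θ z k - θs) (sgdIter gradF γ θ z k - θs) := by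
  have h1 := LpLE.norm_pow (m := 3) (q := p) three_ne_zero (by simpa using hx)
  have hi := hm.measurable_iter γ θ k
  have hs := hi.sub_const θs
  refine h1.of_norm_le (((hm.measurable_g.comp hi).sub (H.measurable.comp hs)).sub
    ((measurable_bilin T hs hs).const_smul (1 / 2 : ℝ))).aestronglyMeasurable hm.L_pos.le
    fun z => ?_
  rw [Real.norm_of_nonneg (by positivity)]
  exact hm.taylor_two _

/-- The Sylvester equation applies to Hx, while the mean of G is g; exchanging them inside Φ costs a
quadratic Taylor error times ‖x‖, which is cubic. -/
lemma lpLE_bilin_taylor_one (hm : GradientModel p μ L τ Pξ gradF θs g H T Φ) {k : ℕ}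
    (hx : LpLE (Measure.infinitePi fun _ : ℕ => Pξ) (3 * p) m
      fun z => sgdIter gradF γ θ z k - θs) :
    LpLE (Measure.infinitePi fun _ : ℕ => Pξ) p (2 * (L / μ) * L * m ^ 3) fun z =>
      Φ (sgdIter gradF γ θ z k - θs)
        (g (sgdIter gradF γ θ z k) - H (sgdIter gradF γ θ z k - θs))
      + Φ (g (sgdIter gradF γ θ z k) - H (sgdIter gradF γ θ z k - θs))
        (sgdIter gradF γ θ z k - θs) := by
  have hL := hm.L_pos
  have hμ := hm.μ_pos
  have h1 := LpLE.norm_pow (m := 3) (q := p) three_ne_zero (by simpa using hx)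
  have hi := hm.measurable_iter γ θ k
  have hs := hi.sub_const θs
  have hη := (hm.measurable_g.comp hi).sub (H.measurable.comp hs)
  refine h1.of_norm_le ((measurable_bilin Φ hs hη).add
    (measurable_bilin Φ hη hs)).aestronglyMeasurable (by positivity) fun z => ?_
  set x := sgdIter gradF γ θ z k
  have hb := hm.taylor_one x
  have b1 := hm.norm_bilin_le (x - θs) (g x - H (x - θs))
  have b2 := hm.norm_bilin_le (g x - H (x - θs)) (x - θs)
  rw [Real.norm_of_nonneg (by positivity)]
  calc _ ≤ 2 * (L / μ) * ‖x - θs‖ * ‖g x - H (x - θs)‖ := (norm_add_le _ _).trans (by linarith)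
    _ ≤ 2 * (L / μ) * ‖x - θs‖ * (L * ‖x - θs‖ ^ 2) := by gcongr
    _ = _ := by ring

lemma lpLE_bilin_self (hm : GradientModel p μ L τ Pξ gradF θs g H T Φ) {k : ℕ}
    (hx : LpLE (Measure.infinitePi fun _ : ℕ => Pξ) (2 * p) m
      fun z => sgdIter gradF γ θ z k - θs) :
    LpLE (Measure.infinitePi fun _ : ℕ => Pξ) p (L / μ * m ^ 2) fun z =>
      Φ (sgdIter gradF γ θ z k - θs) (sgdIter gradF γ θ z k - θs) := by
  have hL := hm.L_pos
  have hμ := hm.μ_pos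
  have h1 := LpLE.norm_pow (m := 2) (q := p) two_ne_zero (by simpa using hx)
  have hs := (hm.measurable_iter γ θ k).sub_const θs
  refine h1.of_norm_le (measurable_bilin Φ hs hs).aestronglyMeasurable (by positivity) fun z => ?_
  rw [Real.norm_of_nonneg (by positivity), pow_two, ← mul_assoc]
  exact hm.norm_bilin_le _ _

omit [IsProbabilityMeasure Pξ] in
/-- The linear term of the error expansion of the sum of `n` consecutive iterates, up to the noise
at the minimizer. -/
lemma sum_hessian_apply_eq (hm : GradientModel p μ L τ Pξ gradF θs g H T Φ) (hγ : γ ≠ 0)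
    (l n : ℕ) (z : ℕ → Z) :
    ∑ i ∈ Finset.range n, H (sgdIter gradF γ θ z (l + i) - θs)
      + ∑ i ∈ Finset.range n, gradF θs (z (l + i + 1))
      + (γ / 2) • ∑ i ∈ Finset.range n,
        Φ (gradF θs (z (l + i + 1))) (gradF θs (z (l + i + 1))) =
    γ⁻¹ • ((sgdIter gradF γ θ z l - θs) - (sgdIter gradF γ θ z (l + n) - θs))
    - (γ⁻¹ / 2) • (Φ (sgdIter gradF γ θ z l - θs) (sgdIter gradF γ θ z l - θs)
      - Φ (sgdIter gradF γ θ z (l + n) - θs) (sgdIter gradF γ θ z (l + n) - θs))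
    - ∑ i ∈ Finset.range n, (gradF (sgdIter gradF γ θ z (l + i)) (z (l + i + 1))
        - g (sgdIter gradF γ θ z (l + i)) - gradF θs (z (l + i + 1)))
    - ∑ i ∈ Finset.range n, (g (sgdIter gradF γ θ z (l + i))
        - H (sgdIter gradF γ θ z (l + i) - θs)
        - (1 / 2 : ℝ) • T (sgdIter gradF γ θ z (l + i) - θs) (sgdIter gradF γ θ z (l + i) - θs))
    + (1 / 2 : ℝ) • ∑ i ∈ Finset.range n, (Φ (sgdIter gradF γ θ z (l + i) - θs)
        (g (sgdIter gradF γ θ z (l + i)) - H (sgdIter gradF γ θ z (l + i) - θs))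
      + Φ (g (sgdIter gradF γ θ z (l + i)) - H (sgdIter gradF γ θ z (l + i) - θs))
        (sgdIter gradF γ θ z (l + i) - θs))
    + (1 / 2 : ℝ) • ∑ i ∈ Finset.range n, (Φ (sgdIter gradF γ θ z (l + i) - θs)
          (gradF (sgdIter gradF γ θ z (l + i)) (z (l + i + 1)) - g (sgdIter gradF γ θ z (l + i)))
        + Φ (gradF (sgdIter gradF γ θ z (l + i)) (z (l + i + 1))
          - g (sgdIter gradF γ θ z (l + i))) (sgdIter gradF γ θ z (l + i) - θs))
    - (γ / 2) • ∑ i ∈ Finset.range n,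
      (Φ (gradF (sgdIter gradF γ θ z (l + i)) (z (l + i + 1)))
          (gradF (sgdIter gradF γ θ z (l + i)) (z (l + i + 1)))
        - Φ (gradF θs (z (l + i + 1))) (gradF θs (z (l + i + 1)))) := by
  induction n with
  | zero => simp
  | succ n ih =>
    simp only [Finset.sum_range_succ, ← Nat.add_assoc]
    have step := hessian_apply_eq hγ hm.sylvester (sgdIter gradF γ θ z (l + n) - θs)
      (g (sgdIter gradF γ θ z (l + n)))
      (gradF (sgdIter gradF γ θ z (l + n)) (z (l + n + 1))) (gradF θs (z (l + n + 1)))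
    have e : sgdIter gradF γ θ z (l + n) - θs
        - γ • gradF (sgdIter gradF γ θ z (l + n)) (z (l + n + 1))
        = sgdIter gradF γ θ z (l + n + 1) - θs := by
      rw [sgdIter]; abel
    rw [e] at step
    linear_combination (norm := module) ih + step

/-- The `L^p` bound for the error of the Polyak–Ruppert average beyond its noise terms. -/
lemma lpLE_remainder (hm : GradientModel p μ L τ Pξ gradF θs g H T Φ) (hγ : 0 < γ) {lam : ℝ}
    (hlam : 0 < lam) (hm0 : 0 ≤ m) {l n : ℕ} (hn : 0 < n)
    (hx : ∀ k, l ≤ k → LpLE (Measure.infinitePi fun _ : ℕ => Pξ) (3 * p) m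
      fun z => sgdIter gradF γ θ z k - θs) :
    LpLE (Measure.infinitePi fun _ : ℕ => Pξ) p
      (2 * m / (γ * n) + L / μ * m ^ 2 / (γ * n) + martConst p * (2 * L * m) / √n + L * m ^ 3
        + L / μ * L * m ^ 3 + martConst p * (L / μ * (2 * L * m ^ 2 + τ * m)) / √n
        + γ * (L / μ * (lam * τ ^ 2 + (lam⁻¹ + 1) * (L * m) ^ 2)))
      fun z => (n : ℝ)⁻¹ • (∑ i ∈ Finset.range n, H (sgdIter gradF γ θ z (l + i) - θs)
        + ∑ i ∈ Finset.range n, gradF θs (z (l + i + 1))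
        + (γ / 2) • ∑ i ∈ Finset.range n,
          Φ (gradF θs (z (l + i + 1))) (gradF θs (z (l + i + 1)))) := by
  have hp := hm.two_le
  have hp1 : 1 ≤ p := by linarith
  have hL := hm.L_pos
  have hμ := hm.μ_pos
  have hτ := hm.noise_le.nonneg
  have hn' : (0 : ℝ) < n := by exact_mod_cast hn
  have hx1 : ∀ k, l ≤ k → LpLE (Measure.infinitePi fun _ : ℕ => Pξ) p m
      fun z => sgdIter gradF γ θ z k - θs := fun k hk => (hx k hk).exponent_mono (by linarith)
  have hx2 : ∀ k, l ≤ k → LpLE (Measure.infinitePi fun _ : ℕ => Pξ) (2 * p) m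
      fun z => sgdIter gradF γ θ z k - θs := fun k hk => (hx k hk).exponent_mono (by linarith)
  have s1 := ((hx1 l le_rfl).sub (hx1 (l + n) (by omega)) hp1).const_smul (inv_nonneg.2 hγ.le)
  have s2 := ((hm.lpLE_bilin_self (hx2 l le_rfl)).sub
    (hm.lpLE_bilin_self (hx2 (l + n) (by omega))) hp1).const_smul
    (c := γ⁻¹ / 2) (by positivity)
  have s3 := hm.lpLE_sum_centered_sub hm0 l n hx1
  have s4 := LpLE.sum (s := Finset.range n) hp1
    fun i _ => hm.lpLE_taylor_two (hx (l + i) (by omega))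
  have s5 := (LpLE.sum (s := Finset.range n) hp1
    fun i _ => hm.lpLE_bilin_taylor_one (hx (l + i) (by omega))).const_smul
    (c := (1 / 2 : ℝ)) (by positivity)
  have s6 := (hm.lpLE_sum_bilin_centered hm0 l n hx2).const_smul (c := (1 / 2 : ℝ)) (by positivity)
  have s7 := (LpLE.sum (s := Finset.range n) hp1
    fun i _ => hm.lpLE_bilin_sub hlam (hx2 (l + i) (by omega))).const_smul
    (c := γ / 2) (by positivity)
  have key := (((((((s1.sub s2 hp1).sub s3 hp1).sub s4 hp1).add s5 hp1).add s6 hp1).sub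
    s7 hp1)).const_smul (c := (n : ℝ)⁻¹) (by positivity)
  simp only [← hm.sum_hessian_apply_eq hγ.ne' l n] at key
  refine key.mono ?_
  simp only [Finset.sum_const, Finset.card_range, nsmul_eq_mul]
  have hsq : (n : ℝ)⁻¹ * √n = 1 / √n := by
    rw [inv_mul_eq_div, Real.sqrt_div_self']
  have t1 : (n : ℝ)⁻¹ * (γ⁻¹ * (m + m)) = 2 * m / (γ * n) := by field_simp; ring
  have t2 : (n : ℝ)⁻¹ * (γ⁻¹ / 2 * (L / μ * m ^ 2 + L / μ * m ^ 2)) = L / μ * m ^ 2 / (γ * n) := by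
    field_simp; ring
  have t3 : (n : ℝ)⁻¹ * (martConst p * √n * (2 * L * m)) = martConst p * (2 * L * m) / √n := by
    linear_combination (martConst p * (2 * L * m)) * hsq
  have t4 : (n : ℝ)⁻¹ * (n * (L * m ^ 3)) = L * m ^ 3 := by field_simp
  have t5 : (n : ℝ)⁻¹ * (1 / 2 * (n * (2 * (L / μ) * L * m ^ 3))) = L / μ * L * m ^ 3 := by
    field_simp
  have t6 : (n : ℝ)⁻¹ * (1 / 2 * (martConst p * √n * (2 * (L / μ) * (2 * L * m ^ 2 + τ * m))))
      = martConst p * (L / μ * (2 * L * m ^ 2 + τ * m)) / √n := by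
    linear_combination (martConst p * (L / μ * (2 * L * m ^ 2 + τ * m))) * hsq
  have t7 : (n : ℝ)⁻¹ * (γ / 2 * (n * (L / μ * (lam * τ ^ 2 + (lam⁻¹ + 1) * (L * m) ^ 2))))
      ≤ γ * (L / μ * (lam * τ ^ 2 + (lam⁻¹ + 1) * (L * m) ^ 2)) := by
    have : 0 ≤ γ * (L / μ * (lam * τ ^ 2 + (lam⁻¹ + 1) * (L * m) ^ 2)) := by positivity
    have e : (n : ℝ)⁻¹ * (γ / 2 * (n * (L / μ * (lam * τ ^ 2 + (lam⁻¹ + 1) * (L * m) ^ 2))))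
      = 1 / 2 * (γ * (L / μ * (lam * τ ^ 2 + (lam⁻¹ + 1) * (L * m) ^ 2))) := by
      rw [show ∀ a : ℝ, (n : ℝ)⁻¹ * (γ / 2 * (n * a)) = 1 / 2 * (γ * a) by
        intro a; field_simp]
    linarith
  rw [mul_add, mul_add, mul_add, mul_add, mul_add, mul_add, t1, t2, t3, t4, t5, t6]
  linarith

end GradientModel

/-! ### Deriving the model from the hypotheses. -/

section FromAssumptions

variable {d : ℕ} {Z : Type*} [MeasurableSpace Z] {p μ L τ L₁ L₂ L₃ L₄ : ℝ} {Pξ : Measure Z}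
  {f : EuclideanSpace ℝ (Fin d) → ℝ}
  {gradF : EuclideanSpace ℝ (Fin d) → Z → EuclideanSpace ℝ (Fin d)}
  {θs : EuclideanSpace ℝ (Fin d)}

lemma eLpNorm_eq_absMoment {Ω E : Type*} [MeasurableSpace Ω] [NormedAddCommGroup E]
    {P : Measure Ω} {q : ℝ} (hq : 0 < q) (X : Ω → E) :
    eLpNorm X (ENNReal.ofReal q) P = absMoment P X q ^ (1 / q) :=
  eLpNorm_rpow_eq_lintegral hq X

lemma IsStochasticGradient.lpLE_sub [IsProbabilityMeasure Pξ]
    (h : IsStochasticGradient (3 * p) Pξ f gradF θs τ L₁)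
    (hs : IsSmoothObjective f L₂ L₃ L₄) (hp : 2 ≤ p) (h1 : L₁ ≤ L) (h2 : L₂ ≤ L) {q : ℝ}
    (hq : 2 ≤ q) (hqp : q ≤ 2 * p) (θ : EuclideanSpace ℝ (Fin d)) :
    LpLE Pξ q (L * ‖θ - θs‖) fun z => gradF θ z - gradF θs z := by
  have hL : 0 < L := h.L₁_pos.trans_le h1
  -- Co-coercivity is available for integer orders only, so q is rounded up; N < q + 1 ≤ 2p + 1 ≤ 3p
  -- keeps the order admissible.
  set N : ℕ := ⌈q⌉₊ with hN
  have hqN : q ≤ N := Nat.le_ceil q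
  have hN2 : 2 ≤ N := by exact_mod_cast hq.trans hqN
  have hN3 : (N : ℝ) ≤ 3 * p := by
    have := Nat.ceil_lt_add_one (by linarith : 0 ≤ q)
    rw [← hN] at this; linarith
  have hN0 : (0 : ℝ) < N := by linarith
  have hmeas : ∀ θ, Measurable (gradF θ) := fun θ =>
    h.measurable.comp (measurable_const.prodMk measurable_id)
  refine LpLE.exponent_mono (r := N)
    ⟨((hmeas θ).sub (hmeas θs)).aestronglyMeasurable, by positivity, ?_⟩ hqN
  rw [eLpNorm_eq_absMoment hN0]
  have hc := h.cocoercive N hN2 hN3 θ θs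
  have hin : inner ℝ (gradient f θ - gradient f θs) (θ - θs) ≤ L * ‖θ - θs‖ ^ 2 := by
    calc _ ≤ ‖gradient f θ - gradient f θs‖ * ‖θ - θs‖ := real_inner_le_norm _ _
      _ ≤ L * ‖θ - θs‖ * ‖θ - θs‖ := by
        gcongr; exact (hs.gradient_lipschitz θ θs).trans (by gcongr)
      _ = _ := by ring
  have hb : L₁ ^ (N - 1) * ‖θ - θs‖ ^ (N - 2) *
      inner ℝ (gradient f θ - gradient f θs) (θ - θs) ≤ (L * ‖θ - θs‖) ^ N := by
    have := h.L₁_pos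
    calc _ ≤ L₁ ^ (N - 1) * ‖θ - θs‖ ^ (N - 2) * (L * ‖θ - θs‖ ^ 2) :=
          mul_le_mul_of_nonneg_left hin (by positivity)
      _ ≤ L ^ (N - 1) * ‖θ - θs‖ ^ (N - 2) * (L * ‖θ - θs‖ ^ 2) := by gcongr
      _ = (L ^ (N - 1) * L) * (‖θ - θs‖ ^ (N - 2) * ‖θ - θs‖ ^ 2) := by ring
      _ = _ := by
        rw [← pow_succ, ← pow_add, mul_pow, Nat.sub_add_cancel (by omega),
          Nat.sub_add_cancel hN2]
  calc _ ≤ ENNReal.ofReal ((L * ‖θ - θs‖) ^ N) ^ (1 / (N : ℝ)) := by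
        gcongr; exact hc.trans (ENNReal.ofReal_le_ofReal hb)
    _ = _ := by
      rw [ENNReal.ofReal_rpow_of_nonneg (by positivity) (by positivity), ← Real.rpow_natCast,
        ← Real.rpow_mul (by positivity), mul_one_div_cancel hN0.ne', Real.rpow_one]

lemma exists_gradientModel [IsProbabilityMeasure Pξ] (hp : 2 ≤ p)
    (hL : L = max (max L₁ L₂) (max L₃ L₄)) (hmin : IsMinOn f Set.univ θs)
    (hc : IsStronglyConvex f μ) (hs : IsSmoothObjective f L₂ L₃ L₄)
    (h : IsStochasticGradient (3 * p) Pξ f gradF θs τ L₁) :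
    ∃ T Φ, GradientModel p μ L τ Pξ gradF θs (gradient f) (hessian f θs) T Φ := by
  have h1 : L₁ ≤ L := hL ▸ (le_max_left _ _).trans (le_max_left _ _)
  have h2 : L₂ ≤ L := hL ▸ (le_max_right _ _).trans (le_max_left _ _)
  have h3 : L₃ ≤ L := hL ▸ (le_max_left _ _).trans (le_max_right _ _)
  have h4 : L₄ ≤ L := hL ▸ (le_max_right _ _).trans (le_max_right _ _)
  have hL0 : 0 < L := h.L₁_pos.trans_le h1
  have hμ := hc.pos
  have hg0 := gradient_eq_zero_of_isMinOn hmin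
  obtain ⟨Φ, hΦ, hsy⟩ := exists_sylvester_solution hμ hL0 (fun v => hc.inner_hessian_ge hs θs v)
    ((hs.norm_hessian_le θs).trans h2) (fderiv ℝ (fderiv ℝ (gradient f)) θs)
  refine ⟨fderiv ℝ (fderiv ℝ (gradient f)) θs, Φ, ?_⟩
  exact {
    two_le := hp
    μ_pos := hμ
    L_pos := hL0
    measurable := h.measurable
    measurable_g := hs.contDiff_gradient.continuous.measurable
    integrable := h.integrable
    unbiased := h.unbiased
    g_zero := hg0
    noise_le := ⟨(h.integrable θs).1, h.τ_nonneg, by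
      rw [eLpNorm_eq_absMoment (by linarith)]; exact h.moment_le⟩
    diff_le := fun q hq hqp θ => h.lpLE_sub hs hp h1 h2 hq hqp θ
    norm_g_le := fun θ => by
      have := hs.gradient_lipschitz θ θs
      rw [hg0, sub_zero] at this
      exact this.trans (by gcongr)
    taylor_one := fun θ => by
      have := norm_taylor_one_le (hs.contDiff_gradient.of_le (by norm_num))
        hs.norm_fderiv_fderiv_gradient_le θs (θ - θs)
      rw [add_sub_cancel, hg0, sub_zero] at this
      exact this.trans (by gcongr)
    taylor_two := fun θ => by
      have := norm_taylor_two_le hs.contDiff_gradient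
        hs.norm_fderiv_fderiv_fderiv_gradient_le θs (θ - θs)
      rw [add_sub_cancel, hg0, sub_zero] at this
      exact this.trans (by gcongr)
    norm_H_le := (hs.norm_hessian_le θs).trans h2
    norm_Φ_le := hΦ.trans (by
      have := hs.norm_fderiv_fderiv_gradient_le θs
      gcongr
      exact this.trans h3)
    sylvester := hsy }

lemma HasMomentBounds.lpLE_iterate [IsProbabilityMeasure Pξ] {D C γ : ℝ} (hp : 2 ≤ p)
    (hμ : 0 < μ) (hτ : 0 ≤ τ) (hF : Measurable (Function.uncurry gradF))
    (h : HasMomentBounds (3 * p) Pξ gradF θs μ L τ D C)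
    (hγ : 0 < γ) (hγL : γ ≤ 1 / (L * C)) (hγμ : γ * μ ≤ 1) (θ : EuclideanSpace ℝ (Fin d))
    (k : ℕ) :
    LpLE (Measure.infinitePi fun _ : ℕ => Pξ) (3 * p)
      (√(1 - γ * μ) ^ k * ‖θ - θs‖ + √(D / μ) * τ * √γ)
      fun z => sgdIter gradF γ θ z k - θs := by
  have hp0 : 0 < 3 * p := by linarith
  have hD : 0 ≤ D := by linarith [h.two_le_last]
  -- A Dirac initial law gives the bound for a deterministic start; the hypothesis controls the
  -- squared norm, whence the square roots.
  have hit := h.iterates γ hγ hγL (Measure.dirac θ) inferInstance k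
  have hmeas := (measurable_sgdIter hF γ k).sub_const θs
  have hmeas' : Measurable fun z : ℕ → Z => sgdIter gradF γ θ z k - θs :=
    hmeas.comp (measurable_const.prodMk measurable_id)
  have e1 : absMoment ((Measure.dirac θ).prod (Measure.infinitePi fun _ : ℕ => Pξ))
      (fun x => sgdIter gradF γ x.1 x.2 k - θs) (3 * p) =
      absMoment (Measure.infinitePi fun _ : ℕ => Pξ)
        (fun z => sgdIter gradF γ θ z k - θs) (3 * p) := by
    rw [absMoment, absMoment, Measure.dirac_prod,
      lintegral_map (hmeas.enorm.pow_const _) measurable_prodMk_left]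
  have e2 : absMoment (Measure.dirac θ) (fun θ => θ - θs) (3 * p) ^ (2 / (3 * p))
      = ENNReal.ofReal (‖θ - θs‖ ^ 2) := by
    have hms : Measurable fun θ : EuclideanSpace ℝ (Fin d) => ‖θ - θs‖ₑ ^ (3 * p) :=
      (measurable_id.sub_const θs).enorm.pow_const _
    rw [absMoment, lintegral_dirac' _ hms, ← ENNReal.rpow_mul, mul_div_cancel₀ _ hp0.ne', ENNReal.rpow_two, ← ofReal_norm,
      ENNReal.ofReal_pow (norm_nonneg _)]
  have ha : 0 ≤ 1 - γ * μ := by linarith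
  rw [e1, e2, ← ENNReal.ofReal_mul (by positivity),
    ← ENNReal.ofReal_add (by positivity) (by positivity)] at hit
  refine ⟨hmeas'.aestronglyMeasurable, by positivity, ?_⟩
  rw [eLpNorm_eq_absMoment hp0]
  calc absMoment (Measure.infinitePi fun _ : ℕ => Pξ)
        (fun z => sgdIter gradF γ θ z k - θs) (3 * p) ^ (1 / (3 * p))
      = (absMoment (Measure.infinitePi fun _ : ℕ => Pξ)
        (fun z => sgdIter gradF γ θ z k - θs) (3 * p) ^ (2 / (3 * p))) ^ (1 / 2 : ℝ) := by
        rw [← ENNReal.rpow_mul]; congr 1; field_simp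
    _ ≤ ENNReal.ofReal ((1 - γ * μ) ^ k * ‖θ - θs‖ ^ 2 + D * γ * τ ^ 2 / μ) ^ (1 / 2 : ℝ) := by
        gcongr
    _ = ENNReal.ofReal √((1 - γ * μ) ^ k * ‖θ - θs‖ ^ 2 + D * γ * τ ^ 2 / μ) := by
        rw [ENNReal.ofReal_rpow_of_nonneg (by positivity) (by positivity), Real.sqrt_eq_rpow]
    _ ≤ _ := by
        apply ENNReal.ofReal_le_ofReal
        refine (sqrt_add_le_sqrt_add_sqrt (by positivity) (by positivity)).trans_eq ?_
        rw [Real.sqrt_mul (by positivity), Real.sqrt_sq (norm_nonneg _)]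
        congr 1
        · congr 1
          rw [Real.sqrt_eq_rpow, Real.sqrt_eq_rpow, ← Real.rpow_natCast, ← Real.rpow_natCast,
            ← Real.rpow_mul ha, ← Real.rpow_mul ha, mul_comm (k : ℝ)]
        · rw [show D * γ * τ ^ 2 / μ = D / μ * τ ^ 2 * γ by ring, Real.sqrt_mul (by positivity),
            Real.sqrt_mul (by positivity), Real.sqrt_sq hτ]

end FromAssumptions

/-! ### Absorbing the initial error and collecting powers of t. -/

section Absorption

lemma sqrt_pow_eq_rpow {a : ℝ} (ha : 0 ≤ a) (k : ℕ) : √a ^ k = a ^ ((k : ℝ) / 2) := by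
  rw [Real.sqrt_eq_rpow, ← Real.rpow_natCast, ← Real.rpow_mul ha]
  congr 1; ring

lemma rpow_neg_quarter_pow (n : ℕ) (k : ℕ) :
    ((n : ℝ) ^ (-(1 / 4) : ℝ)) ^ k = (n : ℝ) ^ (-(k / 4) : ℝ) := by
  rw [← Real.rpow_natCast, ← Real.rpow_mul (by positivity)]
  congr 1; ring

lemma linear_le_add_quadratic {a b r : ℝ} (hb : 0 < b) : a * r ≤ a ^ 2 / b + b * r ^ 2 := by
  have h : a ^ 2 / b + b * r ^ 2 - a * r = b * ((r - a / (2 * b)) ^ 2) + 3 / 4 * (a ^ 2 / b) := by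
    field_simp; ring
  have : 0 ≤ b * ((r - a / (2 * b)) ^ 2) + 3 / 4 * (a ^ 2 / b) := by positivity
  linarith

lemma exp_neg_le_two_div_sq {x : ℝ} (hx : 0 < x) : Real.exp (-x) ≤ 2 / x ^ 2 := by
  rw [Real.exp_neg, inv_eq_one_div, div_le_div_iff₀ (Real.exp_pos x) (by positivity)]
  nlinarith [Real.quadratic_le_exp_of_nonneg hx.le]

/-- The contraction factor over `n` steps of size `t ^ 2`, where `t = n ^ (-1 / 4)`. -/
lemma sqrt_one_sub_pow_le {t μ : ℝ} {n : ℕ} (ht : 0 < t) (hμ : 0 < μ) (htn : t ^ 4 * n = 1) :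
    √(1 - t ^ 2 * μ) ^ n ≤ 8 * t ^ 4 / μ ^ 2 := by
  have h1 : √(1 - t ^ 2 * μ) ≤ Real.exp (-(t ^ 2 * μ / 2)) := by
    rw [Real.sqrt_le_left (Real.exp_nonneg _), ← Real.exp_nat_mul]
    have := Real.add_one_le_exp (-(t ^ 2 * μ))
    calc 1 - t ^ 2 * μ ≤ Real.exp (-(t ^ 2 * μ)) := by linarith
      _ = _ := by congr 1; push_cast; ring
  calc √(1 - t ^ 2 * μ) ^ n ≤ Real.exp (-(t ^ 2 * μ / 2)) ^ n := by gcongr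
    _ = Real.exp (-(μ / (2 * t ^ 2))) := by
      rw [← Real.exp_nat_mul]
      congr 1
      have : (n : ℝ) = 1 / t ^ 4 := by field_simp; linarith
      rw [this]; field_simp
    _ ≤ 2 / (μ / (2 * t ^ 2)) ^ 2 := exp_neg_le_two_div_sq (by positivity)
    _ = _ := by field_simp; ring

variable {p μ L t r : ℝ} {n : ℕ}

lemma quadratic_coeff_ge (hp : 2 ≤ p) (hμ : 0 < μ) (hL : 0 < L) (ht : 0 < t) (ht1 : t ≤ 1) :
    L / μ ^ 2 * √(1 - t ^ 2 * μ) ^ (n + 1) ≤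
      L * √(1 - t ^ 2 * μ) ^ (n + 1) * p ^ 2 / (t ^ 2 * μ ^ 2) := by
  have h1 : 1 ≤ p ^ 2 / t ^ 2 := by
    rw [le_div_iff₀ (by positivity)]
    nlinarith [pow_le_one₀ (n := 2) ht.le ht1]
  have h0 : 0 ≤ L / μ ^ 2 * √(1 - t ^ 2 * μ) ^ (n + 1) := by positivity
  calc _ = L / μ ^ 2 * √(1 - t ^ 2 * μ) ^ (n + 1) * 1 := by ring
    _ ≤ L / μ ^ 2 * √(1 - t ^ 2 * μ) ^ (n + 1) * (p ^ 2 / t ^ 2) := by gcongr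
    _ = _ := by field_simp

/-- Absorption of the terms of low degree in the initial error, for large `n`. -/
lemma absorb_large {A₁ A₂ A₅ : ℝ} (hp : 2 ≤ p) (hμ : 0 < μ) (hL : 0 < L) (hA₂ : 0 ≤ A₂)
    (ht : 0 < t) (ht1 : t ≤ 1) (htn : t ^ 4 * n = 1)
    (hμL : μ ≤ L) (htL : t ^ 2 * L ≤ 1 / 2) (hr : 0 ≤ r) (hn : 96 * A₂ / L ≤ n) :
    3 * (A₁ * (√(1 - t ^ 2 * μ) ^ n * r) + 2 * A₂ * (√(1 - t ^ 2 * μ) ^ n * r) ^ 2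
      + 4 * (L + L / μ * L) * (√(1 - t ^ 2 * μ) ^ n * r) ^ 3 + A₅ * t ^ 3) ≤
    (144 * A₁ ^ 2 / L + 3 * A₅) * t ^ 3
      + 12 * (L * √(1 - t ^ 2 * μ) ^ (n + 1) * p ^ 2 / (t ^ 2 * μ ^ 2) * r ^ 2
        + L * √(1 - t ^ 2 * μ) ^ (3 * n) / (t ^ 2 * μ) * r ^ 3) := by
  have htμ : t ^ 2 * μ ≤ 1 / 2 := le_trans (by gcongr) htL
  set ρ := √(1 - t ^ 2 * μ) with hρ
  have hρ2 : 1 / 2 ≤ ρ := by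
    rw [hρ]; apply Real.le_sqrt_of_sq_le; linarith
  have hρ0 : 0 < ρ := by linarith
  have hρn := sqrt_one_sub_pow_le ht hμ htn
  rw [← hρ] at hρn
  set b := L * ρ ^ (n + 1) * p ^ 2 / (t ^ 2 * μ ^ 2) with hb
  have hbge : L / μ ^ 2 * ρ ^ (n + 1) ≤ b := quadratic_coeff_ge hp hμ hL ht ht1
  have hb1 : 0 < L / μ ^ 2 * ρ ^ (n + 1) := by positivity
  have hb0 : 0 < b := hb1.trans_le hbge
  -- The linear and quadratic terms carry ρ^n per factor r, while the allowed quadratic term carries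
  -- only ρ^(n+1). One spare factor ρ^n is exponentially small, and 8t⁴/μ² is enough of it.
  have hratio : ρ ^ (2 * n) ≤ 16 * t ^ 4 / L * (L / μ ^ 2 * ρ ^ (n + 1)) := by
    have e1 : ρ ^ (2 * n) ≤ ρ ^ n * (8 * t ^ 4 / μ ^ 2) := by
      rw [two_mul, pow_add]; gcongr
    have e2 : ρ ^ n ≤ 2 * ρ ^ (n + 1) := by
      rw [pow_succ]; nlinarith [pow_pos hρ0 n]
    calc ρ ^ (2 * n) ≤ ρ ^ n * (8 * t ^ 4 / μ ^ 2) := e1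
      _ ≤ 2 * ρ ^ (n + 1) * (8 * t ^ 4 / μ ^ 2) := by gcongr
      _ = _ := by field_simp; ring
  have hratio' : ρ ^ (2 * n) ≤ 16 * t ^ 4 / L * b := hratio.trans (by gcongr)
  -- Young's inequality trades the linear term for one copy of b r² and a constant a²/b, which is
  -- O(t⁴) by `hratio'`.
  have l1 : 3 * (A₁ * (ρ ^ n * r)) ≤ 144 * A₁ ^ 2 / L * t ^ 3 + b * r ^ 2 := by
    have := linear_le_add_quadratic (a := 3 * A₁ * ρ ^ n) (r := r) hb0
    have h2 : (3 * A₁ * ρ ^ n) ^ 2 / b ≤ 144 * A₁ ^ 2 / L * t ^ 3 := by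
      rw [div_le_iff₀ hb0]
      have e : (3 * A₁ * ρ ^ n) ^ 2 = 9 * A₁ ^ 2 * ρ ^ (2 * n) := by ring
      have t4 : t ^ 4 ≤ t ^ 3 := pow_le_pow_of_le_one ht.le ht1 (by norm_num)
      calc _ = 9 * A₁ ^ 2 * ρ ^ (2 * n) := e
        _ ≤ 9 * A₁ ^ 2 * (16 * t ^ 4 / L * b) := by gcongr
        _ ≤ 9 * A₁ ^ 2 * (16 * t ^ 3 / L * b) := by gcongr
        _ = _ := by ring
    linarith
  -- A second copy of b r² takes the quadratic term; the lower bound on n makes its coefficient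
  -- small enough.
  have l2 : 3 * (2 * A₂ * (ρ ^ n * r) ^ 2) ≤ b * r ^ 2 := by
    have h1 : 6 * A₂ * ρ ^ (2 * n) ≤ b := by
      have h2 : 96 * A₂ / L * t ^ 4 ≤ 1 := by
        rw [← htn, mul_comm]; gcongr
      calc 6 * A₂ * ρ ^ (2 * n) ≤ 6 * A₂ * (16 * t ^ 4 / L * b) := by gcongr
        _ = 96 * A₂ / L * t ^ 4 * b := by ring
        _ ≤ 1 * b := by gcongr
        _ = b := one_mul b
    calc _ = 6 * A₂ * ρ ^ (2 * n) * r ^ 2 := by ring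
      _ ≤ b * r ^ 2 := by gcongr
  -- The cubic term has matching powers of ρ, and smallness of t²L and t²μ gives the coefficient
  -- comparison. The constant 12 = 3·4 originates here.
  have l3 : 3 * (4 * (L + L / μ * L) * (ρ ^ n * r) ^ 3) ≤
      12 * (L * ρ ^ (3 * n) / (t ^ 2 * μ) * r ^ 3) := by
    have h1 : L + L / μ * L ≤ L / (t ^ 2 * μ) := by
      rw [le_div_iff₀ (by positivity)]
      have : (L + L / μ * L) * (t ^ 2 * μ) = L * (t ^ 2 * μ + t ^ 2 * L) := by field_simp
      rw [this]
      nlinarith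
    calc _ = 12 * ((L + L / μ * L) * ρ ^ (3 * n) * r ^ 3) := by ring
      _ ≤ 12 * (L / (t ^ 2 * μ) * ρ ^ (3 * n) * r ^ 3) := by gcongr
      _ = _ := by ring
  have l4 : 0 ≤ b * r ^ 2 := by positivity
  linarith

/-- Absorption of the crude linear bound, for bounded `n`. -/
lemma absorb_small {A τ' : ℝ} {N : ℕ} (hp : 2 ≤ p) (hμ : 0 < μ) (hL : 0 < L) (hA : 0 ≤ A)
    (hτ : 0 ≤ τ') (ht : 0 < t) (ht1 : t ≤ 1) (htn : t ^ 4 * n = 1)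
    (htμ : t ^ 2 * μ ≤ 1 / 2) (hr : 0 ≤ r) (hn : n ≤ N) :
    A * 4 ^ n * (r + τ') ≤
    (A * 4 ^ N * τ' + (A * 4 ^ N) ^ 2 * (μ ^ 2 / L) * 2 ^ (N + 1)) * N * t ^ 3
      + 12 * (L * √(1 - t ^ 2 * μ) ^ (n + 1) * p ^ 2 / (t ^ 2 * μ ^ 2) * r ^ 2
        + L * √(1 - t ^ 2 * μ) ^ (3 * n) / (t ^ 2 * μ) * r ^ 3) := by
  set ρ := √(1 - t ^ 2 * μ) with hρ
  have hρ2 : 1 / 2 ≤ ρ := by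
    rw [hρ]; apply Real.le_sqrt_of_sq_le; linarith
  have hρ0 : 0 < ρ := by linarith
  set b := L * ρ ^ (n + 1) * p ^ 2 / (t ^ 2 * μ ^ 2) with hb
  have hbge : L / μ ^ 2 * ρ ^ (n + 1) ≤ b := quadratic_coeff_ge hp hμ hL ht ht1
  have hρN : (1 / 2 : ℝ) ^ (N + 1) ≤ ρ ^ (n + 1) := by
    calc (1 / 2 : ℝ) ^ (N + 1) ≤ (1 / 2 : ℝ) ^ (n + 1) :=
          pow_le_pow_of_le_one (by norm_num) (by norm_num) (by omega)
      _ ≤ _ := by gcongr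
  have hbge' : L / μ ^ 2 * (1 / 2 : ℝ) ^ (N + 1) ≤ b := le_trans (by gcongr) hbge
  have hb1 : 0 < L / μ ^ 2 * (1 / 2 : ℝ) ^ (N + 1) := by positivity
  have hb0 : 0 < b := hb1.trans_le hbge'
  have h4 : (4 : ℝ) ^ n ≤ 4 ^ N := pow_le_pow_right₀ (by norm_num) hn
  -- For n ≤ N the quantity N t³ is at least n t⁴ = 1, so any constant is an admissible multiple of
  -- t³.
  have hNt : 1 ≤ N * t ^ 3 := by
    rw [← htn]
    have t4 : t ^ 4 ≤ t ^ 3 := pow_le_pow_of_le_one ht.le ht1 (by norm_num)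
    have : (n : ℝ) ≤ N := by exact_mod_cast hn
    calc t ^ 4 * n ≤ t ^ 3 * N := by gcongr
      _ = _ := mul_comm _ _
  have h1 := linear_le_add_quadratic (a := A * 4 ^ N) (r := r) hb0
  have h2 : (A * 4 ^ N) ^ 2 / b ≤ (A * 4 ^ N) ^ 2 * (μ ^ 2 / L) * 2 ^ (N + 1) := by
    calc (A * 4 ^ N) ^ 2 / b ≤ (A * 4 ^ N) ^ 2 / (L / μ ^ 2 * (1 / 2 : ℝ) ^ (N + 1)) := by gcongr
      _ = _ := by rw [one_div, inv_pow]; field_simp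
  have h3 : 0 ≤ A * 4 ^ N * τ' + (A * 4 ^ N) ^ 2 * (μ ^ 2 / L) * 2 ^ (N + 1) := by positivity
  have h5 : A * 4 ^ n * (r + τ') ≤ A * 4 ^ N * (r + τ') := by gcongr
  have h6 : 0 ≤ 11 * (b * r ^ 2) + 12 * (L * ρ ^ (3 * n) / (t ^ 2 * μ) * r ^ 3) := by positivity
  have h7 := mul_le_mul_of_nonneg_left hNt h3
  linarith

lemma mul_sq_add_le {y c : ℝ} (hy : 0 ≤ y) (ht : 0 < t) (ht1 : t ≤ 1) :
    (y + c * t) * t ^ 2 ≤ y + c * t ^ 3 := by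
  have : y * t ^ 2 ≤ y := mul_le_of_le_one_right hy (pow_le_one₀ ht.le ht1)
  linarith [show (y + c * t) * t ^ 2 = y * t ^ 2 + c * t ^ 3 by ring]

lemma sq_add_mul_le {y c : ℝ} (ht : 0 < t) (ht1 : t ≤ 1) :
    (y + c * t) ^ 2 * t ≤ 2 * y ^ 2 + 2 * c ^ 2 * t ^ 3 := by
  have h1 : (y + c * t) ^ 2 ≤ 2 * y ^ 2 + 2 * (c * t) ^ 2 := by nlinarith [sq_nonneg (y - c * t)]
  have h2 : 2 * y ^ 2 * t ≤ 2 * y ^ 2 := mul_le_of_le_one_right (by positivity) ht1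
  have h3 := mul_le_mul_of_nonneg_right h1 ht.le
  linarith [show (2 * y ^ 2 + 2 * (c * t) ^ 2) * t = 2 * y ^ 2 * t + 2 * c ^ 2 * t ^ 3 by ring]

lemma cube_add_le {y c : ℝ} (hy : 0 ≤ y) (hc : 0 ≤ c) (ht : 0 < t) :
    (y + c * t) ^ 3 ≤ 4 * y ^ 3 + 4 * c ^ 3 * t ^ 3 := by
  have h0 : 0 ≤ c * t := by positivity
  have h1 : 0 ≤ 3 * ((y + c * t) * (y - c * t) ^ 2) := by positivity
  linarith [show 4 * y ^ 3 + 4 * c ^ 3 * t ^ 3 - (y + c * t) ^ 3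
    = 3 * ((y + c * t) * (y - c * t) ^ 2) by ring]

/-- Collecting the powers of the step size in the bound for the remainder of one chain. -/
lemma remainder_bound_le {γ M τ c y : ℝ} (hμ : 0 < μ) (hL : 0 < L) (hM : 0 ≤ M)
    (hτ : 0 ≤ τ) (hc : 0 ≤ c) (hy : 0 ≤ y) (ht : 0 < t) (ht1 : t ≤ 1) (htn : t ^ 4 * n = 1)
    (hγ : t ^ 2 ≤ γ) (hγ2 : γ ≤ 2 * t ^ 2) :
    2 * (y + c * t) / (γ * n) + L / μ * (y + c * t) ^ 2 / (γ * n)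
        + M * (2 * L * (y + c * t)) / √n + L * (y + c * t) ^ 3
        + L / μ * L * (y + c * t) ^ 3
        + M * (L / μ * (2 * L * (y + c * t) ^ 2 + τ * (y + c * t))) / √n
        + γ * (L / μ * (t * τ ^ 2 + (t⁻¹ + 1) * (L * (y + c * t)) ^ 2)) ≤
    (2 + 2 * L * M + M * (L / μ) * τ) * y
      + 2 * (L / μ + 2 * M * L * (L / μ) + 4 * (L / μ) * L ^ 2) * y ^ 2
      + 4 * (L + L / μ * L) * y ^ 3
      + ((2 + 2 * L * M + M * (L / μ) * τ) * c
        + 2 * (L / μ + 2 * M * L * (L / μ) + 4 * (L / μ) * L ^ 2) * c ^ 2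
        + 4 * (L + L / μ * L) * c ^ 3 + 2 * (L / μ) * τ ^ 2) * t ^ 3 := by
  set F := L / μ with hF
  have hF0 : 0 ≤ F := by positivity
  set m := y + c * t with hm
  have hm0 : 0 ≤ m := by positivity
  have hn : (n : ℝ) = 1 / t ^ 4 := by field_simp; linarith
  have hsq : √(n : ℝ) = 1 / t ^ 2 := by
    rw [hn, show 1 / t ^ 4 = (1 / t ^ 2) ^ 2 by field_simp, Real.sqrt_sq (by positivity)]
  have hγ0 : 0 < γ := lt_of_lt_of_le (by positivity) hγ
  have hdiv : ∀ a, 0 ≤ a → a / (γ * n) ≤ a * t ^ 2 := fun a ha => by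
    rw [hn, div_le_iff₀ (by positivity)]
    calc a = a * t ^ 2 * (t ^ 2 * (1 / t ^ 4)) := by field_simp
      _ ≤ a * t ^ 2 * (γ * (1 / t ^ 4)) := by gcongr
  have hdiv' : ∀ a, a / √(n : ℝ) = a * t ^ 2 := fun a => by rw [hsq]; field_simp
  have t21 : t ^ 2 ≤ t := pow_le_of_le_one ht.le ht1 two_ne_zero
  have b1 := hdiv (2 * m) (by positivity)
  have b2 : F * m ^ 2 / (γ * n) ≤ F * m ^ 2 * t :=
    (hdiv _ (by positivity)).trans (by gcongr)
  have b6 : M * (F * (2 * L * m ^ 2 + τ * m)) / √(n : ℝ) ≤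
      2 * M * L * F * m ^ 2 * t + M * F * τ * m * t ^ 2 := by
    rw [hdiv']
    have : 2 * M * L * F * m ^ 2 * t ^ 2 ≤ 2 * M * L * F * m ^ 2 * t := by gcongr
    linarith
  -- With Young weight `lam` = t, both tτ² and t⁻¹m² are of order t when m is, and γ supplies t².
  have b7 : γ * (F * (t * τ ^ 2 + (t⁻¹ + 1) * (L * m) ^ 2)) ≤
      2 * F * τ ^ 2 * t ^ 3 + 4 * F * L ^ 2 * m ^ 2 * t := by
    have e1 : t⁻¹ + 1 ≤ 2 * t⁻¹ := by
      have := (one_le_inv₀ ht).2 ht1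
      linarith
    calc _ ≤ 2 * t ^ 2 * (F * (t * τ ^ 2 + 2 * t⁻¹ * (L * m) ^ 2)) := by gcongr
      _ = 2 * F * τ ^ 2 * t ^ 3 + 4 * F * L ^ 2 * m ^ 2 * t * (t⁻¹ * t) := by ring
      _ = _ := by rw [inv_mul_cancel₀ ht.ne', mul_one]
  have m1 : m * t ^ 2 ≤ y + c * t ^ 3 := mul_sq_add_le hy ht ht1
  have m2 : m ^ 2 * t ≤ 2 * y ^ 2 + 2 * c ^ 2 * t ^ 3 := sq_add_mul_le ht ht1
  have m3 : m ^ 3 ≤ 4 * y ^ 3 + 4 * c ^ 3 * t ^ 3 := cube_add_le hy hc ht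
  have c1 : (2 + 2 * L * M + M * F * τ) * (m * t ^ 2)
      ≤ (2 + 2 * L * M + M * F * τ) * (y + c * t ^ 3) := by gcongr
  have c2 : (F + 2 * M * L * F + 4 * F * L ^ 2) * (m ^ 2 * t)
      ≤ (F + 2 * M * L * F + 4 * F * L ^ 2) * (2 * y ^ 2 + 2 * c ^ 2 * t ^ 3) := by gcongr
  have c3 : (L + F * L) * m ^ 3 ≤ (L + F * L) * (4 * y ^ 3 + 4 * c ^ 3 * t ^ 3) := by gcongr
  rw [hdiv' (M * (2 * L * m))]
  clear_value m F
  linarith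

end Absorption

/-! ### From deterministic to random starting points. -/

section InitialDistribution

lemma eLpNorm_const_mul_norm_pow {Ω E : Type*} [MeasurableSpace Ω] [NormedAddCommGroup E]
    {P : Measure Ω} {p a : ℝ} {m : ℕ} (hp : 0 < p) (X : Ω → E) :
    eLpNorm (fun ω => a * ‖X ω‖ ^ m) (ENNReal.ofReal p) P =
      ‖a‖ₑ * absMoment P X (m * p) ^ (1 / p) := by
  have h := eLpNorm_const_smul a (fun ω => ‖X ω‖ ^ m) (ENNReal.ofReal p) P
  rw [eLpNorm_rpow_eq_lintegral hp (fun ω => ‖X ω‖ ^ m)] at h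
  refine h.trans ?_
  simp only [enorm_pow, enorm_norm, absMoment, ENNReal.rpow_mul, ENNReal.rpow_natCast]

/-- A moment bound for each deterministic starting point integrates to a bound for a random one. -/
lemma absMoment_le_of_forall_init {d : ℕ} {Z Ω : Type*} [MeasurableSpace Z] [MeasurableSpace Ω]
    {P : Measure Ω} [IsProbabilityMeasure P] {ν : Measure (EuclideanSpace ℝ (Fin d))}
    {Pξ : Measure Z} [IsProbabilityMeasure Pξ] {θ₀ : Ω → EuclideanSpace ℝ (Fin d)}
    {ξ : ℕ → Ω → Z} (hin : IsSGDInput P ν Pξ θ₀ ξ) {p A b c : ℝ} (hp : 2 ≤ p) (hA : 0 ≤ A)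
    (hb : 0 ≤ b) (hc : 0 ≤ c) {θs : EuclideanSpace ℝ (Fin d)}
    {F : EuclideanSpace ℝ (Fin d) → (ℕ → Z) → EuclideanSpace ℝ (Fin d)}
    (hF : Measurable (Function.uncurry F))
    (h : ∀ θ, LpLE (Measure.infinitePi fun _ : ℕ => Pξ) p
      (A + (b * ‖θ - θs‖ ^ 2 + c * ‖θ - θs‖ ^ 3)) (F θ)) :
    absMoment P (fun ω => F (θ₀ ω) fun k => ξ k ω) p ^ (1 / p) ≤
      ENNReal.ofReal A + (ENNReal.ofReal b * absMoment ν (fun θ => θ - θs) (2 * p) ^ (1 / p)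
        + ENNReal.ofReal c * absMoment ν (fun θ => θ - θs) (3 * p) ^ (1 / p)) := by
  have hp0 : 0 < p := by linarith
  have hp1 : 1 ≤ ENNReal.ofReal p := ENNReal.one_le_ofReal.2 (by linarith)
  have hζ : Measurable fun ω k => ξ k ω := measurable_pi_lambda _ hin.measurable_noise
  have hlaw : P.map (fun ω k => ξ k ω) = Measure.infinitePi fun _ : ℕ => Pξ := by
    rw [(iIndepFun_iff_map_fun_eq_infinitePi_map hin.measurable_noise).1 hin.indep_noise]
    simp only [hin.law_noise]
  -- The whole noise sequence is one variable independent of the start. The bound takes values in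
  -- [0, ∞], so no moment of ν need be finite.
  have key := eLpNorm_le_of_indepFun hp0 hin.measurable_init hζ hlaw hin.indep_init hF h
  rw [eLpNorm_eq_absMoment hp0] at key
  refine key.trans ?_
  have hX : Measurable fun ω => ‖θ₀ ω - θs‖ := (hin.measurable_init.sub_const θs).norm
  have hmom : ∀ q, absMoment ν (fun θ => θ - θs) q = absMoment P (fun ω => θ₀ ω - θs) q := by
    intro q
    have hms : Measurable fun θ : EuclideanSpace ℝ (Fin d) => ‖θ - θs‖ₑ ^ q :=
      (measurable_id.sub_const θs).enorm.pow_const _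
    rw [← hin.law_init, absMoment, lintegral_map hms hin.measurable_init, absMoment]
  have e2 := eLpNorm_const_mul_norm_pow (P := P) (a := b) (m := 2) hp0 fun ω => θ₀ ω - θs
  have e3 := eLpNorm_const_mul_norm_pow (P := P) (a := c) (m := 3) hp0 fun ω => θ₀ ω - θs
  rw [Real.enorm_eq_ofReal hb] at e2
  rw [Real.enorm_eq_ofReal hc] at e3
  push_cast at e2 e3
  rw [hmom, hmom, ← e2, ← e3]
  have m2 : AEStronglyMeasurable (fun ω => b * ‖θ₀ ω - θs‖ ^ 2) P :=
    ((hX.pow_const 2).const_mul b).aestronglyMeasurable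
  have m3 : AEStronglyMeasurable (fun ω => c * ‖θ₀ ω - θs‖ ^ 3) P :=
    ((hX.pow_const 3).const_mul c).aestronglyMeasurable
  have hA' : eLpNorm (fun _ : Ω => A) (ENNReal.ofReal p) P ≤ ENNReal.ofReal A :=
    (LpLE.const (P := P) (c := A) (by rw [Real.norm_of_nonneg hA]) hp0).le
  exact (eLpNorm_add_le aestronglyMeasurable_const (m2.add m3) hp1).trans
    (add_le_add hA' (eLpNorm_add_le m2 m3 hp1))

end InitialDistribution

lemma trace_noiseCov {d : ℕ} {Z : Type*} [MeasurableSpace Z] {Pξ : Measure Z}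
    [IsProbabilityMeasure Pξ] {gradF : EuclideanSpace ℝ (Fin d) → Z → EuclideanSpace ℝ (Fin d)}
    {θs : EuclideanSpace ℝ (Fin d)} {τ : ℝ} (h : LpLE Pξ 2 τ (gradF θs))
    (hF : Measurable (gradF θs)) :
    (noiseCov Pξ gradF θs).trace = ∫ z, ‖gradF θs z‖ ^ 2 ∂Pξ := by
  have h2 : Integrable (fun z => ‖gradF θs z‖ ^ 2) Pξ := by
    simpa using integrable_norm_rpow_of_memLp two_pos h.memLp
  have hi : ∀ i, Integrable (fun z => gradF θs z i * gradF θs z i) Pξ := fun i => by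
    have hmi : Measurable fun z => gradF θs z i :=
      (by fun_prop : Continuous fun x : EuclideanSpace ℝ (Fin d) => x i).measurable.comp hF
    refine h2.mono' (hmi.mul hmi).aestronglyMeasurable (.of_forall fun z => ?_)
    have := PiLp.norm_apply_le (gradF θs z) i
    rw [norm_mul, ← pow_two]
    gcongr
  simp only [Matrix.trace, Matrix.diag_apply, noiseCov, Matrix.of_apply]
  rw [← integral_finsetSum _ fun i _ => hi i]
  congr 1 with z
  rw [EuclideanSpace.norm_sq_eq]
  simp [pow_two]

/-! ### Crude bounds for small n, and the leading noise term. -/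

namespace GradientModel

variable {d : ℕ} {Z : Type*} [MeasurableSpace Z] {p μ L τ : ℝ} {Pξ : Measure Z}
  [IsProbabilityMeasure Pξ]
  {gradF : EuclideanSpace ℝ (Fin d) → Z → EuclideanSpace ℝ (Fin d)}
  {θs : EuclideanSpace ℝ (Fin d)}
  {g : EuclideanSpace ℝ (Fin d) → EuclideanSpace ℝ (Fin d)}
  {H : EuclideanSpace ℝ (Fin d) →L[ℝ] EuclideanSpace ℝ (Fin d)}
  {T Φ : EuclideanSpace ℝ (Fin d) →L[ℝ] EuclideanSpace ℝ (Fin d) →L[ℝ]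
      EuclideanSpace ℝ (Fin d)} {γ m q t : ℝ} {θ : EuclideanSpace ℝ (Fin d)} {n : ℕ}

omit [MeasurableSpace Z] in
lemma apply_polyakRuppert_sub (H : EuclideanSpace ℝ (Fin d) →L[ℝ] EuclideanSpace ℝ (Fin d))
    (hn : 0 < n) (θs : EuclideanSpace ℝ (Fin d)) (z : ℕ → Z) :
    H (polyakRuppert gradF γ θ z n - θs) =
      (n : ℝ)⁻¹ • ∑ i ∈ Finset.range n, H (sgdIter gradF γ θ z (n + 1 + i) - θs) := by
  have hn' : (n : ℝ) ≠ 0 := by positivity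
  rw [← map_sum, ← map_smul, polyakRuppert, sum_Icc_eq_sum_range, Finset.sum_sub_distrib,
    Finset.sum_const, Finset.card_range, smul_sub, ← Nat.cast_smul_eq_nsmul ℝ, smul_smul,
    inv_mul_cancel₀ hn', one_smul]

omit [MeasurableSpace Z] in
lemma apply_richardsonRomberg_sub (H : EuclideanSpace ℝ (Fin d) →L[ℝ] EuclideanSpace ℝ (Fin d))
    (θs : EuclideanSpace ℝ (Fin d)) (z : ℕ → Z) :
    H (richardsonRomberg gradF γ θ z n - θs) =
      (2 : ℝ) • H (polyakRuppert gradF γ θ z n - θs)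
        - H (polyakRuppert gradF (2 * γ) θ z n - θs) := by
  rw [← map_smul, ← map_sub, richardsonRomberg]
  congr 1
  module

/-- A crude moment bound for the iterates, for step sizes at most `1 / L`. -/
lemma lpLE_iterate_crude (hm : GradientModel p μ L τ Pξ gradF θs g H T Φ) (hγ : 0 ≤ γ)
    (hγL : γ * L ≤ 1) (k : ℕ) :
    LpLE (Measure.infinitePi fun _ : ℕ => Pξ) p (2 ^ k * (‖θ - θs‖ + τ / L))
      fun z => sgdIter gradF γ θ z k - θs := by
  have hp := hm.two_le
  have hL := hm.L_pos
  have hτ := hm.noise_le.nonneg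
  -- One step at most doubles the error and adds τ/L; subtracting τ/L makes the bound reproduce
  -- itself under m ↦ 2m + τ/L.
  suffices LpLE (Measure.infinitePi fun _ : ℕ => Pξ) p (2 ^ k * (‖θ - θs‖ + τ / L) - τ / L)
      fun z => sgdIter gradF γ θ z k - θs from this.mono (by
        have : 0 ≤ τ / L := by positivity
        linarith)
  induction k with
  | zero =>
    simpa [sgdIter] using LpLE.const (P := Measure.infinitePi fun _ : ℕ => Pξ) (q := p)
      (le_refl ‖θ - θs‖) (by linarith)
  | succ k ih =>
    have h1 := (hm.lpLE_diff hp (by linarith) ih).add (hm.lpLE_noise (q := p) (by linarith) (k + 1))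
      (by linarith)
    have h2 := ih.sub (h1.const_smul hγ) (by linarith)
    have e : ∀ z : ℕ → Z, sgdIter gradF γ θ z (k + 1) - θs = sgdIter gradF γ θ z k - θs
        - γ • (gradF (sgdIter gradF γ θ z k) (z (k + 1)) - gradF θs (z (k + 1))
          + gradF θs (z (k + 1))) := fun z => by
      rw [sgdIter, sub_add_cancel]; abel
    simp only [e]
    refine h2.mono ?_
    set m := 2 ^ k * (‖θ - θs‖ + τ / L) - τ / L with hmdef
    have hm0 : 0 ≤ m := ih.nonneg
    have b1 : γ * (L * m) ≤ m := by
      rw [← mul_assoc]; exact mul_le_of_le_one_left hm0 hγL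
    have b2 : γ * τ ≤ τ / L := by
      rw [le_div_iff₀ hL]
      calc γ * τ * L = γ * L * τ := by ring
        _ ≤ τ := mul_le_of_le_one_left hτ hγL
    have b3 : 2 ^ (k + 1) * (‖θ - θs‖ + τ / L) - τ / L = 2 * m + τ / L := by
      rw [hmdef]; ring
    rw [b3, mul_add]
    linarith

lemma lpLE_polyakRuppert_crude (hm : GradientModel p μ L τ Pξ gradF θs g H T Φ) (hγ : 0 ≤ γ)
    (hγL : γ * L ≤ 1) (hn : 0 < n) :
    LpLE (Measure.infinitePi fun _ : ℕ => Pξ) p (L * 4 ^ n * (‖θ - θs‖ + τ / L))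
      fun z => H (polyakRuppert gradF γ θ z n - θs) := by
  have hp := hm.two_le
  have hL := hm.L_pos
  have hτ := hm.noise_le.nonneg
  have hn' : (0 : ℝ) < n := by exact_mod_cast hn
  simp only [apply_polyakRuppert_sub H hn]
  have h1 : ∀ i ∈ Finset.range n, LpLE (Measure.infinitePi fun _ : ℕ => Pξ) p
      (L * 4 ^ n * (‖θ - θs‖ + τ / L))
      fun z => H (sgdIter gradF γ θ z (n + 1 + i) - θs) := fun i hi => by
    refine ((hm.lpLE_iterate_crude hγ hγL (n + 1 + i)).of_norm_le
      (H.measurable.comp ((hm.measurable_iter γ θ _).sub_const θs)).aestronglyMeasurable hL.le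
      fun z => (H.le_opNorm _).trans (by gcongr; exact hm.norm_H_le)).mono ?_
    rw [← mul_assoc]
    gcongr
    -- The averaged indices n + 1 + i are at most 2n, so 2^(2n) = 4^n dominates.
    rw [show (4 : ℝ) = 2 ^ 2 by norm_num, ← pow_mul]
    have := Finset.mem_range.1 hi
    exact pow_le_pow_right₀ (by norm_num) (by omega)
  refine ((LpLE.sum (by linarith) h1).const_smul (c := (n : ℝ)⁻¹) (by positivity)).mono
    (le_of_eq ?_)
  rw [Finset.sum_const, Finset.card_range, nsmul_eq_mul, inv_mul_cancel_left₀ hn'.ne']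

lemma lpLE_richardsonRomberg_crude (hm : GradientModel p μ L τ Pξ gradF θs g H T Φ) (hγ : 0 ≤ γ)
    (hγL : γ * L ≤ 1 / 2) (hn : 0 < n) :
    LpLE (Measure.infinitePi fun _ : ℕ => Pξ) p (3 * L * 4 ^ n * (‖θ - θs‖ + τ / L))
      fun z => H (richardsonRomberg gradF γ θ z n - θs) := by
  have hp := hm.two_le
  simp only [apply_richardsonRomberg_sub]
  have h1 := hm.lpLE_polyakRuppert_crude (θ := θ) hγ (by linarith) hn
  have h2 := hm.lpLE_polyakRuppert_crude (θ := θ) (γ := 2 * γ) (by linarith) (by linarith) hn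
  exact ((h1.const_smul (c := 2) (by norm_num)).sub h2 (by linarith)).mono (le_of_eq (by ring))

/-- The leading term: the average of the noise at the minimizer. -/
lemma lpLE_noise_average (hm : GradientModel p μ L τ Pξ gradF θs g H T Φ) (ht : 0 < t)
    (ht1 : t ≤ 1) (htn : t ^ 4 * n = 1) :
    LpLE (Measure.infinitePi fun _ : ℕ => Pξ) p
      (4 * (√((noiseCov Pξ gradF θs).trace) * √p / √(n : ℝ)) + sumConst (max p 4) * τ * t ^ 3)
      fun z => (n : ℝ)⁻¹ • ∑ i ∈ Finset.range n, gradF θs (z (n + 1 + i + 1)) := by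
  have hp := hm.two_le
  have hτ := hm.noise_le.nonneg
  -- Rosenthal is applied at order max p 4, which is at most 2p: its second term is then n^(1/q - 1)
  -- ≤ n^(-3/4) even when p < 4, and monotonicity of the norms returns to p.
  have hq : 2 ≤ max p 4 := hp.trans (le_max_left _ _)
  have hq4 : 4 ≤ max p 4 := le_max_right _ _
  have hqp : max p 4 ≤ 2 * p := max_le (by linarith) (by linarith)
  have hmF : Measurable (gradF θs) := hm.measurable.comp (measurable_const.prodMk measurable_id)
  have hn : (n : ℝ) = (1 / t) ^ 4 := by field_simp; linarith
  have hn0 : (0 : ℝ) < n := by rw [hn]; positivity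
  have h0 : ∫ z, gradF θs z ∂Pξ = 0 := by rw [hm.unbiased, hm.g_zero]
  have h1 := (lpLE_iid_sum (ξ := fun (k : ℕ) (z : ℕ → Z) => z k) hq hτ
    (fun _ => measurable_pi_apply _) (map_eval_infinitePi Pξ) (iIndepFun_eval_infinitePi Pξ)
    hmF (hm.integrable θs) h0 (n + 1) n fun k => hm.lpLE_noise (by linarith) k).const_smul
    (c := (n : ℝ)⁻¹) (by positivity)
  refine (h1.exponent_mono (le_max_left p 4)).mono ?_
  rw [trace_noiseCov (hm.noise_le.exponent_mono (by linarith)) hmF, mul_add]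
  have hs : (n : ℝ)⁻¹ * √n = 1 / √n := by rw [inv_mul_eq_div, Real.sqrt_div_self']
  have e1 : √(6 * max p 4) ≤ 4 * √p := by
    rw [Real.sqrt_le_left (by positivity), mul_pow, Real.sq_sqrt (by linarith)]
    linarith
  have e2 : (n : ℝ)⁻¹ * (n : ℝ) ^ (1 / max p 4) ≤ t ^ 3 := by
    have : (n : ℝ) ^ (1 / max p 4) ≤ 1 / t := by
      calc (n : ℝ) ^ (1 / max p 4) ≤ (n : ℝ) ^ (1 / 4 : ℝ) := by
            refine Real.rpow_le_rpow_of_exponent_le ?_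
              (one_div_le_one_div_of_le (by norm_num) hq4)
            rw [hn]; exact one_le_pow₀ ((one_le_div ht).2 ht1)
        _ = 1 / t := by
            rw [hn, ← Real.rpow_natCast, ← Real.rpow_mul (by positivity)]; norm_num
    calc _ ≤ (n : ℝ)⁻¹ * (1 / t) := by gcongr
      _ = t ^ 3 := by rw [hn]; field_simp
  have hτ' : 0 ≤ sumConst (max p 4) * τ := mul_nonneg (sumConst_nonneg hq) hτ
  refine add_le_add ?_ ?_
  · calc _ = √(6 * max p 4) * √(∫ z, ‖gradF θs z‖ ^ 2 ∂Pξ) * ((n : ℝ)⁻¹ * √n) := by ring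
      _ ≤ 4 * √p * √(∫ z, ‖gradF θs z‖ ^ 2 ∂Pξ) * ((n : ℝ)⁻¹ * √n) := by gcongr
      _ = _ := by rw [hs]; ring
  · calc _ = sumConst (max p 4) * τ * ((n : ℝ)⁻¹ * (n : ℝ) ^ (1 / max p 4)) := by ring
      _ ≤ _ := by gcongr

end GradientModel

/-! ### The expansion for both chains and their extrapolation. -/

namespace GradientModel

variable {d : ℕ} {Z : Type*} [MeasurableSpace Z] {p μ L τ : ℝ} {Pξ : Measure Z}
  [IsProbabilityMeasure Pξ]
  {gradF : EuclideanSpace ℝ (Fin d) → Z → EuclideanSpace ℝ (Fin d)}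
  {θs : EuclideanSpace ℝ (Fin d)}
  {g : EuclideanSpace ℝ (Fin d) → EuclideanSpace ℝ (Fin d)}
  {H : EuclideanSpace ℝ (Fin d) →L[ℝ] EuclideanSpace ℝ (Fin d)}
  {T Φ : EuclideanSpace ℝ (Fin d) →L[ℝ] EuclideanSpace ℝ (Fin d) →L[ℝ]
      EuclideanSpace ℝ (Fin d)} {γ t D C : ℝ} {θ : EuclideanSpace ℝ (Fin d)} {n : ℕ}

/-- The coefficient of the linear term in the bound for the remainder. -/
noncomputable def linearCoeff (p μ L τ : ℝ) : ℝ :=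
  2 + 2 * L * martConst p + martConst p * (L / μ) * τ

/-- The coefficient of the quadratic term in the bound for the remainder. -/
noncomputable def quadraticCoeff (p μ L : ℝ) : ℝ :=
  L / μ + 2 * martConst p * L * (L / μ) + 4 * (L / μ) * L ^ 2

/-- The coefficient of `n ^ (-3 / 4)` in the bound for the remainder. -/
noncomputable def constCoeff (p μ L τ D : ℝ) : ℝ :=
  linearCoeff p μ L τ * (2 * √(D / μ) * τ)
    + 2 * quadraticCoeff p μ L * (2 * √(D / μ) * τ) ^ 2
    + 4 * (L + L / μ * L) * (2 * √(D / μ) * τ) ^ 3 + 2 * (L / μ) * τ ^ 2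

/-- One bound serves both step sizes t² and 2t²: the smaller step contracts more slowly, and √γ ≤ 2t
in either case. The burn-in up to index n supplies the factor ρ^n. -/
lemma lpLE_remainder_of_momentBounds (hm : GradientModel p μ L τ Pξ gradF θs g H T Φ)
    (hmom : HasMomentBounds (3 * p) Pξ gradF θs μ L τ D C) (ht : 0 < t) (ht1 : t ≤ 1)
    (htn : t ^ 4 * n = 1) (hγ : t ^ 2 ≤ γ) (hγ2 : γ ≤ 2 * t ^ 2) (hγL : γ ≤ 1 / (L * C))
    (hγμ : γ * μ ≤ 1) (hn : 0 < n) :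
    LpLE (Measure.infinitePi fun _ : ℕ => Pξ) p
      (linearCoeff p μ L τ * (√(1 - t ^ 2 * μ) ^ n * ‖θ - θs‖)
        + 2 * quadraticCoeff p μ L * (√(1 - t ^ 2 * μ) ^ n * ‖θ - θs‖) ^ 2
        + 4 * (L + L / μ * L) * (√(1 - t ^ 2 * μ) ^ n * ‖θ - θs‖) ^ 3
        + constCoeff p μ L τ D * t ^ 3)
      fun z => (n : ℝ)⁻¹ • (∑ i ∈ Finset.range n, H (sgdIter gradF γ θ z (n + 1 + i) - θs)
        + ∑ i ∈ Finset.range n, gradF θs (z (n + 1 + i + 1))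
        + (γ / 2) • ∑ i ∈ Finset.range n,
          Φ (gradF θs (z (n + 1 + i + 1))) (gradF θs (z (n + 1 + i + 1)))) := by
  have hp := hm.two_le
  have hL := hm.L_pos
  have hμ := hm.μ_pos
  have hτ := hm.noise_le.nonneg
  have hγ0 : 0 < γ := lt_of_lt_of_le (by positivity) hγ
  have hx : ∀ k, n + 1 ≤ k → LpLE (Measure.infinitePi fun _ : ℕ => Pξ) (3 * p)
      (√(1 - t ^ 2 * μ) ^ n * ‖θ - θs‖ + 2 * √(D / μ) * τ * t)
      fun z => sgdIter gradF γ θ z k - θs := fun k hk => by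
    refine (hmom.lpLE_iterate hp hμ hτ hm.measurable hγ0 hγL hγμ θ k).mono ?_
    have h1 : √(1 - γ * μ) ≤ √(1 - t ^ 2 * μ) := Real.sqrt_le_sqrt (by gcongr)
    have h2 : √(1 - t ^ 2 * μ) ≤ 1 := Real.sqrt_le_one.2 (by
      have : 0 ≤ t ^ 2 * μ := by positivity
      linarith)
    have h3 : √(1 - γ * μ) ^ k ≤ √(1 - t ^ 2 * μ) ^ n :=
      calc _ ≤ √(1 - t ^ 2 * μ) ^ k := by gcongr
        _ ≤ _ := pow_le_pow_of_le_one (Real.sqrt_nonneg _) h2 (by omega)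
    have h4 : √γ ≤ 2 * t := by
      rw [Real.sqrt_le_left (by positivity)]
      nlinarith [pow_pos ht 2]
    calc _ ≤ √(1 - t ^ 2 * μ) ^ n * ‖θ - θs‖ + √(D / μ) * τ * (2 * t) := by gcongr
      _ = _ := by ring
  exact (hm.lpLE_remainder hγ0 ht (by positivity) hn hx).mono
    (remainder_bound_le hμ hL (martConst_nonneg hp) hτ (by positivity) (by positivity)
      ht ht1 htn hγ hγ2)

/-- The Φ(e, e) terms enter as 2·(γ/2) and (2γ)/2 and cancel, while one copy of the noise average
survives. The factor 3 = 2 + 1 counts the remainders of the two chains. -/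
lemma lpLE_richardsonRomberg (hm : GradientModel p μ L τ Pξ gradF θs g H T Φ)
    (hmom : HasMomentBounds (3 * p) Pξ gradF θs μ L τ D C) (ht : 0 < t) (ht1 : t ≤ 1)
    (htn : t ^ 4 * n = 1) (htL : 2 * t ^ 2 ≤ 1 / (L * C)) (htμ : t ^ 2 * μ ≤ 1 / 2)
    (hn : 0 < n) :
    LpLE (Measure.infinitePi fun _ : ℕ => Pξ) p
      (4 * (√((noiseCov Pξ gradF θs).trace) * √p / √(n : ℝ)) + sumConst (max p 4) * τ * t ^ 3
        + 3 * (linearCoeff p μ L τ * (√(1 - t ^ 2 * μ) ^ n * ‖θ - θs‖)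
        + 2 * quadraticCoeff p μ L * (√(1 - t ^ 2 * μ) ^ n * ‖θ - θs‖) ^ 2
        + 4 * (L + L / μ * L) * (√(1 - t ^ 2 * μ) ^ n * ‖θ - θs‖) ^ 3
        + constCoeff p μ L τ D * t ^ 3))
      fun z => H (richardsonRomberg gradF (t ^ 2) θ z n - θs) := by
  have hp := hm.two_le
  have hp1 : 1 ≤ p := by linarith
  have ht2 : 0 < t ^ 2 := by positivity
  have w1 := hm.lpLE_remainder_of_momentBounds (θ := θ) hmom ht ht1 htn le_rfl (by linarith)
    (by linarith) (by linarith) hn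
  have w2 := hm.lpLE_remainder_of_momentBounds (θ := θ) (γ := 2 * t ^ 2) hmom ht ht1 htn
    (by linarith) le_rfl htL (by linarith) hn
  have w0 := hm.lpLE_noise_average ht ht1 htn
  have key := (((w1.const_smul (c := 2) (by norm_num)).sub w2 hp1).sub w0 hp1)
  simp only [apply_richardsonRomberg_sub, apply_polyakRuppert_sub H hn]
  have e : ∀ a b s u : EuclideanSpace ℝ (Fin d),
      (2 : ℝ) • ((n : ℝ)⁻¹ • a) - (n : ℝ)⁻¹ • b =
      (2 : ℝ) • ((n : ℝ)⁻¹ • (a + s + (t ^ 2 / 2) • u))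
        - (n : ℝ)⁻¹ • (b + s + (2 * t ^ 2 / 2) • u) - (n : ℝ)⁻¹ • s := fun a b s u => by
    module
  simp only [fun z : ℕ → Z => e
    (∑ i ∈ Finset.range n, H (sgdIter gradF (t ^ 2) θ z (n + 1 + i) - θs))
    (∑ i ∈ Finset.range n, H (sgdIter gradF (2 * t ^ 2) θ z (n + 1 + i) - θs))
    (∑ i ∈ Finset.range n, gradF θs (z (n + 1 + i + 1)))
    (∑ i ∈ Finset.range n, Φ (gradF θs (z (n + 1 + i + 1))) (gradF θs (z (n + 1 + i + 1))))]
  exact key.mono (le_of_eq (by ring))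

end GradientModel

/-- The threshold beyond which the error expansion applies to both chains. -/
noncomputable def thresholdIndex (p μ L C : ℝ) : ℕ :=
  ⌈max (4 * (L * C) ^ 2) (96 * GradientModel.quadraticCoeff p μ L / L)⌉₊

/-- The constant of the term of order `n ^ (-3 / 4)`. -/
noncomputable def errorConst (p μ L τ D C : ℝ) : ℝ :=
  (144 * GradientModel.linearCoeff p μ L τ ^ 2 / L + 3 * GradientModel.constCoeff p μ L τ D
    + sumConst (max p 4) * τ)
  + (3 * L * 4 ^ thresholdIndex p μ L C * (τ / L)
    + (3 * L * 4 ^ thresholdIndex p μ L C) ^ 2 * (μ ^ 2 / L) * 2 ^ (thresholdIndex p μ L C + 1))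
    * thresholdIndex p μ L C

/-! ### Combining the regimes and integrating over the start. -/

section Final

variable {d : ℕ} {Z : Type*} [MeasurableSpace Z] {p μ L τ : ℝ} {Pξ : Measure Z}
  [IsProbabilityMeasure Pξ]
  {gradF : EuclideanSpace ℝ (Fin d) → Z → EuclideanSpace ℝ (Fin d)}
  {θs : EuclideanSpace ℝ (Fin d)}
  {g : EuclideanSpace ℝ (Fin d) → EuclideanSpace ℝ (Fin d)}
  {H : EuclideanSpace ℝ (Fin d) →L[ℝ] EuclideanSpace ℝ (Fin d)}
  {T Φ : EuclideanSpace ℝ (Fin d) →L[ℝ] EuclideanSpace ℝ (Fin d) →L[ℝ]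
      EuclideanSpace ℝ (Fin d)} {t D C : ℝ} {n : ℕ}

lemma GradientModel.linearCoeff_nonneg (hp : 2 ≤ p) (hμ : 0 < μ) (hL : 0 < L) (hτ : 0 ≤ τ) :
    0 ≤ linearCoeff p μ L τ := by
  have := martConst_nonneg hp
  unfold linearCoeff; positivity

lemma GradientModel.quadraticCoeff_nonneg (hp : 2 ≤ p) (hμ : 0 < μ) (hL : 0 < L) :
    0 ≤ quadraticCoeff p μ L := by
  have := martConst_nonneg hp
  unfold quadraticCoeff; positivity

lemma GradientModel.constCoeff_nonneg (hp : 2 ≤ p) (hμ : 0 < μ) (hL : 0 < L) (hτ : 0 ≤ τ) :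
    0 ≤ constCoeff p μ L τ D := by
  have := quadraticCoeff_nonneg hp hμ hL
  have := linearCoeff_nonneg hp hμ hL hτ
  unfold constCoeff; positivity

lemma errorConst_parts_nonneg (hp : 2 ≤ p) (hμ : 0 < μ) (hL : 0 < L) (hτ : 0 ≤ τ) :
    0 ≤ 144 * GradientModel.linearCoeff p μ L τ ^ 2 / L + 3 * GradientModel.constCoeff p μ L τ D
        + sumConst (max p 4) * τ ∧
      0 ≤ (3 * L * 4 ^ thresholdIndex p μ L C * (τ / L)
        + (3 * L * 4 ^ thresholdIndex p μ L C) ^ 2 * (μ ^ 2 / L)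
          * 2 ^ (thresholdIndex p μ L C + 1)) * thresholdIndex p μ L C := by
  have := GradientModel.constCoeff_nonneg (D := D) hp hμ hL hτ
  have := sumConst_nonneg (q := max p 4) (hp.trans (le_max_left _ _))
  constructor <;> positivity

/-- The bound for a deterministic starting point. -/
lemma lpLE_richardsonRomberg_of_init (hm : GradientModel p μ L τ Pξ gradF θs g H T Φ)
    (hmom : HasMomentBounds (3 * p) Pξ gradF θs μ L τ D C) (hμL : μ ≤ L) (ht : 0 < t)
    (htn : t ^ 4 * n = 1) (hn : (L * C) ^ 2 ≤ n) (θ : EuclideanSpace ℝ (Fin d)) :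
    LpLE (Measure.infinitePi fun _ : ℕ => Pξ) p
      (12 * (√((noiseCov Pξ gradF θs).trace) * √p / √(n : ℝ)) + errorConst p μ L τ D C * t ^ 3
        + (12 * (L * √(1 - t ^ 2 * μ) ^ (n + 1) * p ^ 2 / (t ^ 2 * μ ^ 2)) * ‖θ - θs‖ ^ 2
          + 12 * (L * √(1 - t ^ 2 * μ) ^ (3 * n) / (t ^ 2 * μ)) * ‖θ - θs‖ ^ 3))
      fun z => H (richardsonRomberg gradF (t ^ 2) θ z n - θs) := by
  have hp := hm.two_le
  have hL := hm.L_pos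
  have hμ := hm.μ_pos
  have hτ := hm.noise_le.nonneg
  have hC := hmom.two_le_step
  have hn0 : 0 < n := by
    rcases Nat.eq_zero_or_pos n with rfl | h
    · simp at htn
    · exact h
  have hn1 : (1 : ℝ) ≤ n := by exact_mod_cast hn0
  have ht1 : t ≤ 1 := by
    by_contra hlt
    have := one_lt_pow₀ (not_le.1 hlt) (n := 4) (by norm_num)
    nlinarith
  have hstep : ∀ a : ℝ, 0 ≤ a → a ^ 2 ≤ n → a * t ^ 2 ≤ 1 := fun a ha h => by
    refine (sq_le_one_iff₀ (by positivity)).1 ?_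
    calc (a * t ^ 2) ^ 2 = t ^ 4 * a ^ 2 := by ring
      _ ≤ t ^ 4 * n := by gcongr
      _ = 1 := htn
  have htL : t ^ 2 * L ≤ 1 / 2 := by
    have h1 := hstep (L * C) (by positivity) hn
    have h2 : L * 2 * t ^ 2 ≤ L * C * t ^ 2 := by gcongr
    linarith
  have htμ : t ^ 2 * μ ≤ 1 / 2 := le_trans (by gcongr) htL
  obtain ⟨hK1, hK2⟩ := errorConst_parts_nonneg (D := D) (C := C) hp hμ hL hτ
  have hlead : 0 ≤ √((noiseCov Pξ gradF θs).trace) * √p / √(n : ℝ) := by positivity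
  have hK1' := mul_nonneg hK1 (pow_nonneg ht.le 3)
  have hK2' := mul_nonneg hK2 (pow_nonneg ht.le 3)
  rw [errorConst]
  -- The hypothesis n ≥ (LC)² makes the step γ admissible in the moment bounds, but 2γ requires n ≥
  -- 4(LC)². Below the threshold the crude bound is used, which needs only γL ≤ 1/2, and this
  -- follows from C ≥ 2.
  rcases le_total n (thresholdIndex p μ L C) with h | h
  · refine (hm.lpLE_richardsonRomberg_crude (by positivity) htL hn0).mono ?_
    have := absorb_small (A := 3 * L) (τ' := τ / L) hp hμ hL (by positivity) (by positivity) ht ht1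
      htn htμ (norm_nonneg (θ - θs)) h
    linarith
  · have h' := (Nat.le_ceil _).trans (Nat.cast_le (α := ℝ).2 h)
    have h1 := (le_max_left _ _).trans h'
    have h2 := (le_max_right _ _).trans h'
    have hC2 : 2 * t ^ 2 ≤ 1 / (L * C) := by
      rw [le_div_iff₀ (by positivity)]
      have := hstep (2 * (L * C)) (by positivity) (by linarith)
      linarith
    refine (hm.lpLE_richardsonRomberg hmom ht ht1 htn hC2 htμ hn0).mono ?_
    have := absorb_large (A₁ := GradientModel.linearCoeff p μ L τ)
      (A₅ := GradientModel.constCoeff p μ L τ D) hp hμ hL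
      (GradientModel.quadraticCoeff_nonneg hp hμ hL) ht ht1 htn hμL htL (norm_nonneg (θ - θs)) h2
    linarith

end Final

theorem mainTheorem2 :
    ∃ c₀ : ℝ, 0 < c₀ ∧
      ∀ p μ L τ Clast Cstep : ℝ, 2 ≤ p →
        ∃ K : ℝ, 0 ≤ K ∧
          ∀ (d : ℕ) (Z : Type*) [MeasurableSpace Z] (Pξ : Measure Z) [IsProbabilityMeasure Pξ]
            (f : EuclideanSpace ℝ (Fin d) → ℝ)
            (gradF : EuclideanSpace ℝ (Fin d) → Z → EuclideanSpace ℝ (Fin d))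
            (θs : EuclideanSpace ℝ (Fin d)) (L₁ L₂ L₃ L₄ : ℝ),
            L = max (max L₁ L₂) (max L₃ L₄) →
            IsMinOn f Set.univ θs →
            IsStronglyConvex f μ →
            IsSmoothObjective f L₂ L₃ L₄ →
            IsStochasticGradient (3 * p) Pξ f gradF θs τ L₁ →
            HasMomentBounds (3 * p) Pξ gradF θs μ L τ Clast Cstep →
            ∀ (Ω : Type*) [MeasurableSpace Ω] (P : Measure Ω) [IsProbabilityMeasure P]
              (ν : Measure (EuclideanSpace ℝ (Fin d)))
              (θ₀ : Ω → EuclideanSpace ℝ (Fin d)) (ξ : ℕ → Ω → Z),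
              IsSGDInput P ν Pξ θ₀ ξ →
              ∀ n : ℕ, (L * Cstep) ^ 2 ≤ (n : ℝ) →
                absMoment P
                    (fun ω => hessian f θs
                      (richardsonRomberg gradF ((n : ℝ) ^ (-(1 / 2) : ℝ)) (θ₀ ω)
                        (fun k => ξ k ω) n - θs)) p ^ (1 / p) ≤
                  ENNReal.ofReal
                      (c₀ * (√((noiseCov Pξ gradF θs).trace) * √p / √(n : ℝ))) +
                    ENNReal.ofReal (K * (n : ℝ) ^ (-(3 / 4) : ℝ)) +
                    ENNReal.ofReal c₀ * remainder p μ L ν θs n ((n : ℝ) ^ (-(1 / 2) : ℝ)) := by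
  -- The constant 12 is imposed by the cubic term in the initial error. `K` is chosen before any
  -- sign of the parameters is known, hence the maximum with 0.
  refine ⟨12, by norm_num, fun p μ L τ D C hp => ⟨max (errorConst p μ L τ D C) 0, le_max_right _ _,
    fun d Z _ Pξ _ f gradF θs L₁ L₂ L₃ L₄ hL hmin hc hs hg hmom Ω _ P _ ν θ₀ ξ hin n hn => ?_⟩⟩
  have hp0 : 0 < p := by linarith
  -- In dimension zero both sides are trivial, but μ ≤ L can fail: it is proved with a nonzero
  -- vector.
  rcases eq_or_ne d 0 with rfl | hd
  · have h0 : ∀ x : EuclideanSpace ℝ (Fin 0), x = 0 := fun x => Subsingleton.elim x 0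
    simp [absMoment, h0 (hessian f θs _), hp0, ENNReal.zero_rpow_of_pos]
  obtain ⟨T, Φ, hm⟩ := exists_gradientModel hp hL hmin hc hs hg
  have hL0 := hm.L_pos
  have hμ := hm.μ_pos
  have hC := hmom.two_le_step
  have hμL : μ ≤ L := (hc.le_lipschitz_const hs hd).trans
    (hL ▸ (le_max_right _ _).trans (le_max_left _ _))
  have hn0 : (0 : ℝ) < n := lt_of_lt_of_le (by positivity) hn
  set t : ℝ := (n : ℝ) ^ (-(1 / 4) : ℝ) with ht
  have ht0 : 0 < t := by positivity
  have t2 : (n : ℝ) ^ (-(1 / 2) : ℝ) = t ^ 2 := by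
    rw [ht, rpow_neg_quarter_pow]; norm_num
  have t3 : (n : ℝ) ^ (-(3 / 4) : ℝ) = t ^ 3 := by
    rw [ht, rpow_neg_quarter_pow]; norm_num
  have t4 : t ^ 4 * n = 1 := by
    rw [ht, rpow_neg_quarter_pow]; norm_num [Real.rpow_neg_one, hn0.ne']
  have hpt := lpLE_richardsonRomberg_of_init hm hmom hμL ht0 t4 hn
  have hK : 0 ≤ errorConst p μ L τ D C := by
    obtain ⟨h1, h2⟩ := errorConst_parts_nonneg (D := D) (C := C) hp hμ hL0 hm.noise_le.nonneg
    exact add_nonneg h1 h2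
  have htμ : t ^ 2 * μ ≤ 1 := by
    have h1 : (t ^ 2 * (L * 2)) ^ 2 ≤ 1 := by
      have : (L * 2) ^ 2 ≤ (n : ℝ) := le_trans (by gcongr) hn
      calc (t ^ 2 * (L * 2)) ^ 2 = t ^ 4 * (L * 2) ^ 2 := by ring
        _ ≤ t ^ 4 * n := by gcongr
        _ = 1 := t4
    have h2 := (sq_le_one_iff₀ (by positivity)).1 h1
    have h3 : t ^ 2 * μ ≤ t ^ 2 * (L * 2) := by gcongr; linarith
    linarith
  have hlead : 0 ≤ √((noiseCov Pξ gradF θs).trace) * √p / √(n : ℝ) := by positivity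
  have hF : Measurable (Function.uncurry fun (θ : EuclideanSpace ℝ (Fin d)) (z : ℕ → Z) =>
      hessian f θs (richardsonRomberg gradF (t ^ 2) θ z n - θs)) :=
    (hessian f θs).measurable.comp ((measurable_richardsonRomberg hm.measurable _ n).sub_const θs)
  have key := absMoment_le_of_forall_init hin hp (by positivity) (by positivity) (by positivity)
    hF hpt
  have r1 : √(1 - t ^ 2 * μ) ^ (n + 1) = (1 - t ^ 2 * μ) ^ (((n : ℝ) + 1) / 2) := by
    rw [sqrt_pow_eq_rpow (by linarith)]; push_cast; rfl
  have r2 : √(1 - t ^ 2 * μ) ^ (3 * n) = (1 - t ^ 2 * μ) ^ (3 / 2 * (n : ℝ)) := by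
    rw [sqrt_pow_eq_rpow (by linarith)]; congr 1; push_cast; ring
  rw [t2, t3, max_eq_left hK]
  refine key.trans ?_
  rw [ENNReal.ofReal_add (by positivity) (by positivity)]
  gcongr
  rw [ENNReal.ofReal_mul (by norm_num), ENNReal.ofReal_mul (by norm_num),
    mul_assoc (ENNReal.ofReal 12), mul_assoc (ENNReal.ofReal 12), ← mul_add, r1, r2]
  gcongr
  -- Only the terms with moments of order 2p and 3p were used; the two with moments of order p are
  -- discarded as nonnegative.
  rw [remainder, add_assoc]
  exact le_add_self
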